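/- **Setting.** Let $d>4$, $\Omega=2d$, $\beta\in(0,1)$. For $n\ge 0$ and $x\in\mathbb Z^d$ let $\mathcal W_n(x)$ be the set of $n$-step nearest-neighbour walks $\omega=(\omega(0),\dots,\omega(n))$ in $\mathbb Z^d$ with $\omega(0)=0$, $\omega(n)=x$, and let $U_{st}(\omega)=-1$ if $\omega(s)=\omega(t)$ and $U_{st}(\omega)=0$ otherwise. For $z\ge0$ let $$C_z(x)=\sum_{n\ge0}\sum_{\omega\in\mathcal W_n(x)}z^n,\qquad G_z(x)=\sum_{n\ge 0}\sum_{\omega\in\mathcal W_n(x)}z^n\prod_{0\le s<t\le n}(1+\beta U_{st}(\omega)),\qquad \chi(z)=\sum_xG_z(x),$$ with values in $[0,\infty]$, let $z_c=z_c(\beta)=\sup\{z\ge0:\chi(z)<\infty\}$, and let $b(z)=\sup_x G_z(x)/C_{1/\Omega}(x)$. Let $\delta$ be the Kronecker delta at $0$, and $D(x)=\frac1{2d}$ if $\|x\|_1=1$, $D(x)=0$ otherwise. The lace expansion function is $$\Pi_z(x)=\sum_{m\ge0} z^m\sum_{\omega\in\mathcal W_m(x)}\ \sum_{\Gamma}\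 \prod_{st\in\Gamma}\beta U_{st}(\omega),$$ where $\Gamma$ runs over the connected graphs on $[0,m]$, i.e. the sets of pairs $st$, $0\le s<t\le m$, such that $0$ and $m$ are endpoints of elements of $\Gamma$ and each integer $c$ with $0<c<m$ satisfies $s<c<t$ for some $st\in\Gamma$ (the terms $m=0,1$ vanish). Let $A_\mu=\delta-\mu\Omega D$, $F_z=\delta-z\Omega D-\Pi_z$, and $$\lambda_z=\frac1{1-\hat\Pi_z(0)+\sum_x|x|^2\Pi_z(x)},\qquad \mu_z\Omega=1-\lambda_z\hat F_z(0),\qquad E_z=A_{\mu_z}-\lambda_zF_z ,$$ where $\hat f(k)=\sum_xf(x)e^{ik\cdot x}$ for $k\in\mathbb T^d=(\mathbb R/2\pi\mathbb Z)^d$ and summable $f$. Let $\hat C_\mu$ be the Fourier transform of $C_\mu$ if $C_\mu$ is summable (i.e. $\mu<1/\Omega$) and $\hat C_\mu=1/\hat A_\mu$ otherwise (i.e. $\mu=1/\Omega$). Let $\hat G_z$ be the Fourier transform of $G_z$ if $\chi(z)<\infty$ (i.e. $z<z_c$) and $\hat G_z=1/\hat F_z$ otherwise (i.e. $z=z_c$).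 Put $$\hat f_z=\hat C_{\mu_z}\hat E_z\hat G_z .$$ Finally, let $n_d=d-2$ if $d=5$ and $n_d=d-1$ if $d\ge6$. **Proposition 3.3.** Let $d>4$. There are $\beta_0\in(0,1)$ and $K>0$, depending only on $d$, such that the following holds for all $\beta\in(0,\beta_0]$ and all $z\in[1/\Omega,z_c]$ with $b(z)\le3$. 1. $\hat f_z$ is well defined: the series for $\Pi_z(x)$, $\hat\Pi_z(0)$ and $\sum_x|x|^2\Pi_z(x)$ converge absolutely, $\lambda_z$ is well defined and positive, $\mu_z\in[0,1/\Omega]$, and $\hat A_{\mu_z}$, $\hat F_z$ do not vanish on $\mathbb T^d\setminus\{0\}$. 2. $\hat f_z\in C^{n_d}(\mathbb T^d\setminus\{0\})$, and for every multi-index $\alpha$ with $|\alpha|\le n_d$ the derivative $\nabla^\alpha\hat f_z$ (classical away from $k=0$) is integrable on $\mathbb T^d$, is also the weak derivative of $\hat f_z$ of order $\alpha$ on $\mathbb T^d$, and obeys $$\|\nabla^\alpha\hat f_z\|_{L^1(\mathbb T^d)}=\int_{[-\pi,\pi]^d}|\nabla^\alpha\hat f_z(k)|\,dk\le K\beta .$$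 -/

import Mathlib

namespace WSAW

open scoped ENNReal BigOperators

/-! ### Walks and two-point functions -/

/-- The `n`-step nearest-neighbour walks `ω = (ω(0), …, ω(n))` on `ℤ^d` from `0` to `x`. -/
def walkSet (d n : ℕ) (x : Fin d → ℤ) : Set (Fin (n + 1) → Fin d → ℤ) :=
  {ω | ω 0 = 0 ∧ ω (Fin.last n) = x ∧
    ∀ i : Fin n, ∑ j, |ω i.succ j - ω i.castSucc j| = 1}

theorem walkSet_finite (d n : ℕ) (x : Fin d → ℤ) : (walkSet d n x).Finite := by
  refine (Set.finite_Icc (fun (_ : Fin (n + 1)) (_ : Fin d) => -(n : ℤ))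
    (fun _ _ => (n : ℤ))).subset ?_
  rintro ω ⟨h0, -, hs⟩
  have key : ∀ i : Fin (n + 1), ∀ j, |ω i j| ≤ ((i : ℕ) : ℤ) := by
    intro i
    induction i using Fin.induction with
    | zero => intro j; simp [h0]
    | succ i ih =>
      intro j
      have h1 : |ω i.succ j - ω i.castSucc j| ≤ 1 := by
        rw [← hs i]
        exact Finset.single_le_sum (f := fun j => |ω i.succ j - ω i.castSucc j|)
          (fun _ _ => abs_nonneg _) (Finset.mem_univ j)
      have h2 := ih j
      simp only [Fin.val_castSucc, Fin.val_succ] at h2 ⊢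
      push_cast
      rw [abs_le] at *
      constructor <;> linarith [h1.1, h1.2, h2.1, h2.2]
  have hb : ∀ i j, |ω i j| ≤ (n : ℤ) := fun i j =>
    (key i j).trans (by exact_mod_cast Nat.lt_succ_iff.mp i.2)
  exact ⟨fun i j => (abs_le.mp (hb i j)).1, fun i j => (abs_le.mp (hb i j)).2⟩

/-- `𝒲_n(x)` as a finite set. -/
noncomputable def walks (d n : ℕ) (x : Fin d → ℤ) : Finset (Fin (n + 1) → Fin d → ℤ) :=
  (walkSet_finite d n x).toFinset

/-- `U_{st}(ω)`, equal to `-1` if `ω(s) = ω(t)` and to `0` otherwise. -/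
noncomputable def U {d n : ℕ} (ω : Fin (n + 1) → Fin d → ℤ) (s t : Fin (n + 1)) : ℝ :=
  if ω s = ω t then -1 else 0

/-- The edges on the interval `[0, n]`: the pairs `st` with `0 ≤ s < t ≤ n`. -/
def edges (n : ℕ) : Finset (Fin (n + 1) × Fin (n + 1)) :=
  Finset.univ.filter fun e => e.1 < e.2

/-- The simple random walk two-point function `C_z(x) = ∑_n ∑_{ω ∈ 𝒲_n(x)} z^n`
(for `z ≥ 0`), with values in `[0, ∞]`. -/
noncomputable def C (d : ℕ) (z : ℝ) (x : Fin d → ℤ) : ℝ≥0∞ :=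
  ∑' n : ℕ, ∑ _ω ∈ walks d n x, ENNReal.ofReal (z ^ n)

/-- The weakly self-avoiding walk two-point function
`G_z(x) = ∑_n ∑_{ω ∈ 𝒲_n(x)} z^n ∏_{0 ≤ s < t ≤ n} (1 + β U_{st}(ω))`
(for `0 < β < 1` and `z ≥ 0`), with values in `[0, ∞]`. -/
noncomputable def G (d : ℕ) (β z : ℝ) (x : Fin d → ℤ) : ℝ≥0∞ :=
  ∑' n : ℕ, ∑ ω ∈ walks d n x,
    ENNReal.ofReal (z ^ n * ∏ e ∈ edges n, (1 + β * U ω e.1 e.2))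

/-- The susceptibility `χ(z) = ∑_x G_z(x)`. -/
noncomputable def chi (d : ℕ) (β z : ℝ) : ℝ≥0∞ := ∑' x, G d β z x

/-- The critical point `z_c(β)`: the supremum of the `z ≥ 0` at which `χ(z)` is finite. -/
noncomputable def zc (d : ℕ) (β : ℝ) : ℝ := sSup {z : ℝ | 0 ≤ z ∧ chi d β z < ∞}

/-- The bootstrap function `b(z) = sup_x G_z(x) / C_{1/Ω}(x)`, `Ω = 2d`. -/
noncomputable def b (d : ℕ) (β z : ℝ) : ℝ≥0∞ :=
  ⨆ x : Fin d → ℤ, G d β z x / C d (1 / (2 * d)) x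

/-! ### The lace expansion -/

/-- A graph (set of edges) on `[0, m]` is connected if `0` and `m` are endpoints of edges of it
and every `c` with `0 < c < m` satisfies `s < c < t` for some edge `st` of it. -/
def IsConnectedGraph {m : ℕ} (Γ : Finset (Fin (m + 1) × Fin (m + 1))) : Prop :=
  (∃ e ∈ Γ, e.1 = 0 ∨ e.2 = 0) ∧ (∃ e ∈ Γ, e.1 = Fin.last m ∨ e.2 = Fin.last m) ∧
    ∀ c : Fin (m + 1), 0 < c → c < Fin.last m → ∃ e ∈ Γ, e.1 < c ∧ c < e.2

open Classical in
/-- `J[0,m](ω) = ∑_Γ ∏_{st ∈ Γ} β U_{st}(ω)`, the sum over connected graphs `Γ` on `[0, m]`. -/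
noncomputable def J {d m : ℕ} (β : ℝ) (ω : Fin (m + 1) → Fin d → ℤ) : ℝ :=
  ∑ Γ ∈ (edges m).powerset.filter IsConnectedGraph, ∏ e ∈ Γ, β * U ω e.1 e.2

/-- `π_m(x) = ∑_{ω ∈ 𝒲_m(x)} J[0,m](ω)`. -/
noncomputable def lacePi (d : ℕ) (β : ℝ) (m : ℕ) (x : Fin d → ℤ) : ℝ :=
  ∑ ω ∈ walks d m x, J β ω

/-- `Π_z(x) = ∑_m π_m(x) z^m` (the terms `m = 0, 1` vanish). -/
noncomputable def PiZ (d : ℕ) (β z : ℝ) (x : Fin d → ℤ) : ℝ :=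
  ∑' m : ℕ, lacePi d β m x * z ^ m

/-- The Kronecker delta `δ(x) = δ_{0,x}`. -/
noncomputable def delta (d : ℕ) (x : Fin d → ℤ) : ℝ := if x = 0 then 1 else 0

/-- `D(x) = 1/(2d)` if `‖x‖₁ = 1` and `D(x) = 0` otherwise. -/
noncomputable def D (d : ℕ) (x : Fin d → ℤ) : ℝ := if ∑ j, |x j| = 1 then 1 / (2 * d) else 0

/-- `|x|²`, the square of the Euclidean norm. -/
def normSq {d : ℕ} (x : Fin d → ℤ) : ℝ := ∑ j, (x j : ℝ) ^ 2

/-- `A_μ = δ - μ Ω D`. -/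
noncomputable def A (d : ℕ) (μ : ℝ) (x : Fin d → ℤ) : ℝ := delta d x - μ * (2 * d) * D d x

/-- `F_z = δ - z Ω D - Π_z`. -/
noncomputable def F (d : ℕ) (β z : ℝ) (x : Fin d → ℤ) : ℝ :=
  delta d x - z * (2 * d) * D d x - PiZ d β z x

/-- `1 - Π̂_z(0) + ∑_x |x|² Π_z(x)`, the reciprocal of `λ_z`. -/
noncomputable def lamDenom (d : ℕ) (β z : ℝ) : ℝ :=
  1 - ∑' x, PiZ d β z x + ∑' x, normSq x * PiZ d β z x

/-- `λ_z`. -/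
noncomputable def lam (d : ℕ) (β z : ℝ) : ℝ := 1 / lamDenom d β z

/-- `μ_z`, given by `μ_z Ω = 1 - λ_z F̂_z(0)`. -/
noncomputable def mu (d : ℕ) (β z : ℝ) : ℝ := (1 - lam d β z * ∑' x, F d β z x) / (2 * d)

/-- `E_z = A_{μ_z} - λ_z F_z`. -/
noncomputable def E (d : ℕ) (β z : ℝ) (x : Fin d → ℤ) : ℝ :=
  A d (mu d β z) x - lam d β z * F d β z x

/-! ### Fourier transforms -/

/-- `f̂(k) = ∑_x f(x) e^{i k·x}` for summable `f`, as a `2π`-periodic function on `ℝ^d`. -/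
noncomputable def fourier {d : ℕ} (f : (Fin d → ℤ) → ℝ) (k : Fin d → ℝ) : ℂ :=
  ∑' x, (f x : ℂ) * Complex.exp (Complex.I * ((∑ j, k j * (x j : ℝ) : ℝ) : ℂ))

open Classical in
/-- `Ĉ_μ(k)`: the Fourier series of `C_μ` when `C_μ` is summable (`μ < 1/Ω`), and `1 / Â_μ(k)`
when it is not (`μ = 1/Ω`). -/
noncomputable def Chat (d : ℕ) (μ : ℝ) (k : Fin d → ℝ) : ℂ :=
  if ∑' x, C d μ x < ∞ then fourier (fun x => (C d μ x).toReal) k else 1 / fourier (A d μ) k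

open Classical in
/-- `Ĝ_z(k)`: the Fourier series of `G_z` when `χ(z) < ∞` (`z < z_c`), and `1 / F̂_z(k)`
when `χ(z) = ∞` (`z = z_c`). -/
noncomputable def Ghat (d : ℕ) (β z : ℝ) (k : Fin d → ℝ) : ℂ :=
  if chi d β z < ∞ then fourier (fun x => (G d β z x).toReal) k else 1 / fourier (F d β z) k

/-- `f̂_z = Ĉ_{μ_z} Ê_z Ĝ_z`. -/
noncomputable def fhat (d : ℕ) (β z : ℝ) (k : Fin d → ℝ) : ℂ :=
  Chat d (mu d β z) k * fourier (E d β z) k * Ghat d β z k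

/-! ### Derivatives on the torus -/

/-- The partial derivative `∇_i g`. -/
noncomputable def partialD {d : ℕ} (i : Fin d) (g : (Fin d → ℝ) → ℂ) (k : Fin d → ℝ) : ℂ :=
  lineDeriv ℝ g k (Pi.single i 1)

/-- `∇^α g = ∇_1^{α_1} ⋯ ∇_d^{α_d} g` for a multi-index `α`. -/
noncomputable def nabla {d : ℕ} (α : Fin d → ℕ) (g : (Fin d → ℝ) → ℂ) : (Fin d → ℝ) → ℂ :=
  Fin.foldr d (fun i h => (partialD i)^[α i] h) g

/-- The points of `(2πℤ)^d`, i.e. the points of `ℝ^d` that represent `0` in the torus. -/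
def zeroLattice (d : ℕ) : Set (Fin d → ℝ) :=
  {k | ∀ i, ∃ m : ℤ, k i = 2 * Real.pi * m}

/-- The fundamental domain `[-π, π]^d` of the torus. -/
def box (d : ℕ) : Set (Fin d → ℝ) := Set.Icc (fun _ => -Real.pi) (fun _ => Real.pi)

/-- A smooth function on the torus, as a `2π`-periodic function on `ℝ^d`. -/
def IsTorusTest {d : ℕ} (φ : (Fin d → ℝ) → ℂ) : Prop :=
  ContDiff ℝ (⊤ : ℕ∞) φ ∧ ∀ k i, φ (k + Pi.single i (2 * Real.pi)) = φ k

/-- The order of differentiation: `d - 2` for `d = 5`, and `d - 1` for `d ≥ 6`. -/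
def nd (d : ℕ) : ℕ := if d = 5 then d - 2 else d - 1

/-- All quantities that enter `f̂_z` are given by convergent series and non-zero denominators:
the series for `Π_z`, `Π̂_z(0)` and `∑_x |x|² Π_z(x)` converge absolutely, `λ_z` is finite and
positive, `μ_z ∈ [0, 1/Ω]`, and `Â_{μ_z}`, `F̂_z` vanish at most at the zero of the torus. -/
def WellDefined (d : ℕ) (β z : ℝ) : Prop :=
  (∀ x, Summable fun m : ℕ => |lacePi d β m x * z ^ m|) ∧
  (Summable fun x : Fin d → ℤ => (1 + normSq x) * |PiZ d β z x|) ∧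
  0 < lamDenom d β z ∧
  0 ≤ mu d β z ∧ mu d β z ≤ 1 / (2 * d) ∧
  ∀ k ∉ zeroLattice d, fourier (A d (mu d β z)) k ≠ 0 ∧ fourier (F d β z) k ≠ 0

end WSAW

/-! The quotient f̂ = Ê/(Â F̂) is singular only at k = 0. Each of Â and F̂ is bounded below by a
multiple of |k|² there, while the choice of λ and μ makes Ê vanish to fourth order. If Ê has enough
derivatives, of size O(β), then f̂ and its derivatives up to order n_d are O(β) times powers of |k|
no worse than |k|^{-(d-1)}, which is integrable.

The smoothness of Ê comes from moments of Π. The sum over connected graphs is resummed greedily over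
laces (`sum_cover_eq`, `abs_coverSum_le`, `abs_intervalJ_le`), so that every compatible edge
contributes a factor in [0,1] and no cancellation is needed. The lace sum is then dominated by a
recursively defined positive quantity (`abs_listJ_le`), whose generating function satisfies a linear
recursion in G (`laceGen_succ_le`). Since b(z) ≤ 3, G is at most 3C, and the random walk Green
function decays like (1+‖x‖)^{-(d-2)} (`exists_C_le`, from a heat kernel bound by tilted Fourier
inversion). With this decay one step of the recursion costs O(β), which gives absolute bounds on Π
of order β(1+‖x‖)^{-3(d-2)} (`tsum_listJ_le`) and hence n_d moments of size O(β)
(`exists_moment_bound`).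

The renewal structure of the expansion gives Ĝ F̂ = 1 when the susceptibility is finite
(`lace_expansion`). So F̂(0) is positive below the critical point, and nonnegative at it by left
continuity (`tsum_F_nonneg`). This sign and the small second moment of Π bound F̂ below on the whole
torus (`le_norm_fourier_F`). The definitions of λ and μ cancel the zeroth and second moments of E;
lattice symmetry removes the rest below order four (`vanishTo_E`).

The estimates on derivatives are organised as a symbol calculus: `Sym` is stable under products and
inverses, with constants uniform in the functions (`Sym.mul`, `Sym.inv`), and is applied to f̂ in
`exists_sym_fhat`. Classical derivatives are weak ones because almost every line parallel to an axis
misses the singular points, so that Fubini and periodicity leave no boundary term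
(`integral_partialD`). -/

namespace WSAW

/-! ### Graphs on intervals and resummation over laces -/

open Finset

/-- The pairs `(s, t)` with `a ≤ s < t ≤ b`. -/
def pairs (a b : ℕ) : Finset (ℕ × ℕ) := (Icc a b ×ˢ Icc a b).filter fun e => e.1 < e.2

theorem mem_pairs {a b : ℕ} {e : ℕ × ℕ} : e ∈ pairs a b ↔ a ≤ e.1 ∧ e.1 < e.2 ∧ e.2 ≤ b := by
  simp only [pairs, mem_filter, mem_product, mem_Icc]
  omega

/-- `K[a, b]`, the sum over all graphs on `[a, b]`. -/
noncomputable def intervalK (u : ℕ × ℕ → ℝ) (a b : ℕ) : ℝ := ∏ e ∈ pairs a b, (1 + u e)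

/-- Connectedness on `[0, m]`; the condition at `m` is implied by the other ones. -/
def Conn (m : ℕ) (Γ : Finset (ℕ × ℕ)) : Prop :=
  (∃ e ∈ Γ, e.1 < 1) ∧ ∀ c, 0 < c → c < m → ∃ e ∈ Γ, e.1 < c ∧ c < e.2

open Classical in
/-- `J[0, m]`, the sum over connected graphs on `[0, m]`. -/
noncomputable def intervalJ (u : ℕ × ℕ → ℝ) (m : ℕ) : ℝ :=
  ∑ Γ ∈ (pairs 0 m).powerset.filter (Conn m), ∏ e ∈ Γ, u e

theorem sum_powerset_union {α R : Type*} [DecidableEq α] [AddCommMonoid R] {S T : Finset α}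
    (h : Disjoint S T) (f : Finset α → R) :
    ∑ Γ ∈ (S ∪ T).powerset, f Γ = ∑ Γ₁ ∈ S.powerset, ∑ Γ₂ ∈ T.powerset, f (Γ₁ ∪ Γ₂) := by
  rw [← sum_product']
  symm
  refine sum_nbij' (fun p => p.1 ∪ p.2) (fun Γ => (Γ ∩ S, Γ ∩ T)) ?_ ?_ ?_ ?_ ?_
  · rintro ⟨a, b⟩ hab
    simp only [mem_product, mem_powerset] at hab ⊢
    exact union_subset_union hab.1 hab.2
  · intro Γ _
    simp
  · rintro ⟨a, b⟩ hab
    simp only [mem_product, mem_powerset] at hab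
    rw [Finset.disjoint_left] at h
    ext x
    · simp only [mem_inter, mem_union]
      exact ⟨fun ⟨h1, h2⟩ => h1.elim id fun h3 => (h h2 (hab.2 h3)).elim,
        fun h1 => ⟨Or.inl h1, hab.1 h1⟩⟩
    · simp only [mem_inter, mem_union]
      exact ⟨fun ⟨h1, h2⟩ => h1.elim (fun h3 => (h (hab.1 h3) h2).elim) id,
        fun h1 => ⟨Or.inr h1, hab.2 h1⟩⟩
  · intro Γ hΓ
    rw [mem_powerset] at hΓ
    rw [← inter_union_distrib_left]
    exact inter_eq_left.mpr hΓ
  · simp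

theorem prod_union_of_subset {α : Type*} [DecidableEq α] {S T A B : Finset α} (h : Disjoint S T)
    (hA : A ⊆ S) (hB : B ⊆ T) (u : α → ℝ) : ∏ e ∈ A ∪ B, u e = (∏ e ∈ A, u e) * ∏ e ∈ B, u e :=
  prod_union (disjoint_of_subset_left hA (disjoint_of_subset_right hB h))

/-- The cut is the least positive integer that no edge straddles, i.e. the right end of the
connected component of 0. Minimality gives connectedness to its left; a second, larger cut would
need the first one to be straddled. -/
theorem existsUnique_cut {n : ℕ} {Γ : Finset (ℕ × ℕ)} (hΓ : Γ ⊆ pairs 0 n) (h0 : ∃ e ∈ Γ, e.1 < 1) :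
    ∃! m, m ∈ Icc 1 n ∧ (∀ e ∈ Γ, ¬(e.1 < m ∧ m < e.2)) ∧ Conn m (Γ ∩ pairs 0 m) := by
  classical
  obtain ⟨e, he, he0⟩ := h0
  have hen := mem_pairs.1 (hΓ he)
  have hex : ∃ m, 1 ≤ m ∧ ∀ e ∈ Γ, ¬(e.1 < m ∧ m < e.2) := by
    refine ⟨n, by omega, fun e he => ?_⟩
    have := mem_pairs.1 (hΓ he)
    omega
  have hs := Nat.find_spec hex
  set m := Nat.find hex with hm
  refine ⟨m, ⟨?_, hs.2, ?_, ?_⟩, ?_⟩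
  · rw [mem_Icc]
    refine ⟨hs.1, Nat.find_min' hex ⟨by omega, fun e he => ?_⟩⟩
    have := mem_pairs.1 (hΓ he)
    omega
  · refine ⟨e, mem_inter.2 ⟨he, mem_pairs.2 ?_⟩, he0⟩
    have := hs.2 e he
    omega
  · intro c hc hcm
    have h1 := Nat.find_min hex hcm
    push Not at h1
    obtain ⟨e', he', h2⟩ := h1 hc
    refine ⟨e', mem_inter.2 ⟨he', mem_pairs.2 ?_⟩, h2⟩
    have := hs.2 e' he'
    omega
  · rintro m' ⟨hm', hc', hcov'⟩
    rw [mem_Icc] at hm'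
    refine le_antisymm ?_ (Nat.find_min' hex ⟨hm'.1, hc'⟩)
    by_contra hlt
    obtain ⟨e', he', h2⟩ := hcov'.2 m hs.1 (by omega)
    exact hs.2 e' (mem_inter.1 he').1 h2

/-- Graphs without an edge at 0 make up the first term. Every other graph splits, in exactly one
way, into a connected graph on [0,m] and an arbitrary graph on [m,n]. -/
theorem intervalK_eq (u : ℕ × ℕ → ℝ) (n : ℕ) :
    intervalK u 0 n = intervalK u 1 n + ∑ m ∈ Icc 1 n, intervalJ u m * intervalK u m n := by
  classical
  have hcut : ∀ m ∈ Icc 1 n, intervalJ u m * intervalK u m n =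
      ∑ Γ ∈ (pairs 0 n).powerset,
        if (∀ e ∈ Γ, ¬(e.1 < m ∧ m < e.2)) ∧ Conn m (Γ ∩ pairs 0 m) then ∏ e ∈ Γ, u e else 0 := by
    intro m hm
    rw [mem_Icc] at hm
    have hd : Disjoint (pairs 0 m) (pairs m n) := by
      rw [Finset.disjoint_left]
      intro e h1 h2
      rw [mem_pairs] at h1 h2
      omega
    rw [← sum_filter, ← filter_filter, sum_filter]
    have : (pairs 0 n).powerset.filter (fun Γ => ∀ e ∈ Γ, ¬(e.1 < m ∧ m < e.2)) =
        (pairs 0 m ∪ pairs m n).powerset := by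
      ext Γ
      simp only [mem_filter, mem_powerset, subset_iff, mem_union, mem_pairs]
      constructor
      · rintro ⟨h1, h2⟩ e he
        have := h1 he
        have := h2 e he
        omega
      · intro h
        refine ⟨fun e he => ?_, fun e he => ?_⟩ <;> have := h he <;> omega
    rw [this, sum_powerset_union hd, intervalJ, intervalK, prod_one_add, sum_filter, sum_mul]
    refine sum_congr rfl fun A hA => ?_
    rw [mem_powerset] at hA
    rw [mul_sum]
    refine sum_congr rfl fun B hB => ?_
    rw [mem_powerset] at hB
    have h3 : (A ∪ B) ∩ pairs 0 m = A := by
      rw [union_inter_distrib_right, inter_eq_left.2 hA,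
        disjoint_iff_inter_eq_empty.1 (disjoint_of_subset_left hB hd.symm), union_empty]
    rw [h3, prod_union_of_subset hd hA hB]
    split_ifs <;> simp
  rw [sum_congr rfl hcut, sum_comm]
  have hone : intervalK u 1 n =
      ∑ Γ ∈ (pairs 0 n).powerset, if ¬ ∃ e ∈ Γ, e.1 < 1 then ∏ e ∈ Γ, u e else 0 := by
    rw [intervalK, prod_one_add, ← sum_filter]
    refine sum_congr ?_ fun _ _ => rfl
    ext Γ
    simp only [mem_filter, mem_powerset, subset_iff, mem_pairs, not_exists, not_and]
    constructor
    · intro h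
      refine ⟨fun e he => ?_, fun e he => ?_⟩ <;> have := h he <;> omega
    · rintro ⟨h1, h2⟩ e he
      have := h1 he
      have := h2 e he
      omega
  rw [hone, ← sum_add_distrib, intervalK, prod_one_add]
  refine sum_congr rfl fun Γ hΓ => ?_
  rw [mem_powerset] at hΓ
  by_cases h0 : ∃ e ∈ Γ, e.1 < 1
  · obtain ⟨m, ⟨hm1, hm2⟩, huniq⟩ := existsUnique_cut hΓ h0
    rw [if_neg (not_not.2 h0), sum_eq_single_of_mem m hm1, if_pos hm2, zero_add]
    intro m' hm' hne
    exact if_neg fun h => hne (huniq m' ⟨hm', h⟩)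
  · rw [if_pos h0, sum_eq_zero, add_zero]
    intro m _
    refine if_neg fun h => h0 ?_
    obtain ⟨e, he, he0⟩ := h.2.1
    exact ⟨e, (mem_inter.1 he).1, he0⟩

/-- The pairs in `[a, m]` that reach beyond `r`. -/
def beyond (m a r : ℕ) : Finset (ℕ × ℕ) := (pairs a m).filter fun e => r < e.2

theorem mem_beyond {m a r : ℕ} {e : ℕ × ℕ} :
    e ∈ beyond m a r ↔ a ≤ e.1 ∧ e.1 < e.2 ∧ e.2 ≤ m ∧ r < e.2 := by
  simp only [beyond, mem_filter, mem_pairs]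
  omega

open Classical in
/-- The sum over the graphs on `[a, m]`, with edges reaching beyond `b`, that cover `[b, m)`. -/
noncomputable def coverSum (u : ℕ × ℕ → ℝ) (m a b : ℕ) : ℝ :=
  ∑ Γ ∈ (beyond m a b).powerset.filter
    (fun Γ => ∀ c, b ≤ c → c < m → ∃ e ∈ Γ, e.1 < c ∧ c < e.2), ∏ e ∈ Γ, u e

theorem coverSum_self (u : ℕ × ℕ → ℝ) (m a : ℕ) : coverSum u m a m = 1 := by
  classical
  have : beyond m a m = ∅ := by
    ext e
    rw [mem_beyond]
    simp only [notMem_empty, iff_false]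
    omega
  rw [coverSum, this]
  rw [filter_true_of_mem]
  · simp
  · intro Γ _ c hc hcm
    omega

open Classical in
/-- The graphs on `[a, m]` reaching beyond `r`, covering `(r, m)` and having an edge that starts
before `p`, summed according to the furthest point reached by the edges that start before `p`. -/
theorem sum_cover_eq (u : ℕ × ℕ → ℝ) {m a p r : ℕ} (hap : a ≤ p) (hpr : p ≤ r + 1) :
    ∑ Γ ∈ (beyond m a r).powerset.filter (fun Γ => (∃ e ∈ Γ, e.1 < p) ∧
        ∀ c, r < c → c < m → ∃ e ∈ Γ, e.1 < c ∧ c < e.2), ∏ e ∈ Γ, u e =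
      ∑ t ∈ Ioc r m, (∏ e ∈ (beyond m a r).filter (fun e => e.1 < p ∧ e.2 = t), (1 + u e) - 1) *
        ((∏ e ∈ (beyond m a r).filter (fun e => (e.1 < p ∧ e.2 < t) ∨ (p ≤ e.1 ∧ e.2 ≤ t)),
          (1 + u e)) * coverSum u m p t) := by
  have key : ∀ t ∈ Ioc r m,
      (∏ e ∈ (beyond m a r).filter (fun e => e.1 < p ∧ e.2 = t), (1 + u e) - 1) *
        ((∏ e ∈ (beyond m a r).filter (fun e => (e.1 < p ∧ e.2 < t) ∨ (p ≤ e.1 ∧ e.2 ≤ t)),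
          (1 + u e)) * coverSum u m p t) =
      ∑ Γ ∈ (beyond m a r).powerset, if ((∀ e ∈ Γ, e.1 < p → e.2 ≤ t) ∧
        (∃ e ∈ Γ, e.1 < p ∧ e.2 = t)) ∧ ∀ c, r < c → c < m → ∃ e ∈ Γ, e.1 < c ∧ c < e.2
        then ∏ e ∈ Γ, u e else 0 := by
    intro t ht
    rw [mem_Ioc] at ht
    -- When t is the furthest point reached from before p, the allowed edges fall into three
    -- disjoint classes: those realising t, of which at least one is present (`S₁`); those that may
    -- be added freely (`S₂`); and those from p onwards that pass t and must cover the rest. Free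
    -- edges resum to a product.
    set S₁ := (beyond m a r).filter (fun e => e.1 < p ∧ e.2 = t) with hS₁
    set S₂ := (beyond m a r).filter (fun e => (e.1 < p ∧ e.2 < t) ∨ (p ≤ e.1 ∧ e.2 ≤ t)) with hS₂
    have m1 : ∀ e, e ∈ S₁ ↔ (a ≤ e.1 ∧ e.1 < e.2 ∧ e.2 ≤ m ∧ r < e.2) ∧ e.1 < p ∧ e.2 = t := by
      intro e; rw [hS₁, mem_filter, mem_beyond]
    have m2 : ∀ e, e ∈ S₂ ↔ (a ≤ e.1 ∧ e.1 < e.2 ∧ e.2 ≤ m ∧ r < e.2) ∧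
        ((e.1 < p ∧ e.2 < t) ∨ (p ≤ e.1 ∧ e.2 ≤ t)) := by
      intro e; rw [hS₂, mem_filter, mem_beyond]
    have d12 : Disjoint S₁ (S₂ ∪ beyond m p t) := by
      rw [Finset.disjoint_left]
      intro e h1 h2
      rw [mem_union, m2, mem_beyond] at h2
      rw [m1] at h1
      omega
    have d23 : Disjoint S₂ (beyond m p t) := by
      rw [Finset.disjoint_left]
      intro e h1 h2
      rw [m2] at h1
      rw [mem_beyond] at h2
      omega
    have hset : (beyond m a r).powerset.filter (fun Γ => ∀ e ∈ Γ, e.1 < p → e.2 ≤ t) =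
        (S₁ ∪ (S₂ ∪ beyond m p t)).powerset := by
      ext Γ
      simp only [mem_filter, mem_powerset, subset_iff, mem_union, m1, m2, mem_beyond]
      constructor
      · rintro ⟨h1, h2⟩ e he
        have := h1 he
        have := h2 e he
        omega
      · intro h
        refine ⟨fun e he => ?_, fun e he => ?_⟩ <;> have := h he <;> omega
    rw [← sum_filter, ← filter_filter, ← filter_filter, hset, sum_filter, sum_filter,
      sum_powerset_union d12, prod_one_add, prod_one_add]
    have h1 : ∑ A ∈ S₁.powerset, ∏ e ∈ A, u e - 1 =
        ∑ A ∈ S₁.powerset, if A.Nonempty then ∏ e ∈ A, u e else 0 := by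
      rw [← insert_erase (empty_mem_powerset S₁), sum_insert (notMem_erase _ _),
        sum_insert (notMem_erase _ _)]
      simp only [prod_empty, Finset.not_nonempty_empty, if_false, zero_add, add_sub_cancel_left]
      refine sum_congr rfl fun A hA => ?_
      rw [if_pos (nonempty_iff_ne_empty.2 (mem_erase.1 hA).1)]
    rw [h1, sum_mul]
    refine sum_congr rfl fun A hA => ?_
    rw [mem_powerset] at hA
    rw [sum_powerset_union d23, sum_mul, mul_sum]
    refine sum_congr rfl fun B hB => ?_
    rw [mem_powerset] at hB
    rw [coverSum, sum_filter, mul_sum, mul_sum]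
    refine sum_congr rfl fun D hD => ?_
    rw [mem_powerset] at hD
    rw [prod_union_of_subset d12 hA (union_subset_union hB hD), prod_union_of_subset d23 hB hD]
    have hne : (∃ e ∈ A ∪ (B ∪ D), e.1 < p ∧ e.2 = t) ↔ A.Nonempty := by
      constructor
      · rintro ⟨e, he, h⟩
        rw [mem_union, mem_union] at he
        rcases he with he | he | he
        · exact ⟨e, he⟩
        · have := (m2 e).1 (hB he)
          omega
        · have := mem_beyond.1 (hD he)
          omega
      · rintro ⟨e, he⟩
        exact ⟨e, mem_union_left _ he, ((m1 e).1 (hA he)).2⟩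
    simp only [hne]
    by_cases hA' : A.Nonempty
    -- A single edge of `A` starts at or before r, because p ≤ r + 1, and ends at t. It covers
    -- everything strictly between, so only [t, m) remains for `D`; the edges of `A` and `B` end by
    -- t and do not help there.
    · have hcov : (∀ c, r < c → c < m → ∃ e ∈ A ∪ (B ∪ D), e.1 < c ∧ c < e.2) ↔
          ∀ c, t ≤ c → c < m → ∃ e ∈ D, e.1 < c ∧ c < e.2 := by
        constructor
        · intro h c hc hcm
          obtain ⟨e, he, h'⟩ := h c (by omega) hcm
          rw [mem_union, mem_union] at he
          rcases he with he | he | he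
          · have := (m1 e).1 (hA he)
            omega
          · have := (m2 e).1 (hB he)
            omega
          · exact ⟨e, he, h'⟩
        · intro h c hc hcm
          by_cases hct : t ≤ c
          · obtain ⟨e, he, h'⟩ := h c hct hcm
            exact ⟨e, mem_union_right _ (mem_union_right _ he), h'⟩
          · obtain ⟨e, he⟩ := hA'
            refine ⟨e, mem_union_left _ he, ?_⟩
            have := (m1 e).1 (hA he)
            omega
      rw [if_pos hA', if_pos hA']
      simp only [hcov]
      split_ifs <;> ring
    · rw [if_neg hA', if_neg hA', zero_mul]
  rw [sum_congr rfl key, sum_comm, sum_filter]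
  refine sum_congr rfl fun Γ hΓ => ?_
  rw [mem_powerset] at hΓ
  split_ifs with h
  · obtain ⟨⟨e, he, hep⟩, hc⟩ := h
    obtain ⟨f, hf, hmax⟩ := exists_max_image (Γ.filter fun e => e.1 < p) (fun e => e.2)
      ⟨e, mem_filter.2 ⟨he, hep⟩⟩
    rw [mem_filter] at hf
    have hfm := mem_beyond.1 (hΓ hf.1)
    rw [sum_eq_single_of_mem f.2 (mem_Ioc.2 ⟨hfm.2.2.2, hfm.2.2.1⟩), if_pos]
    · exact ⟨⟨fun e he hep => hmax e (mem_filter.2 ⟨he, hep⟩), f, hf.1, hf.2, rfl⟩, hc⟩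
    · intro t _ hne
      refine if_neg ?_
      rintro ⟨⟨h1, g, hg, hgp, rfl⟩, -⟩
      exact hne (le_antisymm (hmax g (mem_filter.2 ⟨hg, hgp⟩)) (h1 f hf.1 hf.2))
  · symm
    refine sum_eq_zero fun t _ => if_neg ?_
    rintro ⟨⟨-, e, he, hep, -⟩, hc⟩
    exact h ⟨⟨e, he, hep⟩, hc⟩

theorem abs_prod_one_add_sub_one_le {ι : Type*} (s : Finset ι) (u : ι → ℝ)
    (h0 : ∀ e, 0 ≤ 1 + u e) (h1 : ∀ e, u e ≤ 0) :
    |∏ e ∈ s, (1 + u e) - 1| ≤ ∑ e ∈ s, |u e| := by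
  classical
  induction s using Finset.induction_on with
  | empty => simp
  | insert a s ha ih =>
    rw [prod_insert ha, sum_insert ha]
    have hp0 : 0 ≤ ∏ e ∈ s, (1 + u e) := prod_nonneg fun e _ => h0 e
    have hp1 : ∏ e ∈ s, (1 + u e) ≤ 1 := prod_le_one (fun e _ => h0 e) fun e _ => by linarith [h1 e]
    calc |(1 + u a) * ∏ e ∈ s, (1 + u e) - 1|
        = |u a * ∏ e ∈ s, (1 + u e) + (∏ e ∈ s, (1 + u e) - 1)| := by ring_nf
      _ ≤ |u a * ∏ e ∈ s, (1 + u e)| + |∏ e ∈ s, (1 + u e) - 1| := abs_add_le _ _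
      _ ≤ _ := by
        rw [abs_mul, abs_of_nonneg hp0]
        exact add_le_add (mul_le_of_le_one_right (abs_nonneg _) hp1) ih

theorem intervalK_nonneg {u : ℕ × ℕ → ℝ} (h0 : ∀ e, 0 ≤ 1 + u e) (a b : ℕ) : 0 ≤ intervalK u a b :=
  prod_nonneg fun e _ => h0 e

/-- The product on the right omits the edges straddling `s`, whose factors lie in [0,1]. -/
theorem intervalK_le_mul {u : ℕ × ℕ → ℝ} (h0 : ∀ e, 0 ≤ 1 + u e) (h1 : ∀ e, u e ≤ 0) {a s b : ℕ}
    (has : a ≤ s) (hsb : s ≤ b) : intervalK u a b ≤ intervalK u a s * intervalK u s b := by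
  classical
  have hd : Disjoint (pairs a s) (pairs s b) := by
    rw [Finset.disjoint_left]
    intro e h1 h2
    rw [mem_pairs] at h1 h2
    omega
  rw [intervalK, intervalK, intervalK, ← prod_union hd]
  refine Finset.prod_le_prod_of_subset_of_le_one ?_ ?_ ?_
  · intro e he
    rw [mem_union, mem_pairs, mem_pairs] at he
    rw [mem_pairs]
    omega
  · exact fun e _ => h0 e
  · intro e _ _
    linarith [h1 e]

/-- One step of the construction of a lace. -/
theorem abs_coverSum_le {u : ℕ × ℕ → ℝ} (h0 : ∀ e, 0 ≤ 1 + u e) (h1 : ∀ e, u e ≤ 0) {m a b : ℕ}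
    (hab : a ≤ b) (hbm : b < m) :
    |coverSum u m a b| ≤
      ∑ t ∈ Ioc b m, ∑ s ∈ Ico a b, |u (s, t)| * (intervalK u b t * |coverSum u m b t|) := by
  classical
  have : coverSum u m a b = ∑ Γ ∈ (beyond m a b).powerset.filter (fun Γ => (∃ e ∈ Γ, e.1 < b) ∧
        ∀ c, b < c → c < m → ∃ e ∈ Γ, e.1 < c ∧ c < e.2), ∏ e ∈ Γ, u e := by
    rw [coverSum]
    refine sum_congr ?_ fun _ _ => rfl
    refine filter_congr fun Γ hΓ => ?_
    rw [mem_powerset] at hΓ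
    constructor
    · intro h
      refine ⟨?_, fun c hc hcm => h c hc.le hcm⟩
      obtain ⟨e, he, h2⟩ := h b le_rfl hbm
      exact ⟨e, he, h2.1⟩
    · rintro ⟨⟨e, he, h2⟩, h3⟩ c hc hcm
      rcases hc.eq_or_lt with rfl | hc
      · exact ⟨e, he, h2, (mem_beyond.1 (hΓ he)).2.2.2⟩
      · exact h3 c hc hcm
  -- The point b itself must be covered, so some edge starts before b; this is the resummation with
  -- p = r = b. The free edges include all pairs in [b,t], which is how K[b,t] appears.
  rw [this, sum_cover_eq u hab (by omega)]
  refine (abs_sum_le_sum_abs _ _).trans (sum_le_sum fun t ht => ?_)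
  rw [mem_Ioc] at ht
  rw [← sum_mul, abs_mul, abs_mul]
  refine mul_le_mul ?_ ?_ (by positivity) (by positivity)
  · refine (abs_prod_one_add_sub_one_le _ _ h0 h1).trans ?_
    refine le_trans ?_
      (sum_map (Ico a b) ⟨fun s => (s, t), fun _ _ h => (Prod.mk.inj h).1⟩ fun e => |u e|).le
    refine sum_le_sum_of_subset_of_nonneg ?_ fun _ _ _ => abs_nonneg _
    rintro ⟨s, t'⟩ he
    rw [mem_filter, mem_beyond] at he
    exact mem_map.2 ⟨s, mem_Ico.2 ⟨he.1.1, he.2.1⟩, Prod.ext rfl he.2.2.symm⟩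
  · refine mul_le_mul_of_nonneg_right ?_ (abs_nonneg _)
    rw [abs_of_nonneg (prod_nonneg fun e _ => h0 e), intervalK]
    refine Finset.prod_le_prod_of_subset_of_le_one ?_ (fun e _ => h0 e) fun e _ _ => by linarith [h1 e]
    intro e he
    rw [mem_pairs] at he
    rw [mem_filter, mem_beyond]
    omega

/-- The first step of the construction of a lace. -/
theorem abs_intervalJ_le {u : ℕ × ℕ → ℝ} (h0 : ∀ e, 1 / 2 ≤ 1 + u e) (m : ℕ) :
    |intervalJ u m| ≤
      2 * ∑ t ∈ Ioc 0 m, |u (0, t)| * (intervalK u 0 t * |coverSum u m 1 t|) := by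
  classical
  have h0' : ∀ e, 0 ≤ 1 + u e := fun e => by linarith [h0 e]
  have : intervalJ u m = ∑ Γ ∈ (beyond m 0 0).powerset.filter (fun Γ => (∃ e ∈ Γ, e.1 < 1) ∧
        ∀ c, 0 < c → c < m → ∃ e ∈ Γ, e.1 < c ∧ c < e.2), ∏ e ∈ Γ, u e := by
    have : beyond m 0 0 = pairs 0 m := by
      ext e
      rw [mem_beyond, mem_pairs]
      omega
    rw [intervalJ, this]
    exact sum_congr (filter_congr fun _ _ => Iff.rfl) fun _ _ => rfl
  rw [this, sum_cover_eq u zero_le_one (by omega), mul_sum]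
  refine (abs_sum_le_sum_abs _ _).trans (sum_le_sum fun t ht => ?_)
  rw [mem_Ioc] at ht
  have e1 : (beyond m 0 0).filter (fun e => e.1 < 1 ∧ e.2 = t) = {(0, t)} := by
    ext ⟨x, y⟩
    rw [mem_filter, mem_beyond, mem_singleton, Prod.mk.injEq]
    omega
  have e2 : pairs 0 t = insert (0, t)
      ((beyond m 0 0).filter (fun e => (e.1 < 1 ∧ e.2 < t) ∨ (1 ≤ e.1 ∧ e.2 ≤ t))) := by
    ext ⟨x, y⟩
    rw [mem_insert, mem_filter, mem_beyond, mem_pairs, Prod.mk.injEq]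
    omega
  have e3 : (0, t) ∉
      (beyond m 0 0).filter (fun e => (e.1 < 1 ∧ e.2 < t) ∨ (1 ≤ e.1 ∧ e.2 ≤ t)) := by
    rw [mem_filter]
    omega
  rw [e1, prod_singleton, add_sub_cancel_left, abs_mul, abs_mul, intervalK, e2, prod_insert e3,
    abs_of_nonneg (prod_nonneg fun e _ => h0' e), mul_left_comm 2]
  refine mul_le_mul_of_nonneg_left ?_ (abs_nonneg _)
  rw [← mul_assoc]
  refine mul_le_mul_of_nonneg_right ?_ (abs_nonneg _)
  rw [← mul_assoc]
  -- The lace edge (0,t) is not among the free edges, so its factor is missing from K[0,t];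
  -- restoring it costs 2, since the factor is at least 1/2.
  exact le_mul_of_one_le_left (prod_nonneg fun e _ => h0' e) (by linarith [h0 (0, t)])

end WSAW

/-! ### Walks as lists of steps, and a positive majorant of the lace sum -/

namespace WSAW

open Finset
open scoped ENNReal

variable {d : ℕ}

/-- The index set of the unit steps `±e_j`. -/
abbrev Step (d : ℕ) : Type := Fin d × Bool

/-- The unit vector of a step. -/
def stepVec (s : Step d) : Fin d → ℤ := Pi.single s.1 (if s.2 then 1 else -1)

/-- The displacement of a list of steps. -/
def disp (l : List (Step d)) : Fin d → ℤ := (l.map stepVec).sum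

@[simp] theorem disp_nil : disp ([] : List (Step d)) = 0 := rfl

@[simp] theorem disp_cons (s : Step d) (l : List (Step d)) :
    disp (s :: l) = stepVec s + disp l := by simp [disp]

@[simp] theorem disp_append (l₁ l₂ : List (Step d)) : disp (l₁ ++ l₂) = disp l₁ + disp l₂ := by
  simp [disp]

theorem disp_take_add_drop (l : List (Step d)) (i : ℕ) :
    disp (l.take i) + disp (l.drop i) = disp l := by
  rw [← disp_append, List.take_append_drop]

/-- The edge weights of a walk given by its steps. -/
noncomputable def edgeWeight (β : ℝ) (l : List (Step d)) (e : ℕ × ℕ) : ℝ :=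
  if disp (l.take e.1) = disp (l.take e.2) then -β else 0

/-- The weight `K[0, n]` of a walk given by its steps. -/
noncomputable def listK (β : ℝ) (l : List (Step d)) : ℝ := intervalK (edgeWeight β l) 0 l.length

/-- `J[0, n]` for a walk given by its steps. -/
noncomputable def listJ (β : ℝ) (l : List (Step d)) : ℝ := intervalJ (edgeWeight β l) l.length

theorem edgeWeight_nonpos {β : ℝ} (hβ : 0 ≤ β) (l : List (Step d)) (e : ℕ × ℕ) :
    edgeWeight β l e ≤ 0 := by
  unfold edgeWeight
  split_ifs <;> linarith

theorem one_add_edgeWeight_ge {β c : ℝ} (hc : c ≤ 1) (hβ : β ≤ 1 - c) (l : List (Step d))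
    (e : ℕ × ℕ) : c ≤ 1 + edgeWeight β l e := by
  unfold edgeWeight
  split_ifs <;> linarith

theorem abs_edgeWeight {β : ℝ} (hβ : 0 ≤ β) (l : List (Step d)) (e : ℕ × ℕ) :
    |edgeWeight β l e| = if disp (l.take e.1) = disp (l.take e.2) then β else 0 := by
  unfold edgeWeight
  split_ifs <;> simp [abs_of_nonneg hβ]

theorem listK_nonneg {β : ℝ} (hβ : β ≤ 1) (l : List (Step d)) : 0 ≤ listK β l :=
  intervalK_nonneg (one_add_edgeWeight_ge zero_le_one (by linarith) l) _ _

theorem intervalK_congr {u v : ℕ × ℕ → ℝ} {a b c : ℕ}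
    (h : ∀ s t, a ≤ s → s < t → t ≤ b → u (s + c, t + c) = v (s, t)) :
    intervalK u (a + c) (b + c) = intervalK v a b := by
  refine prod_nbij' (fun e => (e.1 - c, e.2 - c)) (fun e => (e.1 + c, e.2 + c)) ?_ ?_ ?_ ?_ ?_
  · intro e he
    simp only [mem_pairs] at he ⊢
    omega
  · intro e he
    simp only [mem_pairs] at he ⊢
    omega
  · rintro ⟨x, y⟩ he
    simp only [mem_pairs, Prod.mk.injEq] at he ⊢
    omega
  · rintro ⟨x, y⟩ he
    simp
  · rintro ⟨x, y⟩ he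
    simp only [mem_pairs] at he ⊢
    rw [← h (x - c) (y - c) (by omega) (by omega) (by omega), Nat.sub_add_cancel (by omega),
      Nat.sub_add_cancel (by omega)]

theorem intervalJ_congr {u v : ℕ × ℕ → ℝ} {m : ℕ} (h : ∀ s t, s < t → t ≤ m → u (s, t) = v (s, t)) :
    intervalJ u m = intervalJ v m := by
  classical
  refine sum_congr rfl fun Γ hΓ => prod_congr rfl fun e he => ?_
  rw [mem_filter, mem_powerset] at hΓ
  have := mem_pairs.1 (hΓ.1 he)
  exact h e.1 e.2 this.2.1 this.2.2

theorem disp_take_drop (l : List (Step d)) (i s : ℕ) :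
    disp ((l.drop i).take s) = disp (l.take (s + i)) - disp (l.take i) := by
  rw [eq_sub_iff_add_eq', ← disp_append, List.take_drop, add_comm s i]
  congr 1
  conv_rhs => rw [← List.take_append_drop i (l.take (i + s))]
  rw [List.take_take, min_eq_left (by omega)]

theorem intervalK_edgeWeight (β : ℝ) (l : List (Step d)) {i j : ℕ} (hij : i ≤ j)
    (hj : j ≤ l.length) :
    intervalK (edgeWeight β l) i j = listK β ((l.take j).drop i) := by
  have h1 : ((l.take j).drop i).length = j - i := by simp [hj]
  rw [listK, h1]
  have := @intervalK_congr (edgeWeight β l) (edgeWeight β ((l.take j).drop i)) 0 (j - i) i ?_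
  · rwa [zero_add, Nat.sub_add_cancel hij] at this
  · intro s t _ hst ht
    simp only [edgeWeight, disp_take_drop, List.take_take]
    rw [min_eq_left (by omega), min_eq_left (by omega), min_eq_left (by omega)]
    simp

theorem intervalJ_edgeWeight (β : ℝ) (l : List (Step d)) {m : ℕ} (hm : m ≤ l.length) :
    intervalJ (edgeWeight β l) m = listJ β (l.take m) := by
  rw [listJ, List.length_take, min_eq_left hm]
  refine intervalJ_congr fun s t hst ht => ?_
  simp only [edgeWeight, List.take_take]
  rw [min_eq_left (by omega), min_eq_left (by omega)]

theorem listK_nil (β : ℝ) : listK β ([] : List (Step d)) = 1 := by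
  unfold listK intervalK
  refine prod_eq_one fun e he => ?_
  have := mem_pairs.1 he
  simp at this
  omega

theorem listJ_nil (β : ℝ) : listJ β ([] : List (Step d)) = 0 := by
  classical
  rw [listJ, intervalJ, filter_false_of_mem, sum_empty]
  intro Γ hΓ h
  obtain ⟨e, he, -⟩ := h.1
  have := mem_pairs.1 (mem_powerset.1 hΓ he)
  simp at this
  omega

/-- The recursion that defines the lace expansion. -/
theorem listK_cons (β : ℝ) (a : Step d) (l : List (Step d)) :
    listK β (a :: l) = listK β l +
      ∑ m ∈ range ((a :: l).length + 1), listJ β ((a :: l).take m) * listK β ((a :: l).drop m) := by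
  rw [listK, intervalK_eq, sum_range_succ', List.take_zero, listJ_nil, zero_mul, add_zero]
  congr 1
  · rw [intervalK_edgeWeight _ _ (by simp) le_rfl]
    simp
  · refine sum_nbij' (fun m => m - 1) (fun m => m + 1) ?_ ?_ ?_ ?_ ?_
    · intro m hm; simp only [mem_Icc, mem_range] at hm ⊢; omega
    · intro m hm; simp only [mem_Icc, mem_range] at hm ⊢; omega
    · intro m hm; simp only [mem_Icc] at hm; omega
    · intro m hm; simp
    · intro m hm
      rw [mem_Icc] at hm
      rw [Nat.sub_add_cancel hm.1, intervalJ_edgeWeight _ _ hm.2,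
        intervalK_edgeWeight _ _ hm.2 le_rfl, List.take_length]

/-- A majorant of the sum over laces, for a walk with steps `l` after a point that has displacement
`-v` from the starting point of the next edge of the lace. The first argument bounds the number of
edges. -/
noncomputable def laceMaj (β : ℝ) : ℕ → (Fin d → ℤ) → List (Step d) → ℝ
  | 0, _, _ => 0
  | n + 1, v, l => (if disp l = v then β else 0) * listK β l +
      ∑ j ∈ Ioo 0 l.length, ∑ i ∈ range j, (if disp (l.take j) = v then β else 0) *
        (listK β (l.take i) * listK β ((l.take j).drop i) *
          laceMaj β n (disp (l.take i) - v) (l.drop j))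

theorem laceMaj_nonneg {β : ℝ} (hβ0 : 0 ≤ β) (hβ : β ≤ 1) (n : ℕ) (v : Fin d → ℤ)
    (l : List (Step d)) : 0 ≤ laceMaj β n v l := by
  have h (P : Prop) [Decidable P] : 0 ≤ if P then β else 0 := by split_ifs <;> simp [hβ0]
  induction n generalizing v l with
  | zero => exact le_rfl
  | succ n ih =>
    exact add_nonneg (mul_nonneg (h _) (listK_nonneg hβ _)) <| sum_nonneg fun _ _ =>
      sum_nonneg fun _ _ => mul_nonneg (h _) <|
        mul_nonneg (mul_nonneg (listK_nonneg hβ _) (listK_nonneg hβ _)) (ih _ _)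

/-- The edge st of a lace forces the walk to return at time t to its position at time s. Seen from
time b this fixes the displacement of the piece up to t, so only the vector v has to be remembered,
not s. The start a of the next range may exceed b because the first step of a lace uses a = 1 and b
= 0, while later ones use a = b. -/
theorem sum_coverSum_le_laceMaj {β : ℝ} (hβ0 : 0 ≤ β) (hβ : β ≤ 1) (l : List (Step d))
    {n s a b : ℕ} (hba : b ≤ a) (hb : b < l.length)
    (ih : ∀ t, b < t → t < l.length → |coverSum (edgeWeight β l) l.length a t| ≤
      ∑ s' ∈ Ico a t, laceMaj β n (disp (l.take s') - disp (l.take t)) (l.drop t)) :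
    ∑ t ∈ Ioc b l.length, |edgeWeight β l (s, t)| *
        (intervalK (edgeWeight β l) b t * |coverSum (edgeWeight β l) l.length a t|) ≤
      laceMaj β (n + 1) (disp (l.take s) - disp (l.take b)) (l.drop b) := by
  have h0 := one_add_edgeWeight_ge zero_le_one (by linarith : β ≤ 1 - 0) l
  have h1 := edgeWeight_nonpos hβ0 l
  rw [laceMaj, ← Finset.Ioo_insert_right hb, sum_insert (by simp)]
  refine add_le_add ?_ ?_
  · rw [abs_edgeWeight hβ0]
    have hcov : |coverSum (edgeWeight β l) l.length a l.length| = 1 := by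
      rw [coverSum_self, abs_one]
    have hd := disp_take_add_drop l b
    rw [hcov, mul_one, intervalK_edgeWeight _ _ hb.le le_rfl, List.take_length]
    refine mul_le_mul_of_nonneg_right (le_of_eq ?_) (listK_nonneg hβ _)
    refine if_congr ?_ rfl rfl
    rw [← hd, eq_sub_iff_add_eq', eq_comm]
  · have hlen : (l.drop b).length = l.length - b := by simp
    rw [hlen]
    refine le_of_le_of_eq (b := ∑ t ∈ Ioo b l.length, ∑ i ∈ range (t - b),
      (if disp ((l.drop b).take (t - b)) = disp (l.take s) - disp (l.take b) then β else 0) *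
        (listK β ((l.drop b).take i) * listK β (((l.drop b).take (t - b)).drop i) *
          laceMaj β n (disp ((l.drop b).take i) - (disp (l.take s) - disp (l.take b)))
            ((l.drop b).drop (t - b)))) ?_ ?_
    · refine sum_le_sum fun t ht => ?_
      rw [mem_Ioo] at ht
      rw [abs_edgeWeight hβ0, ← mul_sum, disp_take_drop, Nat.sub_add_cancel ht.1.le]
      by_cases hst : disp (l.take s) = disp (l.take t)
      · rw [if_pos hst, if_pos (by rw [hst])]
        refine mul_le_mul_of_nonneg_left ?_ hβ0
        refine (mul_le_mul_of_nonneg_left (ih t ht.1 ht.2) (intervalK_nonneg h0 _ _)).trans ?_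
        rw [mul_sum]
        -- Allowing the next edge to start anywhere from b on only adds nonnegative terms.
        refine (sum_le_sum_of_subset_of_nonneg (Ico_subset_Ico_left hba) fun s' _ _ =>
          mul_nonneg (intervalK_nonneg h0 _ _) (laceMaj_nonneg hβ0 hβ _ _ _)).trans ?_
        rw [sum_Ico_eq_sum_range]
        refine sum_le_sum fun i hi => ?_
        rw [mem_range] at hi
        have e1 : (l.drop b).drop (t - b) = l.drop t := by
          rw [List.drop_drop]; congr 1; omega
        have e2 : disp ((l.drop b).take i) - (disp (l.take s) - disp (l.take b)) =
            disp (l.take (b + i)) - disp (l.take t) := by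
          rw [disp_take_drop, hst, add_comm i b]; abel
        rw [e1, e2]
        refine mul_le_mul_of_nonneg_right ?_ (laceMaj_nonneg hβ0 hβ _ _ _)
        -- The walk between b and t is cut at the start of the next lace edge; the two pieces will
        -- become two propagators.
        refine (intervalK_le_mul h0 h1 (s := b + i) (by omega) (by omega)).trans (le_of_eq ?_)
        rw [intervalK_edgeWeight _ _ (by omega) (by omega),
          intervalK_edgeWeight _ _ (by omega) (by omega)]
        congr 2
        · rw [List.drop_take]; congr 1; omega
        · rw [List.drop_take, List.drop_take, List.drop_drop]; congr 1; omega
      · rw [if_neg hst, if_neg, zero_mul, zero_mul]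
        rw [sub_left_inj]
        exact fun h => hst h.symm
    · refine sum_nbij' (fun t => t - b) (fun t => t + b) ?_ ?_ ?_ ?_ ?_
      · intro t ht; simp only [mem_Ioo] at ht ⊢; omega
      · intro t ht; simp only [mem_Ioo] at ht ⊢; omega
      · intro t ht; simp only [mem_Ioo] at ht; omega
      · intro t ht; simp
      · intro t ht; rfl

theorem abs_coverSum_le_laceMaj {β : ℝ} (hβ0 : 0 ≤ β) (hβ : β ≤ 1) (l : List (Step d))
    {n a b : ℕ} (hab : a ≤ b) (hb : b < l.length) (hn : l.length - b ≤ n) :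
    |coverSum (edgeWeight β l) l.length a b| ≤
      ∑ s ∈ Ico a b, laceMaj β n (disp (l.take s) - disp (l.take b)) (l.drop b) := by
  induction n generalizing a b with
  | zero => omega
  | succ n ih =>
    refine (abs_coverSum_le (one_add_edgeWeight_ge zero_le_one (by linarith : β ≤ 1 - 0) l)
      (edgeWeight_nonpos hβ0 l) hab hb).trans ?_
    rw [sum_comm]
    exact sum_le_sum fun s _ => sum_coverSum_le_laceMaj hβ0 hβ l le_rfl hb
      fun t hbt ht => ih hbt.le ht (by omega)

/-- Each edge of a lace reaches strictly further than the previous one, so the length of the walk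
bounds the recursion depth. Leaving n free above that length allows one depth for finitely many
walks. -/
theorem abs_listJ_le {β : ℝ} (hβ0 : 0 ≤ β) (hβ : β ≤ 1 / 2) (l : List (Step d)) {n : ℕ}
    (hn : l.length ≤ n) : |listJ β l| ≤ 2 * laceMaj β (n + 1) 0 l := by
  rcases l.length.eq_zero_or_pos with h | h
  · rw [List.eq_nil_of_length_eq_zero h, listJ_nil, abs_zero]
    exact mul_nonneg zero_le_two (laceMaj_nonneg hβ0 (by linarith) _ _ _)
  · refine (abs_intervalJ_le (one_add_edgeWeight_ge (by norm_num) (by linarith) l) _).trans ?_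
    refine mul_le_mul_of_nonneg_left ?_ zero_le_two
    have := sum_coverSum_le_laceMaj (n := n) (s := 0) hβ0 (by linarith) l zero_le_one h
      fun t ht htl => abs_coverSum_le_laceMaj hβ0 (by linarith) l ht htl (by omega)
    simpa using this

/-! ### Sums over walks as sums over lists of steps -/

theorem stepVec_injective : Function.Injective (stepVec (d := d)) := by
  rintro ⟨i, a⟩ ⟨j, b⟩ h
  have h1 := congrFun h i
  simp only [stepVec, Pi.single_apply] at h1
  have hij : i = j := by
    by_contra hne
    rw [if_neg hne] at h1
    cases a <;> simp at h1
  subst hij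
  cases a <;> cases b <;> simp at h1 ⊢

theorem sum_abs_stepVec (s : Step d) : ∑ j, |stepVec s j| = 1 := by
  rw [sum_eq_single_of_mem s.1 (mem_univ _)]
  · cases h : s.2 <;> simp [stepVec, h]
  · intro j _ hj
    simp [stepVec, hj]

theorem exists_stepVec_eq {v : Fin d → ℤ} (hv : ∑ j, |v j| = 1) : ∃ s : Step d, stepVec s = v := by
  obtain ⟨j, hj⟩ : ∃ j, v j ≠ 0 := by
    by_contra! h
    simp [h] at hv
  have h1 : 1 ≤ |v j| := Int.one_le_abs hj
  rw [← add_sum_erase _ _ (mem_univ j)] at hv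
  have h2 : 0 ≤ ∑ i ∈ univ.erase j, |v i| := sum_nonneg fun _ _ => abs_nonneg _
  have h3 : ∑ i ∈ univ.erase j, |v i| = 0 := by omega
  rw [sum_eq_zero_iff_of_nonneg fun _ _ => abs_nonneg _] at h3
  refine ⟨(j, decide (v j = 1)), funext fun i => ?_⟩
  by_cases hij : i = j
  · subst hij
    have h4 : |v i| = 1 := by omega
    rcases (abs_eq zero_le_one).1 h4 with h5 | h5 <;> simp [stepVec, h5]
  · have := abs_eq_zero.1 (h3 i (mem_erase.2 ⟨hij, mem_univ _⟩))
    simp [stepVec, hij, this]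

/-- The walk with the given steps. -/
def stepPath (n : ℕ) (l : List (Step d)) (i : Fin (n + 1)) : Fin d → ℤ := disp (l.take i)

theorem stepPath_succ_sub {n : ℕ} (s : Fin n → Step d) (i : Fin n) :
    stepPath n (List.ofFn s) i.succ - stepPath n (List.ofFn s) i.castSucc = stepVec (s i) := by
  simp only [stepPath, Fin.val_succ, Fin.val_castSucc]
  rw [List.take_add_one]
  simp

theorem sum_walks {M : Type*} [AddCommMonoid M] (n : ℕ) (x : Fin d → ℤ)
    (Φ : (Fin (n + 1) → Fin d → ℤ) → M) :
    ∑ ω ∈ walks d n x, Φ ω =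
      ∑ s : Fin n → Step d, if disp (List.ofFn s) = x then Φ (stepPath n (List.ofFn s)) else 0 := by
  classical
  rw [← sum_filter]
  symm
  refine sum_nbij (fun s => stepPath n (List.ofFn s)) ?_ ?_ ?_ fun _ _ => rfl
  · intro s hs
    rw [mem_filter] at hs
    simp only [walks, Set.Finite.mem_toFinset, walkSet, Set.mem_ofPred_eq]
    refine ⟨by simp [stepPath], ?_, fun i => ?_⟩
    · rw [← hs.2]
      simp only [stepPath, Fin.val_last]
      congr 1
      exact List.take_of_length_le (by simp)
    · rw [← sum_abs_stepVec (s i), ← stepPath_succ_sub]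
      rfl
  · intro s _ s' _ h
    funext i
    apply stepVec_injective
    have h : stepPath n (List.ofFn s) = stepPath n (List.ofFn s') := h
    rw [← stepPath_succ_sub, ← stepPath_succ_sub, h]
  · intro ω hω
    simp only [walks, Set.Finite.coe_toFinset, walkSet, Set.mem_ofPred_eq] at hω
    have hω2 : ∀ i : Fin n, ∃ s : Step d, stepVec s = ω i.succ - ω i.castSucc :=
      fun i => exists_stepVec_eq (hω.2.2 i)
    choose s hs using hω2
    have hp : stepPath n (List.ofFn s) = ω := by
      funext i
      induction i using Fin.induction with
      | zero => simp [stepPath, hω.1]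
      | succ i ih =>
        have := stepPath_succ_sub s i
        rw [hs i, ih] at this
        exact sub_left_injective this
    refine ⟨s, ?_, hp⟩
    simp only [coe_filter, mem_univ, true_and, Set.mem_ofPred_eq]
    rw [← hω.2.1, ← hp]
    simp only [stepPath, Fin.val_last]
    congr 1
    exact (List.take_of_length_le (by simp)).symm

theorem prod_edges_eq {n : ℕ} (β : ℝ) {l : List (Step d)} (hl : l.length = n) :
    ∏ e ∈ edges n, (1 + β * U (stepPath n l) e.1 e.2) = listK β l := by
  subst hl
  refine prod_nbij (fun e => ((e.1 : ℕ), (e.2 : ℕ))) ?_ ?_ ?_ ?_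
  · intro e he
    simp only [edges, mem_filter, mem_univ, true_and] at he
    rw [mem_pairs]
    have : (e.1 : ℕ) < e.2 := he
    simp only
    omega
  · rintro ⟨a, b⟩ _ ⟨a', b'⟩ _ h
    simp only [Prod.mk.injEq] at h ⊢
    exact ⟨Fin.ext h.1, Fin.ext h.2⟩
  · rintro ⟨a, b⟩ h
    rw [mem_coe, mem_pairs] at h
    simp only at h
    refine ⟨(⟨a, by omega⟩, ⟨b, by omega⟩), ?_, rfl⟩
    simp only [edges, coe_filter, mem_univ, true_and, Set.mem_ofPred_eq, Fin.mk_lt_mk]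
    omega
  · intro e _
    by_cases h : disp (l.take e.1) = disp (l.take e.2)
    · simp [U, stepPath, edgeWeight, h]
    · simp [U, stepPath, edgeWeight, h]

theorem J_eq_listJ {n : ℕ} (β : ℝ) {l : List (Step d)} (hl : l.length = n) :
    J β (stepPath n l) = listJ β l := by
  classical
  subst hl
  set ι : Fin (l.length + 1) × Fin (l.length + 1) ↪ ℕ × ℕ :=
    ⟨fun e => ((e.1 : ℕ), (e.2 : ℕ)), by
      rintro ⟨a, b⟩ ⟨a', b'⟩ h
      simp only [Prod.mk.injEq] at h ⊢
      exact ⟨Fin.ext h.1, Fin.ext h.2⟩⟩ with hι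
  have hι1 : ∀ e, (ι e).1 = e.1 := fun _ => rfl
  have hι2 : ∀ e, (ι e).2 = e.2 := fun _ => rfl
  have hedge : (edges l.length).map ι = pairs 0 l.length := by
    ext ⟨a, b⟩
    simp only [mem_map, edges, mem_filter, mem_univ, true_and, mem_pairs]
    constructor
    · rintro ⟨e, he, h⟩
      have h1 : (e.1 : ℕ) = a := congrArg Prod.fst h
      have h2 : (e.2 : ℕ) = b := congrArg Prod.snd h
      have : (e.1 : ℕ) < e.2 := he
      omega
    · rintro ⟨-, h1, h2⟩
      exact ⟨(⟨a, by omega⟩, ⟨b, by omega⟩), by simpa using h1, rfl⟩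
  rw [J, listJ, intervalJ]
  refine sum_nbij (fun Γ => Γ.map ι) ?_ ?_ ?_ ?_
  · intro Γ hΓ
    rw [mem_filter, mem_powerset] at hΓ ⊢
    refine ⟨hedge ▸ map_subset_map.2 hΓ.1, ?_, ?_⟩
    · obtain ⟨⟨e, he, h⟩, -, -⟩ := hΓ.2
      have hlt : (e.1 : ℕ) < e.2 := (mem_filter.1 (hΓ.1 he)).2
      refine ⟨ι e, mem_map_of_mem _ he, ?_⟩
      rw [hι1]
      rcases h with h | h
      · simp [h]
      · simp [h] at hlt
    · intro c hc hcm
      obtain ⟨e, he, h1, h2⟩ := hΓ.2.2.2 ⟨c, by omega⟩ (Fin.lt_def.2 (by simpa using hc))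
        (Fin.lt_def.2 (by simpa using hcm))
      exact ⟨ι e, mem_map_of_mem _ he, Fin.lt_def.1 h1, Fin.lt_def.1 h2⟩
  · intro Γ _ Γ' _ h
    exact map_injective ι h
  · intro Γ hΓ
    rw [mem_coe, mem_filter, mem_powerset, ← hedge, subset_map_iff] at hΓ
    obtain ⟨⟨Γ', hΓ', rfl⟩, ⟨e, he, he0⟩, hcov⟩ := hΓ
    refine ⟨Γ', ?_, rfl⟩
    rw [mem_coe, mem_filter, mem_powerset]
    rw [mem_map] at he
    obtain ⟨e, he, rfl⟩ := he
    rw [hι1] at he0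
    have hlt : (e.1 : ℕ) < e.2 := (mem_filter.1 (hΓ' he)).2
    have hcov' : ∀ c : Fin (l.length + 1), 0 < c → c < Fin.last _ → ∃ e ∈ Γ', e.1 < c ∧ c < e.2 := by
      intro c hc hcm
      obtain ⟨f, hf, h1, h2⟩ := hcov c (Fin.lt_def.1 hc) (by simpa using Fin.lt_def.1 hcm)
      rw [mem_map] at hf
      obtain ⟨f, hf, rfl⟩ := hf
      exact ⟨f, hf, Fin.lt_def.2 h1, Fin.lt_def.2 h2⟩
    refine ⟨hΓ', ⟨e, he, Or.inl (Fin.ext (by simpa using he0))⟩, ?_, hcov'⟩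
    -- The condition at the right end is recovered here: an edge straddling the last interior point
    -- ends at the right end, and if there is no interior point the edge at 0 does.
    have hl : 1 ≤ l.length := by omega
    rcases hl.eq_or_lt with h1 | h1
    · refine ⟨e, he, Or.inr (Fin.ext ?_)⟩
      simp only [Fin.val_last]
      omega
    · obtain ⟨f, hf, h2, h3⟩ := hcov' ⟨l.length - 1, by omega⟩
        (Fin.lt_def.2 (by simp; omega)) (Fin.lt_def.2 (by simp; omega))
      refine ⟨f, hf, Or.inr (Fin.ext ?_)⟩
      have := Fin.lt_def.1 h3
      simp only [Fin.val_last] at this ⊢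
      omega
  · intro Γ _
    rw [prod_map]
    refine prod_congr rfl fun e _ => ?_
    by_cases h : disp (l.take e.1) = disp (l.take e.2)
    · simp [U, stepPath, edgeWeight, hι1, hι2, h]
    · simp [U, stepPath, edgeWeight, hι1, hι2, h]

theorem tsum_list_eq {α : Type*} [Fintype α] (f : List α → ℝ≥0∞) :
    ∑' l, f l = ∑' n : ℕ, ∑ s : Fin n → α, f (List.ofFn s) := by
  rw [← List.equivSigmaTuple.symm.tsum_eq, ENNReal.tsum_sigma']
  refine tsum_congr fun n => ?_
  rw [tsum_fintype]
  rfl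

theorem G_eq_tsum_list {β : ℝ} (z : ℝ) (x : Fin d → ℤ) :
    G d β z x = ∑' l : List (Step d),
      if disp l = x then ENNReal.ofReal (z ^ l.length * listK β l) else 0 := by
  rw [tsum_list_eq, G]
  refine tsum_congr fun n => ?_
  rw [sum_walks]
  refine sum_congr rfl fun s _ => ?_
  rw [prod_edges_eq β (List.length_ofFn), List.length_ofFn]

theorem lacePi_eq_sum (β : ℝ) (m : ℕ) (x : Fin d → ℤ) :
    lacePi d β m x =
      ∑ s : Fin m → Step d, if disp (List.ofFn s) = x then listJ β (List.ofFn s) else 0 := by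
  rw [lacePi, sum_walks]
  exact sum_congr rfl fun s _ => by rw [J_eq_listJ β (List.length_ofFn)]

theorem C_eq_G (z : ℝ) (x : Fin d → ℤ) : C d z x = G d 0 z x := by
  simp [C, G]

/-- Cutting a list at all possible places. -/
def cutEquiv (α : Type*) : (Σ l : List α, Fin (l.length + 1)) ≃ List α × List α where
  toFun p := (p.1.take p.2, p.1.drop p.2)
  invFun q := ⟨q.1 ++ q.2, ⟨q.1.length, by simp⟩⟩
  left_inv := by
    rintro ⟨l, i, hi⟩
    have h1 : l.take i ++ l.drop i = l := List.take_append_drop i l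
    have h2 : (l.take i).length = i := by simp; omega
    refine Sigma.ext h1 ?_
    simp only
    congr! 2
    rw [h1]
  right_inv := by
    rintro ⟨a, b⟩
    simp

/-- Sums over cuts of a walk become sums over independent pieces; this is how decompositions in time
turn into products of generating functions. -/
theorem tsum_cut_eq {α : Type*} (f : List α → List α → ℝ≥0∞) :
    ∑' l : List α, ∑ i ∈ range (l.length + 1), f (l.take i) (l.drop i) = ∑' a, ∑' b, f a b := by
  rw [← ENNReal.tsum_prod, ← (cutEquiv α).tsum_eq, ENNReal.tsum_sigma']
  refine tsum_congr fun l => ?_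
  rw [tsum_fintype, sum_range]
  rfl

end WSAW

/-! ### Diagrammatic estimates for the lace sum -/

namespace WSAW

open Finset
open scoped ENNReal

variable {d : ℕ}

theorem tsum_eq_tsum_disp (f : List (Step d) → ℝ≥0∞) :
    ∑' l, f l = ∑' w, ∑' l, if disp l = w then f l else 0 := by
  rw [ENNReal.tsum_comm]
  refine tsum_congr fun l => ?_
  rw [tsum_eq_single (disp l) fun w hw => if_neg hw.symm, if_pos rfl]

theorem tsum_mul_tsum_mul_tsum {ι : Type*} (a b c : ι → ℝ≥0∞) :
    ∑' i, ∑' j, ∑' k, a i * b j * c k = (∑' i, a i) * (∑' j, b j) * ∑' k, c k := by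
  simp only [ENNReal.tsum_mul_left, ENNReal.tsum_mul_right]

/-- The generating function of the majorant of the sum over laces. -/
noncomputable def laceGen (β z : ℝ) (n : ℕ) (v x : Fin d → ℤ) : ℝ≥0∞ :=
  ∑' l : List (Step d), if disp l = x then ENNReal.ofReal (z ^ l.length * laceMaj β n v l) else 0

/-- The first term is the lace that ends with this edge. Otherwise the walk is cut at the end of the
edge, at displacement v, and at the start w of the next edge; the remainder is the same problem seen
from v. -/
theorem laceGen_succ_le {β z : ℝ} (hβ0 : 0 ≤ β) (hβ : β ≤ 1) (hz : 0 ≤ z) (n : ℕ)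
    (v x : Fin d → ℤ) :
    laceGen β z (n + 1) v x ≤ (if x = v then ENNReal.ofReal β else 0) * G d β z x +
      ENNReal.ofReal β * ∑' w, G d β z w * G d β z (v - w) * laceGen β z n (w - v) (x - v) := by
  set W : List (Step d) → ℝ≥0∞ := fun l => ENNReal.ofReal (z ^ l.length * listK β l) with hW
  set V : (Fin d → ℤ) → List (Step d) → ℝ≥0∞ :=
    fun w l => ENNReal.ofReal (z ^ l.length * laceMaj β n w l) with hV
  set b := ENNReal.ofReal β with hb
  have hK := fun l : List (Step d) => listK_nonneg hβ l
  have hY := fun (w : Fin d → ℤ) (l : List (Step d)) => laceMaj_nonneg hβ0 hβ n w l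
  have hzp := fun l : List (Step d) => pow_nonneg hz l.length
  set f : List (Step d) → List (Step d) → List (Step d) → ℝ≥0∞ := fun l₁ l₂ l₃ =>
    if disp l₁ + disp l₂ = v ∧ disp l₃ = x - v then b * (W l₁ * W l₂ * V (disp l₁ - v) l₃) else 0
    with hf
  have hsum : ∑' l₁, ∑' l₂, ∑' l₃, f l₁ l₂ l₃ =
      b * ∑' w, G d β z w * G d β z (v - w) * laceGen β z n (w - v) (x - v) := by
    rw [tsum_eq_tsum_disp, ← ENNReal.tsum_mul_left]
    refine tsum_congr fun w => ?_
    rw [G_eq_tsum_list, G_eq_tsum_list, laceGen, ← tsum_mul_tsum_mul_tsum, ← ENNReal.tsum_mul_left]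
    refine tsum_congr fun l₁ => ?_
    by_cases h1 : disp l₁ = w
    · rw [if_pos h1, ← ENNReal.tsum_mul_left]
      refine tsum_congr fun l₂ => ?_
      rw [← ENNReal.tsum_mul_left]
      refine tsum_congr fun l₃ => ?_
      have h4 : w + disp l₂ = v ↔ disp l₂ = v - w := eq_sub_iff_add_eq'.symm
      by_cases h2 : disp l₂ = v - w <;> by_cases h3 : disp l₃ = x - v <;>
        simp [hf, h1, h4, h2, h3, hW, hV]
    · simp [h1]
  have hF : ∑' l₁, ∑' l₂, ∑' l₃, f l₁ l₂ l₃ = ∑' l : List (Step d), ∑ j ∈ range (l.length + 1),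
      ∑ i ∈ range ((l.take j).length + 1), f ((l.take j).take i) ((l.take j).drop i) (l.drop j) := by
    rw [tsum_cut_eq fun l' l₃ => ∑ i ∈ range (l'.length + 1), f (l'.take i) (l'.drop i) l₃]
    symm
    rw [ENNReal.tsum_comm]
    refine (tsum_congr fun l₃ => tsum_cut_eq fun l₁ l₂ => f l₁ l₂ l₃).trans ?_
    rw [ENNReal.tsum_comm]
    exact tsum_congr fun l₁ => ENNReal.tsum_comm
  rw [← hsum, hF, G_eq_tsum_list, ← ENNReal.tsum_mul_left, ← ENNReal.tsum_add, laceGen]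
  refine ENNReal.tsum_le_tsum fun l => ?_
  by_cases hl : disp l = x
  swap
  · simp [hl]
  rw [if_pos hl, if_pos hl, laceMaj, mul_add, ENNReal.ofReal_add]
  rotate_left
  · exact mul_nonneg (hzp _) (mul_nonneg (by split_ifs <;> simp [hβ0]) (hK _))
  · exact mul_nonneg (hzp _) (sum_nonneg fun _ _ => sum_nonneg fun _ _ =>
      mul_nonneg (by split_ifs <;> simp [hβ0]) (mul_nonneg (mul_nonneg (hK _) (hK _)) (hY _ _)))
  refine add_le_add (le_of_eq ?_) ?_
  · rw [hl]
    by_cases h : x = v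
    · rw [if_pos h, if_pos h, ← ENNReal.ofReal_mul hβ0]
      congr 1
      ring
    · simp [h]
  · rw [mul_sum, ENNReal.ofReal_sum_of_nonneg fun _ _ => mul_nonneg (hzp _) <|
      sum_nonneg fun _ _ => mul_nonneg (by split_ifs <;> simp [hβ0])
        (mul_nonneg (mul_nonneg (hK _) (hK _)) (hY _ _))]
    refine (sum_le_sum fun j hj => ?_).trans
      (sum_le_sum_of_subset (fun j hj => by rw [mem_Ioo] at hj; rw [mem_range]; omega))
    rw [mem_Ioo] at hj
    rw [mul_sum, ENNReal.ofReal_sum_of_nonneg fun _ _ => mul_nonneg (hzp _) <|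
      mul_nonneg (by split_ifs <;> simp [hβ0]) (mul_nonneg (mul_nonneg (hK _) (hK _)) (hY _ _))]
    have hlen : (l.take j).length = j := by simp; omega
    rw [hlen]
    refine (sum_le_sum fun i hi => ?_).trans
      (sum_le_sum_of_subset (fun i hi => by rw [mem_range] at hi ⊢; omega))
    rw [mem_range] at hi
    have h1 : (l.take j).take i = l.take i := by rw [List.take_take, min_eq_left hi.le]
    by_cases hv : disp (l.take j) = v
    · have h2 : disp ((l.take j).take i) + disp ((l.take j).drop i) = v := by
        rw [disp_take_add_drop, hv]
      have h3 : disp (l.drop j) = x - v := by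
        rw [eq_sub_iff_add_eq', ← hv, disp_take_add_drop, hl]
      simp only [hf]
      rw [if_pos hv, if_pos ⟨h2, h3⟩, h1]
      simp only [hW, hV, hb]
      rw [← ENNReal.ofReal_mul (mul_nonneg (hzp _) (hK _)),
        ← ENNReal.ofReal_mul (mul_nonneg (mul_nonneg (hzp _) (hK _)) (mul_nonneg (hzp _) (hK _))),
        ← ENNReal.ofReal_mul hβ0]
      refine ENNReal.ofReal_le_ofReal (le_of_eq ?_)
      have h4 : l.length = (l.take i).length + ((l.take j).drop i).length + (l.drop j).length := by
        simp; omega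
      rw [h4, pow_add, pow_add]
      ring
    · simp [hv]

theorem tsum_sub_left_eq (f : (Fin d → ℤ) → ℝ≥0∞) (x : Fin d → ℤ) :
    ∑' w, f (x - w) = ∑' w, f w := (Equiv.subLeft x).tsum_eq f

theorem tsum_sub_right_eq (f : (Fin d → ℤ) → ℝ≥0∞) (x : Fin d → ℤ) :
    ∑' w, f (w - x) = ∑' w, f w := (Equiv.subRight x).tsum_eq f

theorem mul_le_sq_add_sq (a b : ℝ≥0∞) : a * b ≤ a ^ 2 + b ^ 2 := by
  rcases le_total a b with h | h
  · exact (mul_le_mul_left h b).trans (by rw [← sq]; exact le_add_self)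
  · exact (mul_le_mul_right h a).trans (by rw [← sq]; exact le_self_add)

/-- The bound on the convolutions in the diagrams of the lace expansion. -/
theorem tsum_diagram_le {g : (Fin d → ℤ) → ℝ≥0∞} {κ : ℝ≥0∞} (hneg : ∀ x, g (-x) = g x)
    (hκ : ∀ x y, g x * g y ≤ κ * g (x + y) * (g x + g y)) (v x : Fin d → ℤ) :
    ∑' w, g w * g (v - w) * (g (x - v) * g (x - w) ^ 2) ≤
      κ * (κ * (7 * ∑' w, g w ^ 2)) * (g x * g (x - v) ^ 2) := by
  -- One factor g(x-w) is paired with g(w) and the other with g(v-w). This extracts g(x) and g(x-v),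
  -- and leaves quadratic terms dominated by squares, whose coefficients 2 + 3 + 2 give the 7.
  have hg : ∀ w, g w * g (v - w) * g (x - w) ^ 2 ≤ κ ^ 2 * (g x * g (x - v)) *
      (2 * g w ^ 2 + 3 * g (x - w) ^ 2 + 2 * g (w - v) ^ 2) := by
    intro w
    have h1 : g w * g (x - w) ≤ κ * g x * (g w + g (x - w)) := by
      simpa using hκ w (x - w)
    have h2 : g (v - w) * g (x - w) ≤ κ * g (x - v) * (g (w - v) + g (x - w)) := by
      have := hκ (w - v) (x - w)
      rw [show w - v + (x - w) = x - v by abel] at this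
      rwa [show g (v - w) = g (w - v) by rw [← hneg, neg_sub]]
    calc g w * g (v - w) * g (x - w) ^ 2 = (g w * g (x - w)) * (g (v - w) * g (x - w)) := by ring
      _ ≤ (κ * g x * (g w + g (x - w))) * (κ * g (x - v) * (g (w - v) + g (x - w))) :=
        mul_le_mul' h1 h2
      _ = κ ^ 2 * (g x * g (x - v)) * (g w * g (w - v) + g w * g (x - w) + g (x - w) * g (w - v) +
          g (x - w) ^ 2) := by ring
      _ ≤ κ ^ 2 * (g x * g (x - v)) * ((g w ^ 2 + g (w - v) ^ 2) + (g w ^ 2 + g (x - w) ^ 2) +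
          (g (x - w) ^ 2 + g (w - v) ^ 2) + g (x - w) ^ 2) := by
        gcongr <;> exact mul_le_sq_add_sq _ _
      _ = _ := by ring
  calc ∑' w, g w * g (v - w) * (g (x - v) * g (x - w) ^ 2)
      = g (x - v) * ∑' w, g w * g (v - w) * g (x - w) ^ 2 := by
        rw [← ENNReal.tsum_mul_left]
        exact tsum_congr fun w => by ring
    _ ≤ g (x - v) * ∑' w, κ ^ 2 * (g x * g (x - v)) *
          (2 * g w ^ 2 + 3 * g (x - w) ^ 2 + 2 * g (w - v) ^ 2) := by
        exact mul_le_mul_right (ENNReal.tsum_le_tsum hg) _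
    _ = _ := by
        rw [ENNReal.tsum_mul_left, ENNReal.tsum_add, ENNReal.tsum_add, ENNReal.tsum_mul_left,
          ENNReal.tsum_mul_left, ENNReal.tsum_mul_left, tsum_sub_left_eq (fun w => g w ^ 2),
          tsum_sub_right_eq (fun w => g w ^ 2)]
        ring

/-- The bound on the generating function of laces. -/
theorem laceGen_le {g : (Fin d → ℤ) → ℝ≥0∞} {κ a : ℝ≥0∞} (hg0 : g 0 = 1)
    (hneg : ∀ x, g (-x) = g x)
    (hκ : ∀ x y, g x * g y ≤ κ * g (x + y) * (g x + g y))
    {β z : ℝ} (hβ0 : 0 ≤ β) (hβ : β ≤ 1) (hz : 0 ≤ z) (hG : ∀ x, G d β z x ≤ a * g x)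
    (hsmall : ENNReal.ofReal β * (a * a * (κ * (κ * (7 * ∑' w, g w ^ 2))) * 2) ≤ 1)
    (n : ℕ) (v x : Fin d → ℤ) :
    laceGen β z n v x ≤ 2 * a * ENNReal.ofReal β * (g x * g (x - v) ^ 2) := by
  induction n generalizing v x with
  | zero => simp [laceGen, laceMaj]
  | succ n ih =>
    set b := ENNReal.ofReal β
    set S := κ * (κ * (7 * ∑' w, g w ^ 2))
    refine (laceGen_succ_le hβ0 hβ hz n v x).trans ?_
    -- The profile g(x)g(x-v)² is reproduced by the diagram, and the constant 2ab is preserved: the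
    -- terminal edge contributes ab, and the smallness condition makes the recursive term at most
    -- ab. Hence the bound does not depend on the depth.
    calc _ ≤ a * b * (g x * g (x - v) ^ 2) + b * ∑' w, (a * a * (2 * a * b)) *
          (g w * g (v - w) * (g (x - v) * g (x - w) ^ 2)) := by
          refine add_le_add ?_ (mul_le_mul_right (ENNReal.tsum_le_tsum fun w => ?_) b)
          · split_ifs with h
            · subst h
              rw [sub_self, hg0, one_pow, mul_one, mul_comm a b, mul_assoc]
              exact mul_le_mul_right (hG x) b
            · simp
          · refine (mul_le_mul' (mul_le_mul' (hG w) (hG (v - w))) (ih (w - v) (x - v))).trans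
              (le_of_eq ?_)
            rw [show x - v - (w - v) = x - w by abel]
            ring
      _ ≤ a * b * (g x * g (x - v) ^ 2) + b * ((a * a * (2 * a * b)) *
          (S * (g x * g (x - v) ^ 2))) := by
          rw [ENNReal.tsum_mul_left]
          gcongr
          exact tsum_diagram_le hneg hκ v x
      _ = a * b * (g x * g (x - v) ^ 2) + a * b * (g x * g (x - v) ^ 2) * (b * (a * a * S * 2)) := by
          ring
      _ ≤ a * b * (g x * g (x - v) ^ 2) + a * b * (g x * g (x - v) ^ 2) * 1 := by gcongr
      _ = _ := by ring

/-- With v = 0 the profile is the cube of the propagator bound. The depth needed depends on the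
walk, so one first restricts to finitely many walks and then uses that `laceGen_le` is uniform in
the depth. -/
theorem tsum_listJ_le {g : (Fin d → ℤ) → ℝ≥0∞} {κ a : ℝ≥0∞} (hg0 : g 0 = 1)
    (hneg : ∀ x, g (-x) = g x)
    (hκ : ∀ x y, g x * g y ≤ κ * g (x + y) * (g x + g y))
    {β z : ℝ} (hβ0 : 0 ≤ β) (hβ : β ≤ 1 / 2) (hz : 0 ≤ z) (hG : ∀ x, G d β z x ≤ a * g x)
    (hsmall : ENNReal.ofReal β * (a * a * (κ * (κ * (7 * ∑' w, g w ^ 2))) * 2) ≤ 1)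
    (x : Fin d → ℤ) :
    (∑' l : List (Step d), if disp l = x then ENNReal.ofReal (z ^ l.length * |listJ β l|) else 0) ≤
      4 * a * ENNReal.ofReal β * g x ^ 3 := by
  rw [ENNReal.tsum_eq_iSup_sum]
  refine iSup_le fun s => ?_
  set n := s.sup List.length with hn
  calc _ ≤ ∑ l ∈ s, 2 * (if disp l = x then
        ENNReal.ofReal (z ^ l.length * laceMaj β (n + 1) 0 l) else 0) := by
        refine sum_le_sum fun l hl => ?_
        split_ifs
        · rw [← ENNReal.ofReal_ofNat 2, ← ENNReal.ofReal_mul zero_le_two]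
          refine ENNReal.ofReal_le_ofReal ?_
          rw [mul_left_comm]
          exact mul_le_mul_of_nonneg_left (abs_listJ_le hβ0 hβ l (le_sup (f := List.length) hl))
            (pow_nonneg hz _)
        · simp
    _ ≤ 2 * laceGen β z (n + 1) 0 x := by
        rw [← mul_sum]
        exact mul_le_mul_right (ENNReal.sum_le_tsum s) 2
    _ ≤ 2 * (2 * a * ENNReal.ofReal β * (g x * g (x - 0) ^ 2)) := by
        gcongr
        exact laceGen_le hg0 hneg hκ hβ0 (by linarith) hz hG hsmall _ _ _
    _ = _ := by rw [sub_zero]; ring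

end WSAW

/-! ### Heat kernel bound by tilted Fourier inversion -/

namespace WSAW

open Finset MeasureTheory
open scoped ENNReal Real

variable {d : ℕ}

theorem volume_restrict_box (d : ℕ) :
    (volume : Measure (Fin d → ℝ)).restrict (box d) =
      Measure.pi fun _ => (volume : Measure ℝ).restrict (Set.Icc (-π) π) := by
  rw [box, ← Set.pi_univ_Icc, volume_pi, Measure.restrict_pi_pi]

theorem integral_Icc_cexp (m : ℤ) :
    ∫ t in Set.Icc (-π) π, Complex.exp (Complex.I * t * m) = if m = 0 then (2 * π : ℂ) else 0 := by
  rw [integral_Icc_eq_integral_Ioc, ← intervalIntegral.integral_of_le (by linarith [Real.pi_pos])]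
  split_ifs with h
  · subst h
    simp
    ring
  · have h1 : ∀ t : ℝ, Complex.exp (Complex.I * t * m) = Complex.exp ((Complex.I * m) * t) := by
      intro t; congr 1; ring
    simp_rw [h1]
    rw [integral_exp_mul_complex (mul_ne_zero Complex.I_ne_zero (by exact_mod_cast h))]
    have h2 : Complex.exp (Complex.I * m * (π : ℝ)) = Complex.exp (Complex.I * m * ((-π : ℝ) : ℂ)) := by
      rw [Complex.exp_eq_exp_iff_exists_int]
      exact ⟨m, by push_cast; ring⟩
    rw [h2, sub_self, zero_div]

theorem integral_box_cexp (y : Fin d → ℤ) :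
    ∫ k in box d, ∏ i, Complex.exp (Complex.I * (k i : ℝ) * y i) =
      if y = 0 then ((2 * π) ^ d : ℂ) else 0 := by
  rw [volume_restrict_box,
    integral_fintype_prod_eq_prod (fun i (t : ℝ) => Complex.exp (Complex.I * t * y i))]
  simp_rw [integral_Icc_cexp]
  split_ifs with h
  · simp [h]
  · obtain ⟨i, hi⟩ := Function.ne_iff.1 h
    exact prod_eq_zero (mem_univ i) (if_neg hi)

/-- The integrand has period π, so the integral is twice that over [-π/2, π/2], where Jordan's
inequality |sin t| ≥ 2|t|/π gives a Gaussian. -/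
theorem integral_exp_neg_sin_sq_le {s : ℝ} (hs : 0 < s) :
    ∫ t in Set.Icc (-π) π, Real.exp (-s * Real.sin t ^ 2) ≤ 2 * √(π ^ 3 / (4 * s)) := by
  have hpi := Real.pi_pos
  rw [integral_Icc_eq_integral_Ioc, ← intervalIntegral.integral_of_le (by linarith)]
  have hc : Continuous fun t => Real.exp (-s * Real.sin t ^ 2) := by fun_prop
  have hper : Function.Periodic (fun t => Real.exp (-s * Real.sin t ^ 2)) π := by
    intro t
    simp [Real.sin_add_pi]
  have h1 : ∫ t in (-π)..π, Real.exp (-s * Real.sin t ^ 2) =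
      2 * ∫ t in (-(π / 2))..(π / 2), Real.exp (-s * Real.sin t ^ 2) := by
    rw [← intervalIntegral.integral_add_adjacent_intervals (b := 0)
      (hc.intervalIntegrable _ _) (hc.intervalIntegrable _ _), two_mul]
    congr 1
    · have := hper.intervalIntegral_add_eq (-π) (-(π / 2))
      rw [show -π + π = 0 by ring, show -(π / 2) + π = π / 2 by ring] at this
      exact this
    · have := hper.intervalIntegral_add_eq 0 (-(π / 2))
      rw [zero_add, show -(π / 2) + π = π / 2 by ring] at this
      exact this
  rw [h1]
  refine mul_le_mul_of_nonneg_left ?_ zero_le_two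
  have hb : 0 < 4 / π ^ 2 * s := by positivity
  have h2 : √(π ^ 3 / (4 * s)) = ∫ t : ℝ, Real.exp (-(4 / π ^ 2 * s) * t ^ 2) := by
    rw [integral_gaussian]
    congr 1
    field_simp
  rw [h2, intervalIntegral.integral_of_le (by linarith)]
  refine (setIntegral_mono_on (hc.integrableOn_Ioc)
    (integrable_exp_neg_mul_sq hb).integrableOn measurableSet_Ioc fun t ht => ?_).trans
    (setIntegral_le_integral (integrable_exp_neg_mul_sq hb)
      (Filter.Eventually.of_forall fun t => (Real.exp_pos _).le))
  refine Real.exp_le_exp.2 ?_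
  have h3 : 2 / π * |t| ≤ |Real.sin t| := by
    have := Real.mul_abs_le_abs_sin (abs_le.2 ⟨ht.1.le, ht.2⟩)
    exact this
  have h4 : (2 / π * |t|) ^ 2 ≤ Real.sin t ^ 2 := by
    rw [← sq_abs (Real.sin t)]
    exact pow_le_pow_left₀ (by positivity) h3 2
  have h5 : (2 / π * |t|) ^ 2 = 4 / π ^ 2 * t ^ 2 := by
    rw [mul_pow, sq_abs, div_pow]; norm_num
  rw [h5] at h4
  nlinarith

/-- `2 ∑_i cosh(θ_i + i k_i)`, the generating function of the tilted step. -/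
noncomputable def tiltedStep (θ k : Fin d → ℝ) : ℂ :=
  2 * ∑ i, Complex.cosh (θ i + Complex.I * k i)

/-- The squared modulus is 1 + sinh²a - sin²b, and y ≤ (1 + y²)/2. The loss is measured by sin²b,
which vanishes at b = π as well as at 0, as the bipartite lattice requires. -/
theorem norm_cosh_le (a b : ℝ) : ‖Complex.cosh (a + Complex.I * b)‖ ≤
    1 + (Real.sinh a ^ 2 - Real.sin b ^ 2) / 2 := by
  have h1 : Complex.cosh (a + Complex.I * b) =
      (Real.cosh a * Real.cos b : ℝ) + (Real.sinh a * Real.sin b : ℝ) * Complex.I := by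
    rw [mul_comm, Complex.cosh_add, Complex.cosh_mul_I, Complex.sinh_mul_I]
    push_cast
    ring
  have h2 : ‖Complex.cosh (a + Complex.I * b)‖ ^ 2 = Real.sinh a ^ 2 + 1 - Real.sin b ^ 2 := by
    rw [h1, Complex.sq_norm, Complex.normSq_add_mul_I, mul_pow, mul_pow, Real.cosh_sq, Real.cos_sq']
    ring
  nlinarith [sq_nonneg (‖Complex.cosh (a + Complex.I * b)‖ - 1)]

/-- The inequality 1 + y ≤ exp y turns the sum over coordinates into a product, so that the
k-integral factorises. -/
theorem norm_tiltedStep_pow_le (hd : 0 < d) (θ k : Fin d → ℝ) (n : ℕ) :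
    ‖tiltedStep θ k‖ ^ n ≤ (2 * d) ^ n * (Real.exp (n / (2 * d) * ∑ i, Real.sinh (θ i) ^ 2) *
      ∏ i, Real.exp (-(n / (2 * d)) * Real.sin (k i) ^ 2)) := by
  have hd' : (0 : ℝ) < d := by exact_mod_cast hd
  have h1 : ‖tiltedStep θ k‖ ≤
      2 * d * Real.exp (1 / (2 * d) * ∑ i, (Real.sinh (θ i) ^ 2 - Real.sin (k i) ^ 2)) := by
    rw [tiltedStep, norm_mul]
    calc ‖(2 : ℂ)‖ * ‖∑ i, Complex.cosh (θ i + Complex.I * k i)‖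
        ≤ 2 * ∑ i, (1 + (Real.sinh (θ i) ^ 2 - Real.sin (k i) ^ 2) / 2) := by
          rw [Complex.norm_ofNat]
          exact mul_le_mul_of_nonneg_left
            ((norm_sum_le _ _).trans (sum_le_sum fun i _ => norm_cosh_le _ _)) zero_le_two
      _ = 2 * d * (1 / (2 * d) * ∑ i, (Real.sinh (θ i) ^ 2 - Real.sin (k i) ^ 2) + 1) := by
          rw [sum_add_distrib, ← sum_div]
          simp
          field_simp
          ring
      _ ≤ _ := mul_le_mul_of_nonneg_left (Real.add_one_le_exp _) (by positivity)
  refine (pow_le_pow_left₀ (norm_nonneg _) h1 n).trans (le_of_eq ?_)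
  rw [mul_pow, ← Real.exp_nat_mul, ← Real.exp_sum, ← Real.exp_add]
  congr 2
  rw [← mul_sum, sum_sub_distrib]
  ring

theorem sum_cexp_stepVec (κ : Fin d → ℂ) :
    ∑ s : Step d, Complex.exp (∑ i, κ i * (stepVec s i : ℤ)) = 2 * ∑ i, Complex.cosh (κ i) := by
  rw [Fintype.sum_prod_type, mul_sum]
  refine sum_congr rfl fun i _ => ?_
  rw [Fintype.sum_bool]
  have h : ∀ b : Bool, ∑ j, κ j * (stepVec (i, b) j : ℤ) = κ i * (if b then 1 else -1) := by
    intro b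
    rw [sum_eq_single_of_mem i (mem_univ _)]
    · cases b <;> simp [stepVec]
    · intro j _ hj
      simp [stepVec, hj]
  rw [h, h, Complex.cosh]
  simp
  ring

theorem prod_cexp_disp (κ : Fin d → ℂ) {n : ℕ} (s : Fin n → Step d) :
    ∏ i, Complex.exp (∑ j, κ j * (stepVec (s i) j : ℤ)) =
      Complex.exp (∑ j, κ j * (disp (List.ofFn s) j : ℤ)) := by
  rw [← Complex.exp_sum, sum_comm]
  congr 1
  refine sum_congr rfl fun j _ => ?_
  rw [← mul_sum, disp, List.map_ofFn, List.sum_ofFn]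
  simp

/-- The number of walks with `n` steps that end at `x`. -/
def walkCount (n : ℕ) (x : Fin d → ℤ) : ℕ :=
  (univ.filter fun s : Fin n → Step d => disp (List.ofFn s) = x).card

/-- Expanding the power sums over walks weighted by exp(θ·displacement), and orthogonality of
characters selects the endpoint x. The tilt θ produces the exponential factor without any contour
shift. -/
theorem walkCount_eq_integral (θ : Fin d → ℝ) (n : ℕ) (x : Fin d → ℤ) :
    ∫ k in box d, tiltedStep θ k ^ n * ∏ i, Complex.exp (Complex.I * (k i : ℝ) * (-x i : ℤ)) =
      (2 * π) ^ d * (Complex.exp (∑ i, θ i * (x i : ℤ)) * walkCount n x) := by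
  have h1 : ∀ k : Fin d → ℝ,
      tiltedStep θ k ^ n * ∏ i, Complex.exp (Complex.I * (k i : ℝ) * (-x i : ℤ)) =
      ∑ s : Fin n → Step d, Complex.exp (∑ i, θ i * (disp (List.ofFn s) i : ℤ)) *
        ∏ i, Complex.exp (Complex.I * (k i : ℝ) * (disp (List.ofFn s) - x : Fin d → ℤ) i) := by
    intro k
    rw [tiltedStep, ← sum_cexp_stepVec fun i => (θ i : ℂ) + Complex.I * k i, sum_pow',
      sum_mul]
    rw [Fintype.piFinset_univ]
    refine sum_congr rfl fun s _ => ?_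
    rw [prod_cexp_disp, ← Complex.exp_sum, ← Complex.exp_sum, ← Complex.exp_add,
      ← Complex.exp_add]
    congr 1
    rw [← sum_add_distrib, ← sum_add_distrib]
    refine sum_congr rfl fun i _ => ?_
    simp only [Pi.sub_apply]
    push_cast
    ring
  simp_rw [h1]
  rw [integral_finsetSum]
  · simp_rw [integral_const_mul, integral_box_cexp, sub_eq_zero]
    rw [walkCount, card_filter]
    push_cast
    rw [mul_sum, mul_sum]
    refine sum_congr rfl fun s _ => ?_
    split_ifs with h
    · rw [h]; ring
    · simp
  · intro s _
    refine Continuous.integrableOn_Icc ?_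
    fun_prop

theorem walkCount_le (hd : 0 < d) (θ : Fin d → ℝ) {n : ℕ} (hn : 0 < n) (x : Fin d → ℤ) :
    (2 * π) ^ d * (Real.exp (∑ i, θ i * (x i : ℝ)) * walkCount n x) ≤
      (2 * d) ^ n * (Real.exp (n / (2 * d) * ∑ i, Real.sinh (θ i) ^ 2) *
        (2 * √(π ^ 3 / (4 * (n / (2 * d))))) ^ d) := by
  have hpi := Real.pi_pos
  have hs : (0 : ℝ) < n / (2 * d) := by positivity
  have h1 : ((2 * π) ^ d * (Real.exp (∑ i, θ i * (x i : ℝ)) * walkCount n x) : ℝ) =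
      ‖∫ k in box d, tiltedStep θ k ^ n *
        ∏ i, Complex.exp (Complex.I * (k i : ℝ) * (-x i : ℤ))‖ := by
    rw [walkCount_eq_integral, norm_mul, norm_mul, Complex.norm_exp, norm_pow, norm_mul]
    simp [abs_of_pos hpi]
  rw [h1]
  have hcont : Continuous fun k : Fin d → ℝ => (2 * d : ℝ) ^ n *
      (Real.exp (n / (2 * d) * ∑ i, Real.sinh (θ i) ^ 2) *
      ∏ i, Real.exp (-(n / (2 * d)) * Real.sin (k i) ^ 2)) := by fun_prop
  refine (norm_integral_le_of_norm_le (hcont.integrableOn_Icc)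
    (Filter.Eventually.of_forall fun k => ?_)).trans ?_
  · rw [norm_mul, norm_pow, norm_prod]
    have : ∀ i, ‖Complex.exp (Complex.I * (k i : ℝ) * (-x i : ℤ))‖ = 1 := by
      intro i
      rw [Complex.norm_exp]
      simp
    simp_rw [this]
    rw [prod_const_one, mul_one]
    exact norm_tiltedStep_pow_le hd θ k n
  · simp_rw [integral_const_mul]
    refine mul_le_mul_of_nonneg_left (mul_le_mul_of_nonneg_left ?_ (Real.exp_pos _).le)
      (by positivity)
    change ∫ k in box d, _ ≤ _
    rw [volume_restrict_box, integral_fintype_prod_eq_pow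
      (fun t : ℝ => Real.exp (-(n / (2 * d)) * Real.sin t ^ 2)), Fintype.card_fin]
    exact pow_le_pow_left₀ (integral_nonneg fun t => (Real.exp_pos _).le)
      (integral_exp_neg_sin_sq_le hs) d

end WSAW

/-! ### Decay of the random walk Green function -/

namespace WSAW

open Finset MeasureTheory
open scoped ENNReal Real

variable {d : ℕ}

theorem exists_norm_eq_abs (hd : 0 < d) (x : Fin d → ℤ) : ∃ j, ‖x‖ = |(x j : ℝ)| := by
  have : Nonempty (Fin d) := ⟨⟨0, hd⟩⟩
  obtain ⟨j, hj⟩ := Finite.exists_max fun i => ‖x i‖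
  refine ⟨j, ?_⟩
  rw [← Int.norm_eq_abs]
  exact le_antisymm ((pi_norm_le_iff_of_nonneg (norm_nonneg _)).2 hj) (norm_le_pi_norm x j)

theorem sinh_sq_le {t : ℝ} (ht : t ^ 2 ≤ 1) : Real.sinh t ^ 2 ≤ 2 * t ^ 2 := by
  have h1 := Real.cosh_le_exp_half_sq t
  have h2 : Real.cosh t ^ 2 ≤ Real.exp (t ^ 2) := by
    refine (pow_le_pow_left₀ (Real.cosh_pos t).le h1 2).trans (le_of_eq ?_)
    rw [← Real.exp_nat_mul]
    congr 1
    push_cast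
    ring
  have h3 := Real.abs_exp_sub_one_le (x := t ^ 2) (by rwa [abs_of_nonneg (sq_nonneg t)])
  rw [abs_of_nonneg (sq_nonneg t)] at h3
  have h4 := (abs_le.1 h3).2
  have h5 := Real.cosh_sq t
  linarith

/-- The heat kernel bound for simple random walk. -/
theorem exists_walkCount_le (hd : 0 < d) : ∃ c : ℝ, 0 < c ∧ ∀ n : ℕ, 0 < n → ∀ x : Fin d → ℤ,
    walkCount n x / (2 * d : ℝ) ^ n ≤ c * ((√n ^ d)⁻¹ * Real.exp (-((1 + ‖x‖) / √n))) := by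
  have hpi := Real.pi_pos
  have hd' : (0 : ℝ) < d := by exact_mod_cast hd
  refine ⟨((2 * π) ^ d)⁻¹ * Real.exp (1 / d) * (2 * √(π ^ 3 * d / 2)) ^ d * Real.exp 1,
    by positivity, fun n hn x => ?_⟩
  have hn' : (0 : ℝ) < n := by exact_mod_cast hn
  have hsn : (1 : ℝ) ≤ √n := by rw [Real.one_le_sqrt]; exact_mod_cast hn
  have hsq : √(n : ℝ) ^ 2 = n := Real.sq_sqrt hn'.le
  obtain ⟨j, hj⟩ := exists_norm_eq_abs hd x
  -- The tilt points along the largest coordinate of x and has size 1/√n: it gains exp(-‖x‖/√n),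
  -- while n sinh²θ stays bounded.
  set σ : ℝ := if 0 ≤ x j then 1 else -1 with hσ
  have hσ2 : σ ^ 2 = 1 := by rw [hσ]; split_ifs <;> norm_num
  have hσx : σ * x j = |(x j : ℝ)| := by
    rw [hσ]
    split_ifs with h
    · rw [one_mul, abs_of_nonneg (by exact_mod_cast h)]
    · rw [abs_of_nonpos (by exact_mod_cast (not_le.1 h).le)]; ring
  have key := walkCount_le hd (Pi.single j (σ / √n)) hn x
  have e1 : ∑ i, (Pi.single j (σ / √n) : Fin d → ℝ) i * (x i : ℝ) = ‖x‖ / √n := by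
    rw [sum_eq_single_of_mem j (mem_univ _) fun i _ hi => by simp [hi], Pi.single_eq_same, hj,
      ← hσx]
    ring
  have e2 : ∑ i, Real.sinh ((Pi.single j (σ / √n) : Fin d → ℝ) i) ^ 2 ≤ 2 / n := by
    rw [sum_eq_single_of_mem j (mem_univ _) fun i _ hi => by simp [hi], Pi.single_eq_same]
    have h1 : (σ / √n) ^ 2 = 1 / n := by rw [div_pow, hσ2, hsq]
    refine (sinh_sq_le ?_).trans (le_of_eq ?_)
    · rw [h1, div_le_one hn']; exact_mod_cast hn
    · rw [h1]; ring
  have e3 : Real.exp (n / (2 * d) * ∑ i, Real.sinh ((Pi.single j (σ / √n) : Fin d → ℝ) i) ^ 2) ≤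
      Real.exp (1 / d) := by
    refine Real.exp_le_exp.2 ((mul_le_mul_of_nonneg_left e2 (by positivity)).trans (le_of_eq ?_))
    field_simp
  have e4 : √(π ^ 3 / (4 * (n / (2 * d)))) = √(π ^ 3 * d / 2) * (√n)⁻¹ := by
    rw [← Real.sqrt_inv, ← Real.sqrt_mul (by positivity)]
    congr 1
    field_simp
    norm_num
  rw [e1, e4] at key
  -- Replacing ‖x‖ by 1 + ‖x‖ costs at most a factor e, because √n ≥ 1.
  have e5 : Real.exp (-((1 + ‖x‖) / √n)) * Real.exp 1 ≥ (Real.exp (‖x‖ / √n))⁻¹ := by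
    rw [← Real.exp_neg, ← Real.exp_add]
    refine Real.exp_le_exp.2 ?_
    have : 1 / √n ≤ 1 := by rw [div_le_one (by linarith)]; exact hsn
    rw [add_div]
    linarith
  have h6 : walkCount n x / (2 * d : ℝ) ^ n ≤ ((2 * π) ^ d)⁻¹ * Real.exp (1 / d) *
      (2 * √(π ^ 3 * d / 2)) ^ d * (√n ^ d)⁻¹ * (Real.exp (‖x‖ / √n))⁻¹ := by
    have h7 := key.trans (mul_le_mul_of_nonneg_left (mul_le_mul_of_nonneg_right e3 (by positivity))
      (by positivity))
    rw [← mul_assoc 2, mul_pow _ (√n)⁻¹] at h7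
    rw [div_le_iff₀ (by positivity)]
    have hE := Real.exp_pos (‖x‖ / √n)
    calc (walkCount n x : ℝ) = ((2 * π) ^ d * (Real.exp (‖x‖ / √n) * walkCount n x)) *
          ((2 * π) ^ d * Real.exp (‖x‖ / √n))⁻¹ := by field_simp
      _ ≤ _ := mul_le_mul_of_nonneg_right h7 (by positivity)
      _ = _ := by rw [mul_inv]; ring
  calc _ ≤ _ := h6
    _ ≤ ((2 * π) ^ d)⁻¹ * Real.exp (1 / d) *
      (2 * √(π ^ 3 * d / 2)) ^ d * (√n ^ d)⁻¹ * (Real.exp (-((1 + ‖x‖) / √n)) * Real.exp 1) :=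
      mul_le_mul_of_nonneg_left e5 (by positivity)
    _ = _ := by ring

/-- The bound on the Green function of simple random walk. -/
noncomputable def decay (x : Fin d → ℤ) : ℝ := ((1 + ‖x‖) ^ (d - 2))⁻¹

theorem decay_pos (x : Fin d → ℤ) : 0 < decay x := by
  have := norm_nonneg x
  unfold decay
  positivity

/-- The sum over times splits at the diffusive scale m². Below it there are m² terms; above it the
tail of ∑ n⁻² is at most 2/m². Here e + 4 plays the role of the dimension. -/
theorem sum_range_le_of_split {f : ℕ → ℝ} {c : ℝ} {m e : ℕ} (hm : 0 < m) (hc : 0 ≤ c)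
    (h1 : ∀ n < m ^ 2, f n ≤ c * ((m : ℝ) ^ (e + 4))⁻¹)
    (h2 : ∀ n, m ^ 2 ≤ n → f n ≤ c * (((m : ℝ) ^ e)⁻¹ * ((n : ℝ) ^ 2)⁻¹))
    (hf : ∀ n, 0 ≤ f n) (N : ℕ) :
    ∑ n ∈ range N, f n ≤ 3 * c * ((m : ℝ) ^ (e + 2))⁻¹ := by
  have hm' : (0 : ℝ) < m := by exact_mod_cast hm
  have hsub : range N ⊆ range (m ^ 2) ∪ Ioo (m ^ 2 - 1) N := by
    intro n hn
    rw [mem_union, mem_range, mem_Ioo]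
    rw [mem_range] at hn
    have : 0 < m ^ 2 := by positivity
    omega
  have hdisj : Disjoint (range (m ^ 2)) (Ioo (m ^ 2 - 1) N) := by
    rw [Finset.disjoint_left]
    intro n hn hn'
    rw [mem_range] at hn
    rw [mem_Ioo] at hn'
    omega
  refine (sum_le_sum_of_subset_of_nonneg hsub fun n _ _ => hf n).trans ?_
  rw [sum_union hdisj]
  have b1 : ∑ n ∈ range (m ^ 2), f n ≤ c * ((m : ℝ) ^ (e + 2))⁻¹ := by
    refine (sum_le_sum fun n hn => h1 n (mem_range.1 hn)).trans (le_of_eq ?_)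
    rw [sum_const, card_range, nsmul_eq_mul]
    push_cast
    field_simp
    ring
  have b2 : ∑ n ∈ Ioo (m ^ 2 - 1) N, f n ≤ 2 * c * ((m : ℝ) ^ (e + 2))⁻¹ := by
    calc ∑ n ∈ Ioo (m ^ 2 - 1) N, f n
        ≤ ∑ n ∈ Ioo (m ^ 2 - 1) N, c * (((m : ℝ) ^ e)⁻¹ * ((n : ℝ) ^ 2)⁻¹) := by
          refine sum_le_sum fun n hn => h2 n ?_
          rw [mem_Ioo] at hn
          omega
      _ = c * (((m : ℝ) ^ e)⁻¹ * ∑ n ∈ Ioo (m ^ 2 - 1) N, ((n : ℝ) ^ 2)⁻¹) := by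
          rw [mul_sum, mul_sum]
      _ ≤ c * (((m : ℝ) ^ e)⁻¹ * (2 / ((m ^ 2 - 1 : ℕ) + 1))) := by
          gcongr
          exact sum_Ioo_inv_sq_le _ _
      _ = _ := by
          have : ((m ^ 2 - 1 : ℕ) : ℝ) + 1 = (m : ℝ) ^ 2 := by
            have : 1 ≤ m ^ 2 := Nat.one_le_pow _ _ hm
            push_cast [Nat.cast_sub this]
            ring
          rw [this, pow_add]
          field_simp
  linarith

theorem C_eq_tsum_walkCount (x : Fin d → ℤ) :
    C d (1 / (2 * d)) x = ∑' n : ℕ, ENNReal.ofReal (walkCount n x / (2 * d : ℝ) ^ n) := by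
  rw [C]
  refine tsum_congr fun n => ?_
  rw [sum_walks, ← sum_filter, sum_const, ← walkCount, nsmul_eq_mul, ← ENNReal.ofReal_natCast,
    ← ENNReal.ofReal_mul (by positivity)]
  congr 1
  rw [one_div, inv_pow, div_eq_mul_inv]

theorem exists_C_le (hd : 4 < d) : ∃ c : ℝ, 0 < c ∧ ∀ x : Fin d → ℤ,
    C d (1 / (2 * d)) x ≤ ENNReal.ofReal (c * decay x) := by
  obtain ⟨c, hc, h⟩ := exists_walkCount_le (show 0 < d by omega)
  obtain ⟨e, rfl⟩ : ∃ e, d = e + 4 := ⟨d - 4, by omega⟩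
  -- The summand 1 accounts for time zero, where there is no heat kernel bound; the factorial comes
  -- from trading the exponential for a power when n < m².
  set A : ℝ := 1 + c * (1 + ((2 * (e + 4)).factorial : ℕ)) with hA
  have hA1 : 1 ≤ A := by
    have : 0 ≤ c * (1 + ((2 * (e + 4)).factorial : ℕ)) := by positivity
    linarith
  refine ⟨3 * A, by positivity, fun x => ?_⟩
  obtain ⟨j, hj⟩ := exists_norm_eq_abs (show 0 < e + 4 by omega) x
  obtain ⟨m, hm, hmx⟩ : ∃ m : ℕ, 0 < m ∧ 1 + ‖x‖ = m :=
    ⟨1 + (x j).natAbs, by omega, by rw [hj]; push_cast; rw [Nat.cast_natAbs]; simp⟩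
  have hm' : (1 : ℝ) ≤ m := by exact_mod_cast hm
  rw [C_eq_tsum_walkCount]
  refine ENNReal.tsum_le_of_sum_range_le fun N => ?_
  rw [← ENNReal.ofReal_sum_of_nonneg fun _ _ => by positivity]
  refine ENNReal.ofReal_le_ofReal ?_
  rw [decay, hmx, show e + 4 - 2 = e + 2 by omega]
  have hz : ∀ n, n = 0 → walkCount n x / (2 * ((e + 4 : ℕ) : ℝ)) ^ n ≤ if x = 0 then 1 else 0 := by
    rintro n rfl
    simp only [walkCount, pow_zero, div_one]
    by_cases hx : x = 0
    · subst hx; simp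
    · have : ¬ (0 = x) := fun h => hx h.symm
      simp [hx, this]
  refine sum_range_le_of_split hm (by positivity) (fun n hn => ?_) (fun n hn => ?_)
    (fun n => by positivity) N
  · rcases n.eq_zero_or_pos with h0 | h0
    · refine (hz n h0).trans ?_
      split_ifs with hx
      · subst hx
        rw [norm_zero, add_zero] at hmx
        rw [← hmx]
        simpa using hA1
      · positivity
    · refine (h n h0 x).trans ?_
      rw [hmx]
      have hn0 : (0 : ℝ) < n := by exact_mod_cast h0
      have hs : 0 < √(n : ℝ) := Real.sqrt_pos.2 hn0
      -- Of the 2d powers of √n/m gained, d cancel the prefactor n^{-d/2} in favour of m^{-d}; the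
      -- others are at most 1.
      have h1 : Real.exp (-(m / √n)) ≤ ((2 * (e + 4)).factorial : ℕ) * (√n / m) ^ (2 * (e + 4)) := by
        have := Real.pow_div_factorial_le_exp (x := m / √n) (by positivity) (2 * (e + 4))
        rw [Real.exp_neg, inv_le_iff_one_le_mul₀ (Real.exp_pos _)]
        rw [div_le_iff₀ (by positivity)] at this
        calc (1 : ℝ) = (√n / m) ^ (2 * (e + 4)) * (m / √n) ^ (2 * (e + 4)) := by
              rw [← mul_pow, div_mul_div_cancel₀ (by positivity), div_self hs.ne', one_pow]
          _ ≤ (√n / m) ^ (2 * (e + 4)) * (Real.exp (m / √n) * ((2 * (e + 4)).factorial : ℕ)) := by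
              gcongr
          _ = _ := by ring
      have h2 : √(n : ℝ) ≤ m := by
        rw [Real.sqrt_le_left (by positivity)]
        exact_mod_cast hn.le
      calc c * ((√n ^ (e + 4))⁻¹ * Real.exp (-(m / √n)))
          ≤ c * ((√n ^ (e + 4))⁻¹ * (((2 * (e + 4)).factorial : ℕ) * (√n / m) ^ (2 * (e + 4)))) := by
            gcongr
        _ = c * ((2 * (e + 4)).factorial : ℕ) * ((√n / m) ^ (e + 4) * ((m : ℝ) ^ (e + 4))⁻¹) := by
            generalize e + 4 = q
            rw [two_mul, pow_add, div_pow]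
            field_simp
        _ ≤ c * ((2 * (e + 4)).factorial : ℕ) * (1 * ((m : ℝ) ^ (e + 4))⁻¹) := by
            gcongr
            exact pow_le_one₀ (by positivity) (by rw [div_le_one (by positivity)]; exact h2)
        _ ≤ A * ((m : ℝ) ^ (e + 4))⁻¹ := by
            rw [one_mul]
            gcongr
            rw [hA]
            linarith
  · have h0 : 0 < n := lt_of_lt_of_le (by positivity) hn
    refine (h n h0 x).trans ?_
    have hn0 : (0 : ℝ) < n := by exact_mod_cast h0
    have hs : 0 < √(n : ℝ) := Real.sqrt_pos.2 hn0
    have h2 : (m : ℝ) ≤ √n := by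
      rw [Real.le_sqrt' (by positivity)]
      exact_mod_cast hn
    have h4 : √(n : ℝ) ^ 4 = (n : ℝ) ^ 2 := by
      rw [show (4 : ℕ) = 2 * 2 by norm_num, pow_mul, Real.sq_sqrt hn0.le]
    calc c * ((√n ^ (e + 4))⁻¹ * Real.exp (-((1 + ‖x‖) / √n)))
        ≤ c * ((√n ^ (e + 4))⁻¹ * 1) := by
          gcongr
          rw [Real.exp_le_one_iff, neg_nonpos]
          positivity
      _ = c * ((√n ^ e)⁻¹ * ((n : ℝ) ^ 2)⁻¹) := by rw [pow_add, h4, mul_inv, mul_one]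
      _ ≤ A * (((m : ℝ) ^ e)⁻¹ * ((n : ℝ) ^ 2)⁻¹) := by
          gcongr
          rw [hA]
          have : 0 ≤ c * ((2 * (e + 4)).factorial : ℕ) := by positivity
          linarith

end WSAW

/-! ### Summability of the decay profile and moments of the lace sum -/

namespace WSAW

open Finset MeasureTheory
open scoped ENNReal Real

variable {d : ℕ}

theorem tsum_pi_prod_eq (a : ℤ → ℝ≥0∞) (n : ℕ) :
    ∑' x : Fin n → ℤ, ∏ i, a (x i) = (∑' m, a m) ^ n := by
  induction n with
  | zero => simp
  | succ n ih =>
    rw [← (Fin.consEquiv fun _ : Fin (n + 1) => ℤ).tsum_eq, ENNReal.tsum_prod']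
    simp_rw [Fin.consEquiv_apply, Fin.prod_univ_succ, Fin.cons_zero, Fin.cons_succ,
      ENNReal.tsum_mul_left, ih]
    rw [ENNReal.tsum_mul_right, pow_succ']

theorem summable_one_add_abs_rpow {p : ℝ} (hp : 1 < p) :
    Summable fun m : ℤ => (1 + |(m : ℝ)|) ^ (-p) := by
  refine Summable.of_norm_bounded_eventually (Real.summable_abs_int_rpow hp) ?_
  rw [Filter.eventually_cofinite]
  refine (Set.finite_singleton (0 : ℤ)).subset fun m hm => ?_
  by_contra hne
  refine hm ?_
  have : 0 < |(m : ℝ)| := abs_pos.2 (by exact_mod_cast hne)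
  rw [Real.norm_of_nonneg (by positivity)]
  exact Real.rpow_le_rpow_of_nonpos this (by linarith) (by linarith)

/-- `∑_x (1 + ‖x‖)^{-(d+1)}` is finite. -/
theorem tsum_one_add_norm_lt_top (hd : 0 < d) :
    ∑' x : Fin d → ℤ, ENNReal.ofReal ((1 + ‖x‖) ^ (d + 1))⁻¹ < ∞ := by
  have hd' : (0 : ℝ) < d := by exact_mod_cast hd
  -- The exponent d + 1 is shared equally between the coordinates; each share exceeds 1, so the
  -- dominating product is summable.
  set p : ℝ := (d + 1) / d with hp
  have hp1 : 1 < p := by rw [hp, lt_div_iff₀ hd']; linarith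
  calc ∑' x : Fin d → ℤ, ENNReal.ofReal ((1 + ‖x‖) ^ (d + 1))⁻¹
      ≤ ∑' x : Fin d → ℤ, ∏ i, ENNReal.ofReal ((1 + |(x i : ℝ)|) ^ (-p)) := by
        refine ENNReal.tsum_le_tsum fun x => ?_
        rw [← ENNReal.ofReal_prod_of_nonneg fun i _ => by positivity]
        refine ENNReal.ofReal_le_ofReal ?_
        have h1 : ((1 + ‖x‖) ^ (d + 1))⁻¹ = ∏ _i : Fin d, (1 + ‖x‖) ^ (-p) := by
          rw [prod_const, card_univ, Fintype.card_fin, ← Real.rpow_natCast (_ ^ (-p)) d,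
            ← Real.rpow_mul (by positivity), ← Real.rpow_natCast (1 + ‖x‖), ← Real.rpow_neg (by positivity)]
          congr 1
          rw [hp]
          push_cast
          field_simp
        rw [h1]
        refine prod_le_prod (fun i _ => by positivity) fun i _ => ?_
        refine Real.rpow_le_rpow_of_nonpos (by positivity) ?_ (by linarith)
        have := norm_le_pi_norm x i
        rw [Int.norm_eq_abs] at this
        linarith
    _ = (∑' m : ℤ, ENNReal.ofReal ((1 + |(m : ℝ)|) ^ (-p))) ^ d :=
        tsum_pi_prod_eq (fun m : ℤ => ENNReal.ofReal ((1 + |(m : ℝ)|) ^ (-p))) d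
    _ < ∞ := ENNReal.pow_lt_top
        (summable_one_add_abs_rpow hp1).tsum_ofReal_lt_top

/-- This is the bubble condition: 2(d-2) ≥ d + 1 needs d > 4. -/
theorem tsum_decay_sq_lt_top (hd : 4 < d) : ∑' x : Fin d → ℤ, ENNReal.ofReal (decay x) ^ 2 < ∞ := by
  refine lt_of_le_of_lt (ENNReal.tsum_le_tsum fun x => ?_) (tsum_one_add_norm_lt_top (d := d) (by omega))
  rw [← ENNReal.ofReal_pow (decay_pos x).le]
  refine ENNReal.ofReal_le_ofReal ?_
  have := norm_nonneg x
  rw [decay, inv_pow, ← pow_mul]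
  gcongr
  · linarith
  · omega

/-- The cube of the propagator decays with exponent 3(d-2), which must pay for summability and for
`nd d` moments. Equality holds for d = 5 and d = 6; for d = 5 the value d - 1 would be too large. -/
theorem two_mul_nd_add (hd : 4 < d) : nd d + (d + 1) ≤ 3 * (d - 2) := by
  unfold nd
  split_ifs <;> omega

theorem tsum_decay_cube_lt_top (hd : 4 < d) :
    ∑' x : Fin d → ℤ, ENNReal.ofReal ((1 + ‖x‖) ^ nd d) * ENNReal.ofReal (decay x) ^ 3 < ∞ := by
  refine lt_of_le_of_lt (ENNReal.tsum_le_tsum fun x => ?_) (tsum_one_add_norm_lt_top (d := d) (by omega))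
  have := norm_nonneg x
  rw [← ENNReal.ofReal_pow (decay_pos x).le, ← ENNReal.ofReal_mul (by positivity)]
  refine ENNReal.ofReal_le_ofReal ?_
  rw [decay, inv_pow, ← pow_mul, ← div_eq_mul_inv, div_le_iff₀ (by positivity),
    inv_mul_eq_div, le_div_iff₀ (by positivity), ← pow_add]
  refine pow_le_pow_right₀ (by linarith) ?_
  have := two_mul_nd_add hd
  omega

/-- The longer of the two vectors has at least half the norm of their sum, so its decay factor is
controlled by that of x + y. -/
theorem decay_mul_le (x y : Fin d → ℤ) :
    decay x * decay y ≤ 2 ^ (d - 2) * decay (x + y) * (decay x + decay y) := by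
  have key : ∀ a b : Fin d → ℤ, ‖a‖ ≤ ‖b‖ → decay b ≤ 2 ^ (d - 2) * decay (a + b) := by
    intro a b hab
    have ha := norm_nonneg a
    have h1 := norm_add_le a b
    have h2 := norm_nonneg (a + b)
    rw [decay, decay, ← div_eq_mul_inv, le_div_iff₀ (by positivity), inv_mul_le_iff₀ (by positivity),
      ← mul_pow]
    exact pow_le_pow_left₀ (by positivity) (by linarith) _
  have hx := decay_pos x
  have hy := decay_pos y
  have hxy := decay_pos (x + y)
  rcases le_total ‖x‖ ‖y‖ with h | h
  · calc decay x * decay y ≤ decay x * (2 ^ (d - 2) * decay (x + y)) := by gcongr; exact key x y h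
      _ = 2 ^ (d - 2) * decay (x + y) * decay x := by ring
      _ ≤ _ := by gcongr; linarith
  · have := key y x h
    rw [add_comm y x] at this
    calc decay x * decay y ≤ 2 ^ (d - 2) * decay (x + y) * decay y := by gcongr
      _ ≤ _ := by gcongr; linarith

/-- The diagrammatic bound: moments of the lace expansion function are of order `β`. -/
theorem exists_moment_bound (hd : 4 < d) : ∃ β₀ K : ℝ, 0 < β₀ ∧ β₀ ≤ 1 / 2 ∧ 0 < K ∧
    ∀ β, 0 < β → β ≤ β₀ → ∀ z, 0 ≤ z → b d β z ≤ 3 →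
      ∑' l : List (Step d), ENNReal.ofReal ((1 + ‖disp l‖) ^ nd d * |z ^ l.length * listJ β l|) ≤
        ENNReal.ofReal (K * β) := by
  obtain ⟨c, hc, hC⟩ := exists_C_le hd
  set g : (Fin d → ℤ) → ℝ≥0∞ := fun x => ENNReal.ofReal (decay x) with hg
  set κ : ℝ≥0∞ := ENNReal.ofReal (2 ^ (d - 2)) with hκ
  set a : ℝ≥0∞ := ENNReal.ofReal (3 * c) with ha
  set B : ℝ≥0∞ := a * a * (κ * (κ * (7 * ∑' w, g w ^ 2))) * 2 with hB
  have hBtop : B < ∞ := by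
    have := tsum_decay_sq_lt_top hd
    finiteness
  set M : ℝ≥0∞ := ∑' x : Fin d → ℤ, ENNReal.ofReal ((1 + ‖x‖) ^ nd d) * g x ^ 3 with hM
  have hMtop : M < ∞ := tsum_decay_cube_lt_top hd
  -- The bound 1/2 keeps every edge factor at least 1/2; the other one closes the lace recursion.
  -- The constant is 4a = 12c times the moment M of the cubed profile, plus 1 for positivity.
  refine ⟨min (1 / 2) (B.toReal + 1)⁻¹, 12 * c * M.toReal + 1, by positivity, min_le_left _ _,
    by positivity, fun β hβ0 hβ z hz hb => ?_⟩
  have hβ1 : β ≤ 1 / 2 := hβ.trans (min_le_left _ _)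
  have hG : ∀ x, G d β z x ≤ a * g x := by
    intro x
    have h1 : G d β z x / C d (1 / (2 * d)) x ≤ 3 := (le_iSup (fun x => G d β z x / C d (1 / (2 * d)) x) x).trans hb
    have h2 : G d β z x ≤ 3 * C d (1 / (2 * d)) x := by
      -- In extended arithmetic a positive number over 0 is ∞, so a finite ratio forces the
      -- numerator to vanish too.
      by_cases h0 : C d (1 / (2 * d)) x = 0
      · rw [h0] at h1
        by_contra hne
        have h3 : G d β z x ≠ 0 := fun h => hne (by rw [h]; exact zero_le)
        rw [ENNReal.div_zero h3] at h1
        exact absurd h1 (by simp)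
      · exact (ENNReal.div_le_iff h0 (ne_top_of_le_ne_top ENNReal.ofReal_ne_top (hC x))).1 h1
    refine h2.trans ((mul_le_mul_right (hC x) 3).trans (le_of_eq ?_))
    rw [ha, hg, ← ENNReal.ofReal_mul (by positivity), ← ENNReal.ofReal_ofNat 3,
      ← ENNReal.ofReal_mul (by norm_num), mul_assoc]
  have hsmall : ENNReal.ofReal β * B ≤ 1 := by
    rw [← ENNReal.ofReal_toReal hBtop.ne, ← ENNReal.ofReal_mul hβ0.le, ENNReal.ofReal_le_one]
    have h1 : β ≤ (B.toReal + 1)⁻¹ := hβ.trans (min_le_right _ _)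
    have h2 : 0 ≤ B.toReal := ENNReal.toReal_nonneg
    calc β * B.toReal ≤ (B.toReal + 1)⁻¹ * (B.toReal + 1) := by gcongr; linarith
      _ = 1 := inv_mul_cancel₀ (by positivity)
  have hκ' : ∀ x y, g x * g y ≤ κ * g (x + y) * (g x + g y) := by
    intro x y
    have hx := (decay_pos x).le
    have hy := (decay_pos y).le
    have hxy := (decay_pos (x + y)).le
    simp only [hg, hκ]
    rw [← ENNReal.ofReal_mul hx, ← ENNReal.ofReal_add hx hy, ← ENNReal.ofReal_mul (by positivity),
      ← ENNReal.ofReal_mul (by positivity)]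
    exact ENNReal.ofReal_le_ofReal (decay_mul_le x y)
  have key := tsum_listJ_le (g := g) (κ := κ) (a := a) (by simp [hg, decay])
    (by simp [hg, decay]) hκ' hβ0.le hβ1 hz hG hsmall
  rw [tsum_eq_tsum_disp]
  calc _ ≤ ∑' x : Fin d → ℤ, ENNReal.ofReal ((1 + ‖x‖) ^ nd d) *
        (4 * a * ENNReal.ofReal β * g x ^ 3) := by
        refine ENNReal.tsum_le_tsum fun x => ?_
        refine le_trans (le_of_eq ?_) (mul_le_mul_right (key x) _)
        rw [← ENNReal.tsum_mul_left]
        refine tsum_congr fun l => ?_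
        split_ifs with h
        · rw [h, abs_mul, abs_of_nonneg (pow_nonneg hz _), ← ENNReal.ofReal_mul (by positivity)]
        · simp
    _ = 4 * a * ENNReal.ofReal β * M := by
        rw [hM, ← ENNReal.tsum_mul_left]
        exact tsum_congr fun x => by ring
    _ = ENNReal.ofReal (12 * c * M.toReal * β) := by
        rw [← ENNReal.ofReal_toReal hMtop.ne, ha, ← ENNReal.ofReal_ofNat 4,
          ← ENNReal.ofReal_mul (by norm_num), ← ENNReal.ofReal_mul (by positivity),
          ← ENNReal.ofReal_mul (by positivity), ENNReal.toReal_ofReal ENNReal.toReal_nonneg]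
        congr 1
        ring
    _ ≤ _ := by
        refine ENNReal.ofReal_le_ofReal ?_
        gcongr
        linarith

/-! ### Sums over lists with given displacement -/

/-- The sum of `w` over the lists of steps with displacement `x`. -/
noncomputable def listSum (w : List (Step d) → ℝ) (x : Fin d → ℤ) : ℝ :=
  ∑' l, if disp l = x then w l else 0

theorem listSum_mul (w : List (Step d) → ℝ) (h : (Fin d → ℤ) → ℂ) (x : Fin d → ℤ) :
    (listSum w x : ℂ) * h x =
      ∑' l : disp ⁻¹' {x}, (w (l : List (Step d)) : ℂ) * h (disp (l : List (Step d))) := by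
  rw [listSum, Complex.ofReal_tsum, ← tsum_mul_right,
    tsum_subtype (disp ⁻¹' {x}) fun l : List (Step d) => (w l : ℂ) * h (disp l)]
  refine tsum_congr fun l => ?_
  by_cases hl : disp l = x
  · simp [hl]
  · simp [hl]

theorem summable_norm_listSum_mul {w : List (Step d) → ℝ} {h : (Fin d → ℤ) → ℂ}
    (hs : Summable fun l : List (Step d) => ‖(w l : ℂ) * h (disp l)‖) :
    (Summable fun x => ‖(listSum w x : ℂ) * h x‖) ∧
      ∑' x, ‖(listSum w x : ℂ) * h x‖ ≤ ∑' l : List (Step d), ‖(w l : ℂ) * h (disp l)‖ := by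
  have h1 := (Equiv.sigmaFiberEquiv (disp (d := d))).summable_iff.2 hs
  have h2 := hs.hasSum.tsum_fiberwise (disp (d := d))
  have h3 : ∀ x, ‖(listSum w x : ℂ) * h x‖ ≤
      ∑' l : disp ⁻¹' {x}, ‖(w (l : List (Step d)) : ℂ) * h (disp (l : List (Step d)))‖ := by
    intro x
    rw [listSum_mul]
    exact norm_tsum_le_tsum_norm (hs.subtype (disp ⁻¹' {x}))
  have h4 := Summable.of_nonneg_of_le (fun x => norm_nonneg _) h3 h2.summable
  exact ⟨h4, (h4.tsum_le_tsum h3 h2.summable).trans_eq h2.tsum_eq⟩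

theorem tsum_listSum_mul {w : List (Step d) → ℝ} {h : (Fin d → ℤ) → ℂ}
    (hs : Summable fun l : List (Step d) => ‖(w l : ℂ) * h (disp l)‖) :
    ∑' x, (listSum w x : ℂ) * h x = ∑' l : List (Step d), (w l : ℂ) * h (disp l) := by
  rw [← (hs.of_norm.hasSum.tsum_fiberwise (disp (d := d))).tsum_eq]
  exact tsum_congr fun x => listSum_mul w h x

theorem tsum_list_eq_of_summable {α : Type*} [Fintype α] {f : List α → ℝ} (hf : Summable f) :
    ∑' l, f l = ∑' n : ℕ, ∑ s : Fin n → α, f (List.ofFn s) := by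
  rw [← List.equivSigmaTuple.symm.tsum_eq]
  change ∑' c, (f ∘ List.equivSigmaTuple.symm) c = _
  rw [(List.equivSigmaTuple.symm.summable_iff.2 hf).tsum_sigma' fun n => Summable.of_finite]
  refine tsum_congr fun n => ?_
  rw [tsum_fintype]
  rfl

theorem summable_sum_ofFn {α : Type*} [Fintype α] {f : List α → ℝ} (hf : Summable f) :
    Summable fun n : ℕ => ∑ s : Fin n → α, f (List.ofFn s) := by
  have := (List.equivSigmaTuple.symm.summable_iff.2 hf).sigma
  refine this.congr fun n => ?_
  rw [tsum_fintype]
  rfl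

theorem summable_ite_disp {w : List (Step d) → ℝ} (hw : Summable fun l => |w l|) (x : Fin d → ℤ) :
    Summable fun l => |if disp l = x then w l else 0| := by
  refine hw.of_nonneg_of_le (fun _ => abs_nonneg _) fun l => ?_
  split_ifs <;> simp

theorem lacePi_mul_pow (β z : ℝ) (m : ℕ) (x : Fin d → ℤ) : lacePi d β m x * z ^ m =
    ∑ s : Fin m → Step d, if disp (List.ofFn s) = x then
      z ^ (List.ofFn s).length * listJ β (List.ofFn s) else 0 := by
  rw [lacePi_eq_sum, sum_mul]
  refine sum_congr rfl fun s _ => ?_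
  rw [List.length_ofFn]
  split_ifs <;> ring

theorem summable_lacePi {β z : ℝ} (hw : Summable fun l : List (Step d) =>
    |z ^ l.length * listJ β l|) (x : Fin d → ℤ) : Summable fun m : ℕ => |lacePi d β m x * z ^ m| := by
  refine (summable_sum_ofFn (summable_ite_disp hw x)).of_nonneg_of_le (fun _ => abs_nonneg _)
    fun m => ?_
  rw [lacePi_mul_pow]
  exact abs_sum_le_sum_abs _ _

theorem PiZ_eq_listSum {β z : ℝ} (hw : Summable fun l : List (Step d) =>
    |z ^ l.length * listJ β l|) (x : Fin d → ℤ) :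
    PiZ d β z x = listSum (fun l => z ^ l.length * listJ β l) x := by
  rw [listSum, tsum_list_eq_of_summable (summable_ite_disp hw x).of_abs, PiZ]
  exact tsum_congr fun m => lacePi_mul_pow β z m x

theorem toReal_G_eq_listSum {β z : ℝ} (hβ : β ≤ 1) (hz : 0 ≤ z) (x : Fin d → ℤ) :
    (G d β z x).toReal = listSum (fun l => z ^ l.length * listK β l) x := by
  rw [G_eq_tsum_list, listSum, ENNReal.tsum_toReal_eq fun l => by split_ifs <;> simp]
  refine tsum_congr fun l => ?_
  split_ifs
  · exact ENNReal.toReal_ofReal (mul_nonneg (pow_nonneg hz _) (listK_nonneg hβ _))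
  · simp

theorem chi_eq_tsum_list (β z : ℝ) :
    chi d β z = ∑' l : List (Step d), ENNReal.ofReal (z ^ l.length * listK β l) := by
  rw [chi, tsum_eq_tsum_disp]
  exact tsum_congr fun x => G_eq_tsum_list z x

end WSAW

/-! ### The lace expansion identity and the sign of F̂(0) -/

namespace WSAW

open Finset MeasureTheory Filter Topology
open scoped ENNReal Real

variable {d : ℕ}

theorem tsum_cut_mul {α : Type*} {f g : List α → ℂ} (hf : Summable fun l => ‖f l‖)
    (hg : Summable fun l => ‖g l‖) :
    (Summable fun l : List α => ∑ i ∈ range (l.length + 1), f (l.take i) * g (l.drop i)) ∧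
      ∑' l : List α, ∑ i ∈ range (l.length + 1), f (l.take i) * g (l.drop i) =
        (∑' l, f l) * ∑' l, g l := by
  have h1 := summable_mul_of_summable_norm hf hg
  have h2 := (cutEquiv α).summable_iff.2 h1
  have h3 : ∀ l : List α, ∑' i : Fin (l.length + 1),
      ((fun x : List α × List α => f x.1 * g x.2) ∘ cutEquiv α) ⟨l, i⟩ =
      ∑ i ∈ range (l.length + 1), f (l.take i) * g (l.drop i) := by
    intro l
    rw [tsum_fintype, sum_range]
    rfl
  refine ⟨h2.sigma.congr h3, ?_⟩
  rw [tsum_mul_tsum_of_summable_norm hf hg, ← (cutEquiv α).tsum_eq]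
  change _ = ∑' c, ((fun x : List α × List α => f x.1 * g x.2) ∘ cutEquiv α) c
  rw [h2.tsum_sigma' fun n => Summable.of_finite]
  exact tsum_congr fun l => (h3 l).symm

/-- The weight of an irreducible piece of a walk: a single step, or a lace graph. -/
noncomputable def irr (β : ℝ) (l : List (Step d)) : ℝ :=
  (if l.length = 1 then 1 else 0) + listJ β l

/-- A renewal equation: a nonempty walk begins with an irreducible piece, either one free step or a
connected graph. The term with m = 0 vanishes because `irr` is zero on the empty walk. -/
theorem listK_eq_irr (β : ℝ) (l : List (Step d)) : listK β l = (if l = [] then 1 else 0) +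
    ∑ m ∈ range (l.length + 1), irr β (l.take m) * listK β (l.drop m) := by
  cases l with
  | nil => simp [irr, listJ_nil, listK_nil]
  | cons a l =>
    rw [if_neg (by simp), zero_add, listK_cons]
    simp only [irr, add_mul, sum_add_distrib]
    congr 1
    rw [sum_eq_single_of_mem 1 (by simp)]
    · simp
    · intro m hm hne
      rw [mem_range] at hm
      rw [if_neg, zero_mul]
      rw [List.length_take]
      simp only [List.length_cons] at hm ⊢
      omega

/-- The character `e^{ik·x}`. -/
noncomputable def chr (k : Fin d → ℝ) (x : Fin d → ℤ) : ℂ :=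
  Complex.exp (Complex.I * ((∑ j, k j * (x j : ℝ) : ℝ) : ℂ))

theorem chr_add (k : Fin d → ℝ) (x y : Fin d → ℤ) : chr k (x + y) = chr k x * chr k y := by
  rw [chr, chr, chr, ← Complex.exp_add, ← mul_add, ← Complex.ofReal_add, ← sum_add_distrib]
  have : ∀ j, k j * ((x + y) j : ℝ) = k j * (x j : ℝ) + k j * (y j : ℝ) := by
    intro j
    rw [Pi.add_apply]
    push_cast
    ring
  simp_rw [this]

@[simp] theorem norm_chr (k : Fin d → ℝ) (x : Fin d → ℤ) : ‖chr k x‖ = 1 := by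
  rw [chr, mul_comm, Complex.norm_exp_ofReal_mul_I]

@[simp] theorem chr_zero_left (x : Fin d → ℤ) : chr 0 x = 1 := by simp [chr]

@[simp] theorem chr_zero_right (k : Fin d → ℝ) : chr k 0 = 1 := by simp [chr]

theorem finite_length_eq_one : {l : List (Step d) | l.length = 1}.Finite :=
  List.finite_length_eq _ 1

theorem summable_irr {β z : ℝ} (hJ : Summable fun l : List (Step d) => |z ^ l.length * listJ β l|) :
    Summable fun l : List (Step d) => |z ^ l.length * irr β l| := by
  have h1 : Summable fun l : List (Step d) => |z ^ l.length * (if l.length = 1 then 1 else 0)| := by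
    refine summable_of_hasFiniteSupport (finite_length_eq_one.subset fun l hl => ?_)
    by_contra h
    exact hl (by simp [show ¬ l.length = 1 from h])
  refine (h1.add hJ).of_nonneg_of_le (fun _ => abs_nonneg _) fun l => ?_
  rw [irr, mul_add]
  exact abs_add_le _ _

theorem summable_nil (z : ℝ) :
    Summable fun l : List (Step d) => |z ^ l.length * (if l = [] then 1 else 0)| := by
  refine summable_of_hasFiniteSupport ((Set.finite_singleton []).subset fun l hl => ?_)
  by_contra h
  exact hl (by simp [show ¬ l = [] from h])

/-- The weight on lists that corresponds to `F_z`. -/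
noncomputable def listF (β : ℝ) (l : List (Step d)) : ℝ := (if l = [] then 1 else 0) - irr β l

theorem summable_listF {β z : ℝ}
    (hJ : Summable fun l : List (Step d) => |z ^ l.length * listJ β l|) :
    Summable fun l : List (Step d) => |z ^ l.length * listF β l| := by
  refine ((summable_nil z).add (summable_irr hJ)).of_nonneg_of_le (fun _ => abs_nonneg _) fun l => ?_
  rw [listF, mul_sub]
  exact abs_sub _ _

theorem listSum_add {w v : List (Step d) → ℝ} (hw : Summable fun l => |w l|)
    (hv : Summable fun l => |v l|) (x : Fin d → ℤ) :
    listSum (fun l => w l + v l) x = listSum w x + listSum v x := by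
  rw [listSum, listSum, listSum,
    ← (summable_ite_disp hw x).of_abs.tsum_add (summable_ite_disp hv x).of_abs]
  exact tsum_congr fun l => by split_ifs <;> simp

theorem listSum_nil (z : ℝ) (x : Fin d → ℤ) :
    listSum (fun l => z ^ l.length * (if l = [] then 1 else 0)) x = delta d x := by
  rw [listSum, tsum_eq_single [] fun l hl => by simp [hl], delta]
  by_cases h : x = 0
  · simp [h]
  · simp [h, Ne.symm h]

theorem listSum_step (z : ℝ) (x : Fin d → ℤ) :
    listSum (fun l : List (Step d) => z ^ l.length * (if l.length = 1 then 1 else 0)) x =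
      z * (2 * d) * D d x := by
  classical
  set ι : Step d ↪ List (Step d) := ⟨fun s => [s], fun _ _ h => by simpa using h⟩
  rw [listSum, tsum_eq_sum (s := univ.map ι)]
  · rw [sum_map]
    have h1 : ∀ s : Step d, (if disp (ι s) = x then
        z ^ (ι s).length * (if (ι s).length = 1 then 1 else 0) else 0 : ℝ) =
        if stepVec s = x then z else 0 := by
      intro s
      have : ι s = [s] := rfl
      simp [this]
    simp_rw [h1, D]
    by_cases hx : ∑ j, |x j| = 1
    · obtain ⟨s, rfl⟩ := exists_stepVec_eq hx
      rw [if_pos hx, sum_eq_single_of_mem s (mem_univ _)]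
      · have : (d : ℝ) ≠ 0 := by
          have := s.1.pos
          positivity
        rw [if_pos rfl]
        field_simp
      · intro s' _ hs'
        exact if_neg fun h => hs' (stepVec_injective h)
    · rw [if_neg hx, mul_zero]
      refine sum_eq_zero fun s _ => if_neg ?_
      rintro rfl
      exact hx (sum_abs_stepVec s)
  · intro l hl
    have : ¬ l.length = 1 := by
      intro h
      obtain ⟨s, rfl⟩ := List.length_eq_one_iff.1 h
      exact hl (mem_map_of_mem ι (mem_univ s))
    simp [this]

theorem listSum_neg (w : List (Step d) → ℝ) (x : Fin d → ℤ) :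
    listSum (fun l => -w l) x = -listSum w x := by
  rw [listSum, listSum, ← tsum_neg]
  exact tsum_congr fun l => by split_ifs <;> simp

theorem F_eq_listSum {β z : ℝ}
    (hJ : Summable fun l : List (Step d) => |z ^ l.length * listJ β l|) (x : Fin d → ℤ) :
    F d β z x = listSum (fun l => z ^ l.length * listF β l) x := by
  have h1 : Summable fun l : List (Step d) => |z ^ l.length * (if l.length = 1 then 1 else 0)| := by
    refine summable_of_hasFiniteSupport (finite_length_eq_one.subset fun l hl => ?_)
    by_contra h
    exact hl (by simp [show ¬ l.length = 1 from h])
  have h2 : (fun l : List (Step d) => z ^ l.length * listF β l) = fun l =>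
      z ^ l.length * (if l = [] then 1 else 0) +
        (-(z ^ l.length * (if l.length = 1 then 1 else 0)) + -(z ^ l.length * listJ β l)) := by
    funext l
    rw [listF, irr]
    ring
  rw [h2, listSum_add (summable_nil z), listSum_add, listSum_neg, listSum_neg, listSum_nil,
    listSum_step, ← PiZ_eq_listSum hJ, F]
  · ring
  · simpa using h1
  · simpa using hJ
  · refine (h1.add hJ).of_nonneg_of_le (fun _ => abs_nonneg _) fun l => ?_
    refine (abs_add_le _ _).trans ?_
    rw [abs_neg, abs_neg]

theorem fourier_F_eq {β z : ℝ} (hJ : Summable fun l : List (Step d) => |z ^ l.length * listJ β l|)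
    (k : Fin d → ℝ) :
    fourier (F d β z) k = ∑' l : List (Step d), ((z ^ l.length * listF β l : ℝ) : ℂ) * chr k (disp l) := by
  rw [← tsum_listSum_mul, fourier]
  · exact tsum_congr fun x => by rw [F_eq_listSum hJ]; rfl
  · simpa using summable_listF hJ

theorem tsum_F_eq {β z : ℝ} (hJ : Summable fun l : List (Step d) => |z ^ l.length * listJ β l|) :
    ∑' x, F d β z x = ∑' l : List (Step d), z ^ l.length * listF β l := by
  have h := fourier_F_eq hJ 0
  rw [fourier] at h
  apply Complex.ofReal_injective
  rw [Complex.ofReal_tsum, Complex.ofReal_tsum]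
  simpa using h

theorem summable_listK {β z : ℝ} (hβ : β ≤ 1) (hz : 0 ≤ z) (hχ : chi d β z < ∞) :
    Summable fun l : List (Step d) => |z ^ l.length * listK β l| := by
  rw [chi_eq_tsum_list] at hχ
  have h1 : ∀ l : List (Step d), 0 ≤ z ^ l.length * listK β l :=
    fun l => mul_nonneg (pow_nonneg hz _) (listK_nonneg hβ _)
  refine (ENNReal.summable_toReal hχ.ne).congr fun l => ?_
  rw [ENNReal.toReal_ofReal (h1 l), abs_of_nonneg (h1 l)]

/-- The lace expansion, in terms of generating functions. -/
theorem lace_expansion {β z : ℝ}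
    (hK : Summable fun l : List (Step d) => |z ^ l.length * listK β l|)
    (hJ : Summable fun l : List (Step d) => |z ^ l.length * listJ β l|) (k : Fin d → ℝ) :
    (∑' l : List (Step d), ((z ^ l.length * listK β l : ℝ) : ℂ) * chr k (disp l)) *
      ∑' l : List (Step d), ((z ^ l.length * listF β l : ℝ) : ℂ) * chr k (disp l) = 1 := by
  set f : List (Step d) → ℂ := fun l => ((z ^ l.length * irr β l : ℝ) : ℂ) * chr k (disp l) with hf
  set g : List (Step d) → ℂ := fun l => ((z ^ l.length * listK β l : ℝ) : ℂ) * chr k (disp l) with hg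
  set o : List (Step d) → ℂ :=
    fun l => ((z ^ l.length * (if l = [] then 1 else 0) : ℝ) : ℂ) * chr k (disp l) with ho
  have hfs : Summable fun l => ‖f l‖ := by simpa [hf] using summable_irr hJ
  have hgs : Summable fun l => ‖g l‖ := by simpa [hg] using hK
  have hos : Summable fun l => ‖o l‖ := by
    simp only [ho, norm_mul, norm_chr, mul_one, Complex.norm_real, Real.norm_eq_abs]
    simpa only [abs_mul] using summable_nil z
  have ho1 : ∑' l, o l = 1 := by
    rw [tsum_eq_single [] fun l hl => by simp [ho, hl]]
    simp [ho]
  obtain ⟨hc, hcut⟩ := tsum_cut_mul hfs hgs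
  have h1 : ∀ l, g l = o l + ∑ i ∈ range (l.length + 1), f (l.take i) * g (l.drop i) := by
    intro l
    have h2 : ∀ i ∈ range (l.length + 1), f (l.take i) * g (l.drop i) =
        (z ^ l.length : ℝ) * chr k (disp l) *
          ((irr β (l.take i) * listK β (l.drop i) : ℝ) : ℂ) := by
      intro i hi
      rw [mem_range] at hi
      have h3 : l.length = (l.take i).length + (l.drop i).length := by simp; omega
      simp only [hf, hg]
      rw [← disp_take_add_drop l i, chr_add, h3, pow_add]
      push_cast
      ring
    rw [sum_congr rfl h2, ← mul_sum, ← Complex.ofReal_sum]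
    simp only [hg, ho]
    rw [listK_eq_irr]
    push_cast
    ring
  -- Characters are multiplicative under concatenation, so the renewal equation becomes algebraic
  -- after summation.
  have h4 : ∑' l, g l = 1 + (∑' l, f l) * ∑' l, g l := by
    conv_lhs => rw [tsum_congr h1]
    rw [hos.of_norm.tsum_add hc, hcut, ho1]
  have h5 : ∑' l : List (Step d), ((z ^ l.length * listF β l : ℝ) : ℂ) * chr k (disp l) =
      1 - ∑' l, f l := by
    rw [← ho1, ← hos.of_norm.tsum_sub hfs.of_norm]
    refine tsum_congr fun l => ?_
    simp only [ho, hf, listF]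
    push_cast
    ring
  rw [h5]
  linear_combination h4

theorem fourier_G_mul_fourier_F {β z : ℝ} (hβ : β ≤ 1) (hz : 0 ≤ z) (hχ : chi d β z < ∞)
    (hJ : Summable fun l : List (Step d) => |z ^ l.length * listJ β l|) (k : Fin d → ℝ) :
    fourier (fun x => (G d β z x).toReal) k * fourier (F d β z) k = 1 := by
  have hK := summable_listK hβ hz hχ
  rw [fourier_F_eq hJ, ← lace_expansion hK hJ k,
    ← tsum_listSum_mul (w := fun l => z ^ l.length * listK β l), fourier]
  · congr 1
    exact tsum_congr fun x => by rw [toReal_G_eq_listSum hβ hz]; rfl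
  · simpa using hK

/-- The two branches in the definition of Ĝ agree by the lace expansion, so from here on only 1/F̂
matters. -/
theorem Ghat_eq {β z : ℝ} (hβ : β ≤ 1) (hz : 0 ≤ z)
    (hJ : Summable fun l : List (Step d) => |z ^ l.length * listJ β l|) (k : Fin d → ℝ) :
    Ghat d β z k = (fourier (F d β z) k)⁻¹ := by
  rw [Ghat]
  split_ifs with h
  · exact eq_inv_of_mul_eq_one_left (fourier_G_mul_fourier_F hβ hz h hJ k)
  · rw [one_div]

theorem listJ_zero (l : List (Step d)) : listJ 0 l = 0 := by
  classical
  refine sum_eq_zero fun Γ hΓ => ?_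
  obtain ⟨e, he, -⟩ := (mem_filter.1 hΓ).2.1
  exact prod_eq_zero he (by simp [edgeWeight])

theorem F_zero_eq_A (z : ℝ) : F d 0 z = A d z := by
  funext x
  have : PiZ d 0 z x = 0 := by
    rw [PiZ]
    refine (tsum_congr fun m => ?_).trans tsum_zero
    rw [lacePi_mul_pow]
    simp [listJ_zero]
  rw [F, A, this, sub_zero]

/-- Simple random walk is the case β = 0, where the lace sum vanishes. -/
theorem Chat_eq {μ : ℝ} (hμ : 0 ≤ μ) (k : Fin d → ℝ) : Chat d μ k = (fourier (A d μ) k)⁻¹ := by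
  have hJ : Summable fun l : List (Step d) => |μ ^ l.length * listJ 0 l| := by
    simp [listJ_zero, summable_zero]
  rw [← F_zero_eq_A, ← Ghat_eq zero_le_one hμ hJ, Chat, Ghat, chi, F_zero_eq_A]
  simp_rw [C_eq_G]

theorem fhat_eq {β z : ℝ} (hβ : β ≤ 1) (hz : 0 ≤ z) (hμ : 0 ≤ mu d β z)
    (hJ : Summable fun l : List (Step d) => |z ^ l.length * listJ β l|) (k : Fin d → ℝ) :
    fhat d β z k =
      (fourier (A d (mu d β z)) k)⁻¹ * fourier (E d β z) k * (fourier (F d β z) k)⁻¹ := by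
  rw [fhat, Chat_eq hμ, Ghat_eq hβ hz hJ]

theorem summable_listJ_of_le {β z z' : ℝ} (hz' : 0 ≤ z') (h : z' ≤ z)
    (hJ : Summable fun l : List (Step d) => |z ^ l.length * listJ β l|) :
    Summable fun l : List (Step d) => |z' ^ l.length * listJ β l| := by
  refine hJ.of_nonneg_of_le (fun _ => abs_nonneg _) fun l => ?_
  rw [abs_mul, abs_mul, abs_of_nonneg (pow_nonneg hz' _),
    abs_of_nonneg (pow_nonneg (hz'.trans h) _)]
  gcongr

theorem chi_lt_top_of_lt_zc {β z : ℝ} (hβ : β ≤ 1) (hz : 0 ≤ z) (h : z < zc d β) :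
    chi d β z < ∞ := by
  have hne : {z : ℝ | 0 ≤ z ∧ chi d β z < ∞}.Nonempty := by
    by_contra hne
    rw [Set.not_nonempty_iff_eq_empty] at hne
    rw [zc, hne, Real.sSup_empty] at h
    linarith
  obtain ⟨z', ⟨hz'0, hz'⟩, hlt⟩ := exists_lt_of_lt_csSup hne h
  refine lt_of_le_of_lt ?_ hz'
  rw [chi_eq_tsum_list, chi_eq_tsum_list]
  refine ENNReal.tsum_le_tsum fun l => ENNReal.ofReal_le_ofReal ?_
  have := listK_nonneg hβ l
  gcongr

/-- At k = 0 the expansion says that the susceptibility, which is nonnegative, times F̂(0) equals 1.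
-/
theorem tsum_F_pos_of_lt_zc {β z : ℝ} (hβ : β ≤ 1) (hz : 0 ≤ z) (h : z < zc d β)
    (hJ : Summable fun l : List (Step d) => |z ^ l.length * listJ β l|) :
    0 < ∑' x, F d β z x := by
  have h1 := lace_expansion (summable_listK hβ hz (chi_lt_top_of_lt_zc hβ hz h)) hJ 0
  simp only [chr_zero_left, mul_one] at h1
  rw [← Complex.ofReal_tsum, ← Complex.ofReal_tsum, ← tsum_F_eq hJ, ← Complex.ofReal_mul,
    Complex.ofReal_eq_one] at h1
  have h2 : 0 ≤ ∑' l : List (Step d), z ^ l.length * listK β l :=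
    tsum_nonneg fun l => mul_nonneg (pow_nonneg hz _) (listK_nonneg hβ _)
  by_contra hneg
  have := mul_nonpos_of_nonneg_of_nonpos h2 (not_lt.1 hneg)
  linarith

/-- `F̂_z(0) ≥ 0` up to and including the critical point. -/
theorem tsum_F_nonneg {β z : ℝ} (hβ : β ≤ 1) (hz : 0 < z) (h : z ≤ zc d β)
    (hJ : Summable fun l : List (Step d) => |z ^ l.length * listJ β l|) :
    0 ≤ ∑' x, F d β z x := by
  rw [tsum_F_eq hJ]
  -- At the critical point the identity may be unavailable, but the series for F̂(0) converges
  -- absolutely at z, so it is left continuous there.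
  have hlim : Tendsto (fun z' : ℝ => ∑' l : List (Step d), z' ^ l.length * listF β l) (𝓝[<] z)
      (𝓝 (∑' l : List (Step d), z ^ l.length * listF β l)) := by
    refine tendsto_tsum_of_dominated_convergence (summable_listF hJ) (fun l => ?_) ?_
    · have : Continuous fun z' : ℝ => z' ^ l.length * listF β l := by fun_prop
      exact (this.tendsto z).mono_left nhdsWithin_le_nhds
    · filter_upwards [Ioo_mem_nhdsLT hz] with z' hz' l
      rw [Real.norm_eq_abs, abs_mul, abs_mul, abs_of_nonneg (pow_nonneg hz'.1.le _),
        abs_of_nonneg (pow_nonneg hz.le _)]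
      have := hz'.1.le
      have := hz'.2.le
      gcongr
  refine ge_of_tendsto hlim ?_
  filter_upwards [Ioo_mem_nhdsLT hz] with z' hz'
  have hJ' := summable_listJ_of_le hz'.1.le hz'.2.le hJ
  rw [← tsum_F_eq hJ']
  exact (tsum_F_pos_of_lt_zc hβ hz'.1.le (hz'.2.trans_le h) hJ').le

end WSAW

/-! ### Fourier series with moments, and symbol estimates at the origin -/

namespace WSAW

open Finset MeasureTheory Filter Topology
open scoped ENNReal Real

variable {d : ℕ}

/-- The Fourier series of a complex function on `ℤ^d`. -/
noncomputable def fc (f : (Fin d → ℤ) → ℂ) (k : Fin d → ℝ) : ℂ := ∑' x, f x * chr k x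

theorem fourier_eq_fc (f : (Fin d → ℤ) → ℝ) : fourier f = fc fun x => (f x : ℂ) := rfl

/-- The function whose Fourier series is the `i`th partial derivative of that of `f`. -/
noncomputable def mulI (i : Fin d) (f : (Fin d → ℤ) → ℂ) (x : Fin d → ℤ) : ℂ :=
  Complex.I * (x i : ℤ) * f x

/-- Absolute summability of the moments of order at most `n`. -/
def Mom (n : ℕ) (f : (Fin d → ℤ) → ℂ) : Prop := Summable fun x => (1 + ‖x‖) ^ n * ‖f x‖

/-- The absolute moment of order `n`. -/
noncomputable def moment (n : ℕ) (f : (Fin d → ℤ) → ℂ) : ℝ := ∑' x, (1 + ‖x‖) ^ n * ‖f x‖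

theorem Mom.mono {m n : ℕ} (h : m ≤ n) {f : (Fin d → ℤ) → ℂ} (hf : Mom n f) : Mom m f := by
  refine Summable.of_nonneg_of_le (fun x => by positivity) (fun x => ?_) hf
  have := norm_nonneg x
  gcongr
  linarith

theorem moment_mono {m n : ℕ} (h : m ≤ n) {f : (Fin d → ℤ) → ℂ} (hf : Mom n f) :
    moment m f ≤ moment n f := by
  refine (hf.mono h).tsum_le_tsum (fun x => ?_) hf
  have := norm_nonneg x
  gcongr
  linarith

theorem moment_nonneg (n : ℕ) (f : (Fin d → ℤ) → ℂ) : 0 ≤ moment n f :=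
  tsum_nonneg fun x => by positivity

theorem norm_mulI_le (n : ℕ) (i : Fin d) (f : (Fin d → ℤ) → ℂ) (x : Fin d → ℤ) :
    (1 + ‖x‖) ^ n * ‖mulI i f x‖ ≤ (1 + ‖x‖) ^ (n + 1) * ‖f x‖ := by
  have h1 := norm_le_pi_norm x i
  have h2 : ‖mulI i f x‖ = ‖x i‖ * ‖f x‖ := by
    rw [mulI, norm_mul, norm_mul, Complex.norm_I, one_mul, Complex.norm_intCast, Int.norm_eq_abs]
  rw [h2, pow_succ, mul_assoc]
  gcongr
  linarith

theorem Mom.mulI {n : ℕ} {f : (Fin d → ℤ) → ℂ} (hf : Mom (n + 1) f) (i : Fin d) :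
    Mom n (mulI i f) :=
  Summable.of_nonneg_of_le (fun x => by positivity) (fun x => norm_mulI_le n i f x) hf

theorem moment_mulI_le {n : ℕ} {f : (Fin d → ℤ) → ℂ} (hf : Mom (n + 1) f) (i : Fin d) :
    moment n (mulI i f) ≤ moment (n + 1) f :=
  (hf.mulI i).tsum_le_tsum (fun x => norm_mulI_le n i f x) hf

theorem Mom.summable {n : ℕ} {f : (Fin d → ℤ) → ℂ} (hf : Mom n f) (k : Fin d → ℝ) :
    Summable fun x => f x * chr k x := by
  refine Summable.of_norm_bounded (hf.mono (Nat.zero_le n)) fun x => ?_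
  simp

theorem norm_fc_le {n : ℕ} {f : (Fin d → ℤ) → ℂ} (hf : Mom n f) (k : Fin d → ℝ) :
    ‖fc f k‖ ≤ moment n f := by
  refine le_trans ?_ (moment_mono (Nat.zero_le n) hf)
  refine tsum_of_norm_bounded (hf.mono (Nat.zero_le n)).hasSum fun x => ?_
  simp

/-- The derivative of a function with partial derivatives `a`. -/
noncomputable def ofPartials (a : Fin d → ℂ) : (Fin d → ℝ) →L[ℝ] ℂ :=
  ∑ i, (ContinuousLinearMap.proj i : (Fin d → ℝ) →L[ℝ] ℝ).smulRight (a i)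

theorem ofPartials_apply (a : Fin d → ℂ) (v : Fin d → ℝ) : ofPartials a v = ∑ i, v i * a i := by
  simp [ofPartials]

theorem norm_ofPartials_le {a : Fin d → ℂ} {M : ℝ} (hM : 0 ≤ M) (ha : ∀ i, ‖a i‖ ≤ M) :
    ‖ofPartials a‖ ≤ d * M := by
  refine ContinuousLinearMap.opNorm_le_bound _ (by positivity) fun v => ?_
  rw [ofPartials_apply]
  refine (norm_sum_le _ _).trans ((sum_le_card_nsmul _ _ (‖v‖ * M) fun i _ => ?_).trans_eq ?_)
  · rw [norm_mul, Complex.norm_real]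
    exact mul_le_mul (norm_le_pi_norm v i) (ha i) (norm_nonneg _) (norm_nonneg _)
  · simp
    ring

/-- `ofPartials` as a continuous linear map. -/
noncomputable def ofPartialsL (d : ℕ) : (Fin d → ℂ) →L[ℝ] (Fin d → ℝ) →L[ℝ] ℂ :=
  LinearMap.toContinuousLinearMap
    { toFun := ofPartials
      map_add' := fun a b => by
        ext v; simp [ofPartials_apply, mul_add, sum_add_distrib]
      map_smul' := fun c a => by
        ext v; simp [ofPartials_apply, mul_sum, mul_left_comm] }

theorem hasFDerivAt_chr (c : ℂ) (x : Fin d → ℤ) (k : Fin d → ℝ) :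
    HasFDerivAt (fun k => c * chr k x)
      (ofPartials fun i => Complex.I * (x i : ℤ) * c * chr k x) k := by
  have h1 : HasFDerivAt (fun k : Fin d → ℝ => Complex.I * ((∑ j, k j * (x j : ℝ) : ℝ) : ℂ))
      (ofPartials fun i => Complex.I * (x i : ℤ)) k := by
    have h2 : (fun k : Fin d → ℝ => Complex.I * ((∑ j, k j * (x j : ℝ) : ℝ) : ℂ)) =
        ofPartials fun i => Complex.I * (x i : ℤ) := by
      funext v
      rw [ofPartials_apply]
      push_cast
      rw [mul_sum]
      exact sum_congr rfl fun i _ => by ring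
    rw [h2]
    exact ContinuousLinearMap.hasFDerivAt _
  refine (h1.cexp.const_mul c).congr_fderiv ?_
  ext v
  simp only [_root_.smul_apply, ofPartials_apply, smul_eq_mul, chr, mul_sum]
  exact sum_congr rfl fun i _ => by ring

theorem hasFDerivAt_fc {f : (Fin d → ℤ) → ℂ} (hf : Mom 1 f) (k : Fin d → ℝ) :
    HasFDerivAt (fc f) (ofPartials fun i => fc (mulI i f) k) k := by
  have h1 := hasFDerivAt_tsum (𝕜 := ℝ) (f := fun x k => f x * chr k x)
    (f' := fun x k => ofPartials fun i => Complex.I * (x i : ℤ) * f x * chr k x)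
    (u := fun x => d * ((1 + ‖x‖) ^ 1 * ‖f x‖)) (hf.mul_left _)
    (fun x k => hasFDerivAt_chr (f x) x k) (fun x k => ?_) (hf.summable 0) k
  · refine h1.congr_fderiv ?_
    have h2 : HasSum (fun x => fun i => mulI i f x * chr k x) fun i => fc (mulI i f) k :=
      Pi.hasSum.2 fun i => ((hf.mulI (n := 0) i).summable k).hasSum
    exact (h2.mapL (ofPartialsL d)).tsum_eq
  · refine norm_ofPartials_le (by positivity) fun i => ?_
    have := norm_mulI_le 0 i f x
    rw [norm_mul, norm_chr, mul_one]
    simpa [mulI] using this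

theorem contDiff_fc {n : ℕ} {f : (Fin d → ℤ) → ℂ} (hf : Mom n f) : ContDiff ℝ n (fc f) := by
  induction n generalizing f with
  | zero =>
    rw [Nat.cast_zero, contDiff_zero]
    refine continuous_tsum (fun x => ?_) hf fun x k => ?_
    · unfold chr
      fun_prop
    · simp
  | succ n ih =>
    rw [Nat.cast_add, Nat.cast_one, contDiff_succ_iff_hasFDerivAt]
    refine ⟨fun k => ofPartialsL d fun i => fc (mulI i f) k, ?_,
      fun k => hasFDerivAt_fc (hf.mono (by omega)) k⟩
    exact (ofPartialsL d).contDiff.comp (contDiff_pi.2 fun i => ih (hf.mulI i))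

theorem partialD_eq_of_hasFDerivAt {g : (Fin d → ℝ) → ℂ} {g' : (Fin d → ℝ) →L[ℝ] ℂ}
    {k : Fin d → ℝ} (h : HasFDerivAt g g' k) (i : Fin d) :
    partialD i g k = g' (Pi.single i 1) := by
  rw [partialD, (h.hasLineDerivAt _).lineDeriv]

theorem partialD_fc {f : (Fin d → ℤ) → ℂ} (hf : Mom 1 f) (i : Fin d) :
    partialD i (fc f) = fc (mulI i f) := by
  funext k
  rw [partialD_eq_of_hasFDerivAt (hasFDerivAt_fc hf k), ofPartials_apply,
    sum_eq_single_of_mem i (mem_univ _)]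
  · simp
  · intro j _ hj
    simp [hj]

/-- The derivatives of order less than `p` of the Fourier series vanish at the origin. -/
def VanishTo (p : ℤ) (f : (Fin d → ℤ) → ℂ) : Prop :=
  ∀ L : List (Fin d), (L.length : ℤ) < p →
    ∑' x, (L.map fun i => Complex.I * (x i : ℤ)).prod * f x = 0

theorem VanishTo.mulI {p : ℤ} {f : (Fin d → ℤ) → ℂ} (h : VanishTo p f) (i : Fin d) :
    VanishTo (p - 1) (mulI i f) := by
  intro L hL
  rw [← h (i :: L) (by simp; omega)]
  refine tsum_congr fun x => ?_
  rw [List.map_cons, List.prod_cons, WSAW.mulI]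
  ring

/-- Taylor's theorem by induction: the partial derivatives are again Fourier series, vanishing to
one order less, and are integrated along the segment from 0 to k. Each order costs a factor d for
the sum over directions. -/
theorem norm_fc_le_pow {P : ℕ} {f : (Fin d → ℤ) → ℂ} (hf : Mom P f) (hv : VanishTo P f)
    (k : Fin d → ℝ) : ‖fc f k‖ ≤ d ^ P * ‖k‖ ^ P * moment P f := by
  induction P generalizing f k with
  | zero => simpa using norm_fc_le hf k
  | succ P ih =>
    have h0 : fc f 0 = 0 := by
      have := hv [] (by simp)
      simpa [fc] using this
    have hf1 : Mom 1 f := hf.mono (by omega)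
    have hM := moment_nonneg (P + 1) f
    have hd : ∀ t ∈ Set.Icc (0 : ℝ) 1, HasDerivWithinAt (fun t : ℝ => fc f (t • k))
        (∑ i, k i * fc (mulI i f) (t • k)) (Set.Icc 0 1) t := by
      intro t _
      have h1 : HasDerivAt (fun t : ℝ => t • k) k t := by
        simpa using (hasDerivAt_id t).smul_const k
      have := (hasFDerivAt_fc hf1 (t • k)).comp_hasDerivAt t h1
      rw [ofPartials_apply] at this
      exact this.hasDerivWithinAt
    have hb : ∀ t ∈ Set.Ico (0 : ℝ) 1, ‖∑ i, k i * fc (mulI i f) (t • k)‖ ≤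
        d * (‖k‖ * (d ^ P * ‖k‖ ^ P * moment (P + 1) f)) := by
      intro t ht
      refine (norm_sum_le _ _).trans ((sum_le_card_nsmul _ _
        (‖k‖ * (d ^ P * ‖k‖ ^ P * moment (P + 1) f)) fun i _ => ?_).trans_eq (by simp))
      rw [norm_mul, Complex.norm_real]
      have h2 : ‖t • k‖ ≤ ‖k‖ := by
        rw [norm_smul, Real.norm_of_nonneg ht.1]
        exact mul_le_of_le_one_left (norm_nonneg _) ht.2.le
      have h3 := hv.mulI i
      rw [show ((P + 1 : ℕ) : ℤ) - 1 = (P : ℤ) by push_cast; ring] at h3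
      have h4 := ih (hf.mulI i) h3 (t • k)
      have h5 := moment_mulI_le hf i
      have h6 := moment_nonneg P (mulI i f)
      refine mul_le_mul (norm_le_pi_norm k i) (h4.trans ?_) (norm_nonneg _) (norm_nonneg _)
      gcongr
    have := norm_image_sub_le_of_norm_deriv_le_segment_01' hd hb
    simp only [one_smul, zero_smul, h0, sub_zero] at this
    refine this.trans (le_of_eq ?_)
    ring

/-- Bounds of order `‖k‖^(p - j)` on the derivatives of order `j ≤ n`, near the origin. -/
def Sym : ℕ → ℤ → ℝ → ((Fin d → ℝ) → ℂ) → Prop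
  | 0, p, K, g => ∀ k ∈ box d, k ≠ 0 → ‖g k‖ ≤ K * ‖k‖ ^ p
  | n + 1, p, K, g => (∀ k ∈ box d, k ≠ 0 → ‖g k‖ ≤ K * ‖k‖ ^ p) ∧
      ∀ i, Sym n (p - 1) K (partialD i g)

theorem Sym.bound {n : ℕ} {p : ℤ} {K : ℝ} {g : (Fin d → ℝ) → ℂ} (h : Sym n p K g) :
    ∀ k ∈ box d, k ≠ 0 → ‖g k‖ ≤ K * ‖k‖ ^ p := by
  cases n with
  | zero => exact h
  | succ n => exact h.1

theorem Sym.mono_const {n : ℕ} {p : ℤ} {K K' : ℝ} (hK : K ≤ K') {g : (Fin d → ℝ) → ℂ}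
    (h : Sym n p K g) : Sym n p K' g := by
  induction n generalizing p g with
  | zero => exact fun k hk h0 => (h k hk h0).trans (by gcongr)
  | succ n ih => exact ⟨fun k hk h0 => (h.1 k hk h0).trans (by gcongr), fun i => ih (h.2 i)⟩

theorem Sym.of_succ {n : ℕ} {p : ℤ} {K : ℝ} {g : (Fin d → ℝ) → ℂ} (h : Sym (n + 1) p K g) :
    Sym n p K g := by
  induction n generalizing p g with
  | zero => exact h.1
  | succ n ih => exact ⟨h.1, fun i => ih (h.2 i)⟩

theorem norm_le_pi_of_mem_box {k : Fin d → ℝ} (hk : k ∈ box d) : ‖k‖ ≤ π := by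
  refine (pi_norm_le_iff_of_nonneg Real.pi_pos.le).2 fun i => abs_le.2 ⟨hk.1 i, hk.2 i⟩

/-- For p ≥ 0 this is the Taylor bound. For p < 0 boundedness suffices, since ‖k‖ ≤ π < 4 on the
box; the constant covers both d^p and 4^(-p). -/
theorem norm_fc_le_zpow {N n : ℕ} {p : ℤ} (hpn : p ≤ n) (hnN : n ≤ N) (hp : -(N : ℤ) ≤ p)
    {f : (Fin d → ℤ) → ℂ} (hf : Mom n f) (hv : VanishTo p f) :
    ∀ k ∈ box d, k ≠ 0 → ‖fc f k‖ ≤ (4 * (d + 1)) ^ N * moment n f * ‖k‖ ^ p := by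
  have hM := moment_nonneg n f
  intro k hk h0
  have hk0 : 0 < ‖k‖ := norm_pos_iff.2 h0
  have hd : (0 : ℝ) ≤ d := by positivity
  rcases le_or_gt 0 p with hp0 | hp0
  · lift p to ℕ using hp0
    have hpn' : p ≤ n := by exact_mod_cast hpn
    refine (norm_fc_le_pow (hf.mono hpn') hv k).trans ?_
    rw [zpow_natCast, mul_right_comm]
    have h1 : (d : ℝ) ^ p ≤ (4 * (d + 1)) ^ N := by
      calc (d : ℝ) ^ p ≤ (4 * (d + 1)) ^ p := by gcongr; linarith
        _ ≤ (4 * (d + 1)) ^ N := pow_le_pow_right₀ (by linarith) (by omega)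
    have h2 := moment_mono hpn' hf
    have h3 := moment_nonneg p f
    gcongr
  · obtain ⟨q, rfl⟩ : ∃ q : ℕ, p = -(q : ℤ) := ⟨p.natAbs, by omega⟩
    refine (norm_fc_le hf k).trans ?_
    have h1 : ‖k‖ ^ q ≤ (4 * (d + 1)) ^ N := by
      have h2 := norm_le_pi_of_mem_box hk
      have h3 := Real.pi_le_four
      calc ‖k‖ ^ q ≤ (4 * (d + 1)) ^ q := by gcongr; linarith
        _ ≤ (4 * (d + 1)) ^ N := pow_le_pow_right₀ (by linarith) (by omega)
    rw [zpow_neg, zpow_natCast, mul_right_comm, ← div_eq_mul_inv]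
    refine le_mul_of_one_le_left hM ?_
    rwa [one_le_div (by positivity)]

/-- Differentiation lowers the number of moments, the order of vanishing and the exponent together.
The exponent may become negative, which is why it is an integer. -/
theorem sym_fc {N n : ℕ} {p : ℤ} (hpn : p ≤ n) (hnN : n ≤ N) (hp : -(N : ℤ) ≤ p - n)
    {f : (Fin d → ℤ) → ℂ} (hf : Mom n f) (hv : VanishTo p f) :
    Sym n p ((4 * (d + 1)) ^ N * moment n f) (fc f) := by
  induction n generalizing p f with
  | zero => exact norm_fc_le_zpow hpn hnN (by push_cast at hp; omega) hf hv
  | succ n ih =>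
    refine ⟨norm_fc_le_zpow hpn hnN (by push_cast at hp; omega) hf hv, fun i => ?_⟩
    rw [partialD_fc (hf.mono (by omega))]
    have h1 := moment_mulI_le hf i
    exact (ih (by push_cast at hpn ⊢; omega) (by omega) (by push_cast at hp ⊢; omega) (hf.mulI i)
      (hv.mulI i)).mono_const (by gcongr)

end WSAW

/-! ### Calculus of symbol estimates away from the singular points -/

namespace WSAW

open Finset MeasureTheory Filter Topology
open scoped ENNReal Real

variable {d : ℕ}

theorem mem_zeroLattice_iff (k : Fin d → ℝ) : k ∈ zeroLattice d ↔ ∀ i, Real.sin (k i / 2) = 0 := by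
  refine forall_congr' fun i => ?_
  rw [Real.sin_eq_zero_iff]
  refine exists_congr fun m => ?_
  constructor <;> intro h <;> linarith

theorem isClosed_zeroLattice : IsClosed (zeroLattice d) := by
  have : zeroLattice d = ⋂ i, {k | Real.sin (k i / 2) = 0} := by
    ext k
    simp [mem_zeroLattice_iff]
  rw [this]
  exact isClosed_iInter fun i => isClosed_eq (by fun_prop) continuous_const

theorem isOpen_compl_zeroLattice : IsOpen (zeroLattice d)ᶜ := isClosed_zeroLattice.isOpen_compl

theorem countable_zeroLattice : (zeroLattice d).Countable := by
  refine (Set.countable_range fun (m : Fin d → ℤ) i => 2 * π * (m i : ℝ)).mono ?_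
  intro k hk
  choose m hm using hk
  exact ⟨m, funext fun i => (hm i).symm⟩

theorem notMem_zeroLattice {k : Fin d → ℝ} (hk : k ∈ box d) (h0 : k ≠ 0) : k ∉ zeroLattice d := by
  intro h
  refine h0 (funext fun i => ?_)
  obtain ⟨m, hm⟩ := h i
  have h1 := hk.1 i
  have h2 := hk.2 i
  have hpi := Real.pi_pos
  have h3 : m = 0 := by
    have h4 : (m : ℝ) < 1 := by
      by_contra! h
      nlinarith
    have h5 : (-1 : ℝ) < m := by
      by_contra! h
      nlinarith
    have h6 : m < 1 := by exact_mod_cast h4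
    have h7 : -1 < m := by exact_mod_cast h5
    omega
  simp [hm, h3]

theorem partialD_eqOn {U : Set (Fin d → ℝ)} (hU : IsOpen U) {g h : (Fin d → ℝ) → ℂ}
    (hgh : Set.EqOn g h U) (i : Fin d) : Set.EqOn (partialD i g) (partialD i h) U := fun _ hk =>
  Filter.EventuallyEq.lineDeriv_eq (hgh.eventuallyEq_of_mem (hU.mem_nhds hk))

theorem partialD_eq_fderiv {g : (Fin d → ℝ) → ℂ} {k : Fin d → ℝ} (h : DifferentiableAt ℝ g k)
    (i : Fin d) : partialD i g k = fderiv ℝ g k (Pi.single i 1) :=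
  partialD_eq_of_hasFDerivAt h.hasFDerivAt i

theorem ContDiffOn.partialD {U : Set (Fin d → ℝ)} (hU : IsOpen U) {n : ℕ} {g : (Fin d → ℝ) → ℂ}
    (hg : ContDiffOn ℝ ((n + 1 : ℕ) : WithTop ℕ∞) g U) (i : Fin d) :
    ContDiffOn ℝ n (partialD i g) U := by
  rw [Nat.cast_add, Nat.cast_one, contDiffOn_succ_iff_fderiv_of_isOpen hU] at hg
  have h1 : ContDiffOn ℝ n (fun k => fderiv ℝ g k (Pi.single i 1)) U :=
    hg.2.2.clm_apply contDiffOn_const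
  exact h1.congr fun k hk => partialD_eq_fderiv (hg.1.differentiableAt (hU.mem_nhds hk)) i

theorem partialD_mul {g h : (Fin d → ℝ) → ℂ} {k : Fin d → ℝ} (hg : DifferentiableAt ℝ g k)
    (hh : DifferentiableAt ℝ h k) (i : Fin d) :
    partialD i (g * h) k = partialD i g k * h k + g k * partialD i h k := by
  rw [partialD_eq_of_hasFDerivAt (hg.hasFDerivAt.mul hh.hasFDerivAt), partialD_eq_fderiv hg,
    partialD_eq_fderiv hh]
  simp only [_root_.add_apply, _root_.smul_apply, smul_eq_mul]
  ring

theorem partialD_inv {g : (Fin d → ℝ) → ℂ} {k : Fin d → ℝ} (hg : DifferentiableAt ℝ g k)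
    (h0 : g k ≠ 0) (i : Fin d) :
    partialD i g⁻¹ k = -(partialD i g k * (g⁻¹ k * g⁻¹ k)) := by
  have h1 := (hasDerivAt_inv h0).comp_hasFDerivAt_of_eq k hg.hasFDerivAt rfl
  have h2 : HasFDerivAt g⁻¹ (-(g k ^ 2)⁻¹ • fderiv ℝ g k) k := h1
  rw [partialD_eq_of_hasFDerivAt h2, partialD_eq_fderiv hg]
  simp only [_root_.smul_apply, smul_eq_mul, Pi.inv_apply]
  field_simp

theorem Sym.congr {n : ℕ} {p : ℤ} {K : ℝ} {g h : (Fin d → ℝ) → ℂ}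
    (hgh : Set.EqOn g h (zeroLattice d)ᶜ) (hg : Sym n p K g) : Sym n p K h := by
  induction n generalizing p g h with
  | zero =>
    intro k hk h0
    rw [← hgh (notMem_zeroLattice hk h0)]
    exact hg k hk h0
  | succ n ih =>
    refine ⟨fun k hk h0 => ?_, fun i => ih (partialD_eqOn isOpen_compl_zeroLattice hgh i) (hg.2 i)⟩
    rw [← hgh (notMem_zeroLattice hk h0)]
    exact hg.1 k hk h0

theorem differentiableAt_of_contDiffOn {n : ℕ} {g : (Fin d → ℝ) → ℂ} {U : Set (Fin d → ℝ)}
    (hU : IsOpen U) (hg : ContDiffOn ℝ ((n + 1 : ℕ) : WithTop ℕ∞) g U) {k : Fin d → ℝ}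
    (hk : k ∈ U) : DifferentiableAt ℝ g k :=
  (hg.differentiableOn (by simp)).differentiableAt (hU.mem_nhds hk)

theorem Sym.add {n : ℕ} {p : ℤ} {K L : ℝ} {g h : (Fin d → ℝ) → ℂ}
    (hgc : ContDiffOn ℝ n g (zeroLattice d)ᶜ) (hhc : ContDiffOn ℝ n h (zeroLattice d)ᶜ)
    (hg : Sym n p K g) (hh : Sym n p L h) : Sym n p (K + L) (g + h) := by
  have hb : ∀ k ∈ box d, k ≠ 0 → ‖(g + h) k‖ ≤ (K + L) * ‖k‖ ^ p := fun k hk h0 =>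
    (norm_add_le _ _).trans (by
      rw [add_mul]
      exact add_le_add (hg.bound k hk h0) (hh.bound k hk h0))
  induction n generalizing p g h with
  | zero => exact hb
  | succ n ih =>
    refine ⟨hb, fun i => ?_⟩
    have e : Set.EqOn (partialD i g + partialD i h) (partialD i (g + h)) (zeroLattice d)ᶜ := by
      intro k hk
      have h1 := differentiableAt_of_contDiffOn isOpen_compl_zeroLattice hgc hk
      have h2 := differentiableAt_of_contDiffOn isOpen_compl_zeroLattice hhc hk
      rw [partialD_eq_of_hasFDerivAt (h1.hasFDerivAt.add h2.hasFDerivAt), Pi.add_apply,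
        partialD_eq_fderiv h1, partialD_eq_fderiv h2]
      rfl
    have hgi := hg.2 i
    have hhi := hh.2 i
    refine (ih (ContDiffOn.partialD isOpen_compl_zeroLattice hgc i)
      (ContDiffOn.partialD isOpen_compl_zeroLattice hhc i) hgi hhi fun k hk h0 => ?_).congr e
    exact (norm_add_le _ _).trans (by
      rw [add_mul]
      exact add_le_add (hgi.bound k hk h0) (hhi.bound k hk h0))

theorem Sym.neg {n : ℕ} {p : ℤ} {K : ℝ} {g : (Fin d → ℝ) → ℂ} (hg : Sym n p K g) :
    Sym n p K (-g) := by
  induction n generalizing p g with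
  | zero => simpa [Sym] using hg
  | succ n ih =>
    refine ⟨by simpa using hg.1, fun i => ?_⟩
    have e : partialD i (-g) = -partialD i g := by
      funext k
      simp only [partialD, lineDeriv, Pi.neg_apply]
      exact deriv.fun_neg
    rw [e]
    exact ih (hg.2 i)

/-- Leibniz' rule by induction on the number of derivatives; each derivative doubles the number of
terms. -/
theorem Sym.mul {n : ℕ} {p q : ℤ} {K L : ℝ} {g h : (Fin d → ℝ) → ℂ} (hK : 0 ≤ K) (hL : 0 ≤ L)
    (hgc : ContDiffOn ℝ n g (zeroLattice d)ᶜ) (hhc : ContDiffOn ℝ n h (zeroLattice d)ᶜ)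
    (hg : Sym n p K g) (hh : Sym n q L h) : Sym n (p + q) (2 ^ n * (K * L)) (g * h) := by
  induction n generalizing p q g h with
  | zero =>
    intro k hk h0
    rw [zpow_add₀ (norm_ne_zero_iff.2 h0), Pi.mul_apply, norm_mul, pow_zero, one_mul,
      mul_mul_mul_comm]
    exact mul_le_mul (hg k hk h0) (hh k hk h0) (norm_nonneg _) (by positivity)
  | succ n ih =>
    refine ⟨fun k hk h0 => ?_, fun i => ?_⟩
    · rw [zpow_add₀ (norm_ne_zero_iff.2 h0), Pi.mul_apply, norm_mul]
      have h1 : (1 : ℝ) ≤ 2 ^ (n + 1) := one_le_pow₀ (by norm_num)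
      calc ‖g k‖ * ‖h k‖ ≤ (K * ‖k‖ ^ p) * (L * ‖k‖ ^ q) :=
            mul_le_mul (hg.1 k hk h0) (hh.1 k hk h0) (norm_nonneg _) (by positivity)
        _ = 1 * (K * L) * (‖k‖ ^ p * ‖k‖ ^ q) := by ring
        _ ≤ _ := by gcongr
    · have hgp := ContDiffOn.partialD isOpen_compl_zeroLattice hgc i
      have hhp := ContDiffOn.partialD isOpen_compl_zeroLattice hhc i
      have hg1 : ContDiffOn ℝ n g (zeroLattice d)ᶜ := hgc.of_le (by norm_cast; omega)
      have hh1 : ContDiffOn ℝ n h (zeroLattice d)ᶜ := hhc.of_le (by norm_cast; omega)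
      have e : Set.EqOn (partialD i g * h + g * partialD i h) (partialD i (g * h))
          (zeroLattice d)ᶜ := fun k hk =>
        (partialD_mul (differentiableAt_of_contDiffOn isOpen_compl_zeroLattice hgc hk)
          (differentiableAt_of_contDiffOn isOpen_compl_zeroLattice hhc hk) i).symm
      have h1 := ih hgp hh1 (hg.2 i) hh.of_succ
      have h2 := ih hg1 hhp hg.of_succ (hh.2 i)
      rw [show p - 1 + q = p + q - 1 by ring] at h1
      rw [show p + (q - 1) = p + q - 1 by ring] at h2
      rw [show (2 : ℝ) ^ (n + 1) * (K * L) = 2 ^ n * (K * L) + 2 ^ n * (K * L) by ring]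
      exact (Sym.add (hgp.mul hh1) (hg1.mul hhp) h1 h2).congr e

/-- Since ∂(1/f) = -∂f·(1/f)², the next derivative has exponent 1 - 2 - 2 = -2 - 1 by the product
rule and the previous order. Only the derivatives of f are assumed to be of symbol type, because
f(0) need not vanish. The constant is chosen before f, which gives uniformity in β and z. -/
theorem Sym.inv (d n : ℕ) {c K : ℝ} (hc : 0 < c) (hK : 0 ≤ K) : ∃ K' : ℝ, 0 ≤ K' ∧
    ∀ f : (Fin d → ℝ) → ℂ, ContDiffOn ℝ n f (zeroLattice d)ᶜ → (∀ k ∉ zeroLattice d, f k ≠ 0) →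
      (∀ k ∈ box d, k ≠ 0 → c * ‖k‖ ^ 2 ≤ ‖f k‖) → (∀ i, Sym (n - 1) 1 K (partialD i f)) →
      Sym n (-2) K' f⁻¹ := by
  have hb : ∀ K' : ℝ, c⁻¹ ≤ K' → ∀ f : (Fin d → ℝ) → ℂ,
      (∀ k ∈ box d, k ≠ 0 → c * ‖k‖ ^ 2 ≤ ‖f k‖) →
      ∀ k ∈ box d, k ≠ 0 → ‖f⁻¹ k‖ ≤ K' * ‖k‖ ^ (-2 : ℤ) := by
    intro K' hK' f hf k hk h0
    have h1 : 0 < ‖k‖ := norm_pos_iff.2 h0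
    have h2 := hf k hk h0
    rw [Pi.inv_apply, norm_inv]
    calc ‖f k‖⁻¹ ≤ (c * ‖k‖ ^ 2)⁻¹ := inv_anti₀ (by positivity) h2
      _ = c⁻¹ * ‖k‖ ^ (-2 : ℤ) := by rw [mul_inv, zpow_neg]; norm_cast
      _ ≤ _ := by gcongr
  induction n with
  | zero => exact ⟨c⁻¹, by positivity, fun f _ _ hf _ => hb _ le_rfl f hf⟩
  | succ n ih =>
    obtain ⟨K', hK', hind⟩ := ih
    set M := 2 ^ n * (K * (2 ^ n * (K' * K')))
    have hM : 0 ≤ M := by positivity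
    refine ⟨c⁻¹ + M, by positivity, fun f hfc hf0 hf hs => ⟨hb _ (by linarith) f hf, fun i => ?_⟩⟩
    have hf1 : ContDiffOn ℝ n f (zeroLattice d)ᶜ := hfc.of_le (by norm_cast; omega)
    have hs1 : ∀ i, Sym (n - 1) 1 K (partialD i f) := fun i => by
      cases n with
      | zero => exact hs i
      | succ n => exact Sym.of_succ (hs i)
    have h1 := hind f hf1 hf0 hf hs1
    have hfi : ContDiffOn ℝ n f⁻¹ (zeroLattice d)ᶜ := hf1.inv hf0
    have h2 := Sym.mul hK' hK' hfi hfi h1 h1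
    have h3 := Sym.mul hK (by positivity) (ContDiffOn.partialD isOpen_compl_zeroLattice hfc i)
      (hfi.mul hfi) (hs i) h2
    have h4 := (h3.neg.mono_const (show _ ≤ c⁻¹ + M by linarith [inv_pos.2 hc]))
    refine h4.congr fun k hk => ?_
    rw [partialD_inv (differentiableAt_of_contDiffOn isOpen_compl_zeroLattice hfc hk) (hf0 k hk)]
    rfl

/-- Iterated partial derivatives along a list of directions. -/
noncomputable def dlist (L : List (Fin d)) (g : (Fin d → ℝ) → ℂ) : (Fin d → ℝ) → ℂ :=
  L.foldr partialD g

theorem dlist_cons (i : Fin d) (L : List (Fin d)) (g : (Fin d → ℝ) → ℂ) :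
    dlist (i :: L) g = partialD i (dlist L g) := rfl

theorem dlist_append (L M : List (Fin d)) (g : (Fin d → ℝ) → ℂ) :
    dlist (L ++ M) g = dlist L (dlist M g) := List.foldr_append

/-- The list of directions of a multi-index. -/
def multiList (α : Fin d → ℕ) : List (Fin d) :=
  (List.finRange d).flatMap fun i => List.replicate (α i) i

theorem length_multiList (α : Fin d → ℕ) : (multiList α).length = ∑ i, α i := by
  simp [multiList, List.length_flatMap, Fin.sum_univ_def]

theorem nabla_eq_dlist (α : Fin d → ℕ) (g : (Fin d → ℝ) → ℂ) : nabla α g = dlist (multiList α) g := by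
  rw [nabla, Fin.foldr_eq_foldr_finRange, dlist, multiList, List.foldr_flatMap]
  congr 1
  funext i h
  induction α i with
  | zero => rfl
  | succ n ih => rw [Function.iterate_succ_apply', ih, List.replicate_succ, List.foldr_cons]

theorem Sym.dlist {n : ℕ} {p : ℤ} {K : ℝ} {g : (Fin d → ℝ) → ℂ} (L : List (Fin d))
    (hL : L.length ≤ n) (hg : Sym n p K g) : Sym (n - L.length) (p - L.length) K (dlist L g) := by
  induction L with
  | nil => simpa [WSAW.dlist] using hg
  | cons i L ih =>
    have h1 := ih (by simp at hL; omega)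
    rw [dlist_cons]
    rw [List.length_cons] at hL ⊢
    obtain ⟨m, hm⟩ : ∃ m, n - L.length = m + 1 := ⟨n - L.length - 1, by omega⟩
    rw [hm] at h1
    rw [show n - (L.length + 1) = m by omega,
      show p - ((L.length + 1 : ℕ) : ℤ) = p - L.length - 1 by push_cast; ring]
    exact h1.2 i

theorem ContDiffOn.dlist {U : Set (Fin d → ℝ)} (hU : IsOpen U) {n : ℕ} {g : (Fin d → ℝ) → ℂ}
    (hg : ContDiffOn ℝ n g U) (L : List (Fin d)) (hL : L.length ≤ n) :
    ContDiffOn ℝ ((n - L.length : ℕ) : WithTop ℕ∞) (dlist L g) U := by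
  induction L with
  | nil => simpa [WSAW.dlist] using hg
  | cons i L ih =>
    have h1 := ih (by simp at hL; omega)
    rw [dlist_cons]
    rw [List.length_cons] at hL ⊢
    obtain ⟨m, hm⟩ : ∃ m, n - L.length = m + 1 := ⟨n - L.length - 1, by omega⟩
    rw [hm] at h1
    rw [show n - (L.length + 1) = m by omega]
    exact ContDiffOn.partialD hU h1 i

end WSAW

namespace WSAW

open Finset MeasureTheory Filter Topology
open scoped ENNReal Real

variable {d : ℕ}

/-! ### Lattice symmetries -/

/-- Invariance under the automorphisms of `ℤ^d` that preserve the `ℓ¹` norm. -/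
def LatticeInvariant {β : Type*} (f : (Fin d → ℤ) → β) : Prop :=
  ∀ e : (Fin d → ℤ) ≃+ (Fin d → ℤ), (∀ x, ∑ j, |e x j| = ∑ j, |x j|) → ∀ x, f (e x) = f x

theorem mem_walks {n : ℕ} {x : Fin d → ℤ} {ω : Fin (n + 1) → Fin d → ℤ} :
    ω ∈ walks d n x ↔ ω 0 = 0 ∧ ω (Fin.last n) = x ∧
      ∀ i : Fin n, ∑ j, |ω i.succ j - ω i.castSucc j| = 1 := by
  simp [walks, walkSet]

theorem map_mem_walks {e : (Fin d → ℤ) ≃+ (Fin d → ℤ)} (he : ∀ x, ∑ j, |e x j| = ∑ j, |x j|)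
    {n : ℕ} {x : Fin d → ℤ} {ω : Fin (n + 1) → Fin d → ℤ} (hω : ω ∈ walks d n x) :
    (fun t => e (ω t)) ∈ walks d n (e x) := by
  rw [mem_walks] at hω ⊢
  refine ⟨by simp [hω.1], by simp [hω.2.1], fun i => ?_⟩
  rw [← hω.2.2 i]
  have := he (ω i.succ - ω i.castSucc)
  rw [map_sub] at this
  exact this

theorem J_map (β : ℝ) (e : (Fin d → ℤ) ≃+ (Fin d → ℤ)) {n : ℕ} (ω : Fin (n + 1) → Fin d → ℤ) :
    J β (fun t => e (ω t)) = J β ω := by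
  simp [J, U]

theorem latticeInvariant_lacePi (β : ℝ) (m : ℕ) : LatticeInvariant (lacePi d β m) := by
  intro e he x
  have he' : ∀ x, ∑ j, |e.symm x j| = ∑ j, |x j| := fun x => by
    rw [← he (e.symm x), e.apply_symm_apply]
  symm
  refine sum_nbij' (fun ω t => e (ω t)) (fun ω t => e.symm (ω t)) (fun ω hω => map_mem_walks he hω)
    (fun ω hω => ?_) (fun ω _ => by simp) (fun ω _ => by simp) fun ω _ => (J_map β e ω).symm
  simpa using map_mem_walks he' hω

theorem latticeInvariant_PiZ (β z : ℝ) : LatticeInvariant (PiZ d β z) := fun e he x =>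
  tsum_congr fun m => by rw [latticeInvariant_lacePi β m e he x]

theorem latticeInvariant_delta : LatticeInvariant (delta d) := fun e _ x => by simp [delta]

theorem latticeInvariant_D : LatticeInvariant (D d) := fun e he x => by simp [D, he]

theorem latticeInvariant_A (μ : ℝ) : LatticeInvariant (A d μ) := fun e he x => by
  rw [A, A, latticeInvariant_delta e he, latticeInvariant_D e he]

theorem latticeInvariant_F (β z : ℝ) : LatticeInvariant (F d β z) := fun e he x => by
  rw [F, F, latticeInvariant_delta e he, latticeInvariant_D e he, latticeInvariant_PiZ β z e he]

theorem latticeInvariant_E (β z : ℝ) : LatticeInvariant (E d β z) := fun e he x => by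
  rw [E, E, latticeInvariant_A _ e he, latticeInvariant_F β z e he]

theorem LatticeInvariant.ofReal {f : (Fin d → ℤ) → ℝ} (hf : LatticeInvariant f) :
    LatticeInvariant fun x => (f x : ℂ) := fun e he x => congrArg _ (hf e he x)

theorem tsum_eq_of_neg {f : (Fin d → ℤ) → ℂ} (e : (Fin d → ℤ) ≃+ (Fin d → ℤ))
    (h : ∀ x, f (e x) = -f x) : ∑' x, f x = 0 := by
  have h1 : ∑' x, f x = -∑' x, f x := by
    rw [← tsum_neg, ← e.toEquiv.tsum_eq f]
    exact tsum_congr h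
  exact self_eq_neg.1 h1

theorem prod_map_neg (x : Fin d → ℤ) (L : List (Fin d)) :
    (L.map fun i => Complex.I * ((-x) i : ℤ)).prod =
      (-1) ^ L.length * (L.map fun i => Complex.I * (x i : ℤ)).prod := by
  induction L with
  | nil => simp
  | cons i L ih =>
    rw [List.map_cons, List.prod_cons, ih, List.map_cons, List.prod_cons, List.length_cons, pow_succ,
      Pi.neg_apply]
    push_cast
    ring

theorem tsum_odd {f : (Fin d → ℤ) → ℂ} (hf : LatticeInvariant f) (L : List (Fin d))
    (hL : Odd L.length) : ∑' x, (L.map fun i => Complex.I * (x i : ℤ)).prod * f x = 0 := by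
  refine tsum_eq_of_neg (AddEquiv.neg _) fun x => ?_
  rw [hf _ (fun x => by simp)]
  rw [AddEquiv.neg_apply, prod_map_neg, hL.neg_one_pow]
  ring

/-- The reflection of the coordinate `i`. -/
def flip (i : Fin d) : (Fin d → ℤ) ≃+ (Fin d → ℤ) :=
  AddEquiv.piCongrRight fun j => if j = i then AddEquiv.neg ℤ else AddEquiv.refl ℤ

theorem flip_apply (i : Fin d) (x : Fin d → ℤ) (j : Fin d) :
    flip i x j = if j = i then -x j else x j := by
  simp only [flip, AddEquiv.piCongrRight_apply]
  split_ifs <;> simp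

/-- The permutation of coordinates. -/
def permute (σ : Equiv.Perm (Fin d)) : (Fin d → ℤ) ≃+ (Fin d → ℤ) where
  toFun x := x ∘ σ
  invFun x := x ∘ σ.symm
  left_inv x := by ext; simp
  right_inv x := by ext; simp
  map_add' _ _ := rfl

theorem tsum_mul_off_diagonal {f : (Fin d → ℤ) → ℂ} (hf : LatticeInvariant f) {i j : Fin d}
    (hij : i ≠ j) : ∑' x, ((x i : ℤ) : ℂ) * (x j : ℤ) * f x = 0 := by
  refine tsum_eq_of_neg (flip i) fun x => ?_
  rw [hf _ fun x => sum_congr rfl fun j _ => by rw [flip_apply]; split_ifs <;> simp]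
  rw [flip_apply, flip_apply, if_pos rfl, if_neg hij.symm]
  push_cast
  ring

theorem tsum_sq_eq {f : (Fin d → ℤ) → ℂ} (hf : LatticeInvariant f) (i j : Fin d) :
    ∑' x, ((x i : ℤ) : ℂ) ^ 2 * f x = ∑' x, ((x j : ℤ) : ℂ) ^ 2 * f x := by
  rw [← (permute (Equiv.swap i j)).toEquiv.tsum_eq]
  refine tsum_congr fun x => ?_
  change (((x ∘ Equiv.swap i j) i : ℤ) : ℂ) ^ 2 * f (permute (Equiv.swap i j) x) = _
  rw [hf _ fun x => Equiv.sum_comp (Equiv.swap i j) fun j => |x j|]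
  simp

theorem vanishTo_one_mulI {f : (Fin d → ℤ) → ℂ} (hf : LatticeInvariant f) (i : Fin d) :
    VanishTo 1 (mulI i f) := by
  intro L hL
  have : L = [] := List.eq_nil_of_length_eq_zero (by omega)
  subst this
  simpa [mulI] using tsum_odd hf [i] (by simp)

/-- Moments of order 1 and 3 vanish under x ↦ -x, and mixed second moments under reflection of one
coordinate, so only the total mass and the diagonal second moments need hypotheses. -/
theorem vanishTo_four {f : (Fin d → ℤ) → ℂ} (hf : LatticeInvariant f) (h0 : ∑' x, f x = 0)
    (h2 : ∀ i, ∑' x, ((x i : ℤ) : ℂ) ^ 2 * f x = 0) : VanishTo 4 f := by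
  intro L hL
  match L, hL with
  | [], _ => simpa using h0
  | [i], _ => exact tsum_odd hf [i] (by simp)
  | [i, j], _ =>
    have h : ∑' x, ((x i : ℤ) : ℂ) * (x j : ℤ) * f x = 0 := by
      by_cases hij : i = j
      · subst hij
        simpa [sq] using h2 i
      · exact tsum_mul_off_diagonal hf hij
    have := congrArg (fun s => -s) h
    rw [neg_zero, ← tsum_neg] at this
    rw [← this]
    refine tsum_congr fun x => ?_
    simp only [List.map_cons, List.map_nil, List.prod_cons, List.prod_nil]
    linear_combination ((x i : ℤ) : ℂ) * (x j : ℤ) * f x * Complex.I_mul_I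
  | [i, j, l], _ => exact tsum_odd hf [i, j, l] (by simp; decide)
  | i :: j :: l :: m :: L, h => simp at h; omega

theorem VanishTo.mono {p q : ℤ} (h : q ≤ p) {f : (Fin d → ℤ) → ℂ} (hf : VanishTo p f) :
    VanishTo q f := fun L hL => hf L (hL.trans_le h)

/-! ### Moments -/

theorem moment_add {n : ℕ} {f g : (Fin d → ℤ) → ℂ} (hf : Mom n f) (hg : Mom n g) :
    Mom n (fun x => f x + g x) ∧ moment n (fun x => f x + g x) ≤ moment n f + moment n g := by
  have h : ∀ x : Fin d → ℤ, (1 + ‖x‖) ^ n * ‖f x + g x‖ ≤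
      (1 + ‖x‖) ^ n * ‖f x‖ + (1 + ‖x‖) ^ n * ‖g x‖ := fun x => by
    rw [← mul_add]
    gcongr
    exact norm_add_le _ _
  have hs : Mom n fun x => f x + g x :=
    Summable.of_nonneg_of_le (fun x => by positivity) h (hf.add hg)
  exact ⟨hs, (hs.tsum_le_tsum h (hf.add hg)).trans_eq (hf.tsum_add hg)⟩

theorem moment_const_mul {n : ℕ} {f : (Fin d → ℤ) → ℂ} (c : ℂ) (hf : Mom n f) :
    Mom n (fun x => c * f x) ∧ moment n (fun x => c * f x) = ‖c‖ * moment n f := by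
  have h : (fun x : Fin d → ℤ => (1 + ‖x‖) ^ n * ‖c * f x‖) =
      fun x => ‖c‖ * ((1 + ‖x‖) ^ n * ‖f x‖) := by
    funext x
    rw [norm_mul]
    ring
  refine ⟨?_, ?_⟩
  · rw [Mom, h]
    exact hf.mul_left _
  · rw [moment, h, tsum_mul_left, moment]

theorem hasSum_delta {V : Type*} [AddCommGroup V] [Module ℝ V] [TopologicalSpace V]
    (h : (Fin d → ℤ) → V) : HasSum (fun x => delta d x • h x) (h 0) := by
  have := hasSum_single (f := fun x => delta d x • h x) 0 fun x hx => by simp [delta, hx]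
  simpa [delta] using this

theorem hasSum_D {V : Type*} [AddCommGroup V] [Module ℝ V] [TopologicalSpace V]
    (h : (Fin d → ℤ) → V) :
    HasSum (fun x => D d x • h x) (∑ s : Step d, (1 / (2 * d) : ℝ) • h (stepVec s)) := by
  classical
  set ι : Step d ↪ (Fin d → ℤ) := ⟨stepVec, stepVec_injective⟩
  have h1 : HasSum (fun x => D d x • h x) (∑ x ∈ univ.map ι, D d x • h x) :=
    hasSum_sum_of_ne_finset_zero ?_
  · rw [sum_map] at h1
    convert h1 using 2 with s
    change _ = D d (stepVec s) • h (stepVec s)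
    rw [D, if_pos (sum_abs_stepVec s)]
  · intro x hx
    rw [D, if_neg, zero_smul]
    intro hs
    obtain ⟨s, rfl⟩ := exists_stepVec_eq hs
    exact hx (mem_map_of_mem ι (mem_univ s))

theorem norm_stepVec (s : Step d) : ‖stepVec s‖ = 1 := by
  rw [stepVec, Pi.norm_single]
  cases s.2 <;> simp

theorem moment_delta (n : ℕ) : Mom n (fun x => (delta d x : ℂ)) ∧
    moment n (fun x => (delta d x : ℂ)) = 1 := by
  have h := hasSum_delta (d := d) fun x => (1 + ‖x‖) ^ n
  have e : (fun x => delta d x • (1 + ‖x‖) ^ n) =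
      fun x : Fin d → ℤ => (1 + ‖x‖) ^ n * ‖(delta d x : ℂ)‖ := by
    funext x
    rw [Complex.norm_real, smul_eq_mul, mul_comm, Real.norm_of_nonneg]
    unfold delta
    split_ifs <;> simp
  rw [e] at h
  exact ⟨h.summable, h.tsum_eq.trans (by simp)⟩

theorem moment_D (hd : 0 < d) (n : ℕ) : Mom n (fun x => (D d x : ℂ)) ∧
    moment n (fun x => (D d x : ℂ)) = 2 ^ n := by
  have h := hasSum_D (d := d) fun x => (1 + ‖x‖) ^ n
  have e : (fun x => D d x • (1 + ‖x‖) ^ n) =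
      fun x : Fin d → ℤ => (1 + ‖x‖) ^ n * ‖(D d x : ℂ)‖ := by
    funext x
    rw [Complex.norm_real, smul_eq_mul, mul_comm, Real.norm_of_nonneg]
    unfold D
    split_ifs
    · positivity
    · exact le_rfl
  rw [e] at h
  refine ⟨h.summable, h.tsum_eq.trans ?_⟩
  have hd' : (d : ℝ) ≠ 0 := by positivity
  simp only [norm_stepVec, smul_eq_mul, sum_const, card_univ, Fintype.card_prod, Fintype.card_fin,
    Fintype.card_bool, nsmul_eq_mul]
  push_cast
  field_simp
  norm_num

theorem normSq_nonneg (x : Fin d → ℤ) : 0 ≤ normSq x := sum_nonneg fun _ _ => sq_nonneg _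

theorem normSq_le (x : Fin d → ℤ) : normSq x ≤ d * (1 + ‖x‖) ^ 2 := by
  refine (sum_le_card_nsmul _ _ ((1 + ‖x‖) ^ 2) fun j _ => ?_).trans_eq (by simp)
  have h1 := norm_le_pi_norm x j
  rw [Int.norm_eq_abs] at h1
  exact sq_le_sq' (by linarith [neg_abs_le (x j : ℝ)]) (by linarith [le_abs_self (x j : ℝ)])

theorem normSq_stepVec (s : Step d) : normSq (stepVec s) = 1 := by
  rw [normSq, sum_eq_single_of_mem s.1 (mem_univ _)]
  · cases h : s.2 <;> simp [stepVec, h]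
  · intro j _ hj
    simp [stepVec, hj]

/-! ### Trigonometric bounds -/

/-- `∑ (1 - cos k_j)`, comparable with `|k|²` near the origin. -/
noncomputable def dirichletSum (k : Fin d → ℝ) : ℝ := ∑ j, (1 - Real.cos (k j))

theorem one_sub_cos_eq (θ : ℝ) : 1 - Real.cos θ = 2 * Real.sin (θ / 2) ^ 2 := by
  have := Real.cos_two_mul (θ / 2)
  rw [mul_div_cancel₀ θ two_ne_zero] at this
  have h2 := Real.sin_sq_add_cos_sq (θ / 2)
  linarith

theorem abs_sin_add_le (a b : ℝ) : |Real.sin (a + b)| ≤ |Real.sin a| + |Real.sin b| := by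
  rw [Real.sin_add]
  refine (abs_add_le _ _).trans ?_
  rw [abs_mul, abs_mul]
  have h1 := mul_le_of_le_one_right (abs_nonneg (Real.sin a)) (Real.abs_cos_le_one b)
  have h2 := mul_le_of_le_one_left (abs_nonneg (Real.sin b)) (Real.abs_cos_le_one a)
  linarith

theorem abs_sin_nat_mul_le (n : ℕ) (t : ℝ) : |Real.sin (n * t)| ≤ n * |Real.sin t| := by
  induction n with
  | zero => simp
  | succ n ih =>
    rw [Nat.cast_succ, add_mul, one_mul, add_mul, one_mul]
    exact (abs_sin_add_le _ _).trans (by linarith)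

theorem abs_sin_int_mul_le (n : ℤ) (t : ℝ) : |Real.sin (t * n)| ≤ |(n : ℝ)| * |Real.sin t| := by
  rw [mul_comm]
  obtain ⟨m, rfl | rfl⟩ := n.eq_nat_or_neg
  · simpa using abs_sin_nat_mul_le m t
  · simpa using abs_sin_nat_mul_le m t

theorem abs_sin_sum_le {ι : Type*} (s : Finset ι) (t : ι → ℝ) :
    |Real.sin (∑ j ∈ s, t j)| ≤ ∑ j ∈ s, |Real.sin (t j)| := by
  classical
  induction s using Finset.induction_on with
  | empty => simp
  | insert a s ha ih =>
    rw [sum_insert ha, sum_insert ha]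
    exact (abs_sin_add_le _ _).trans (by linarith)

/-- In terms of half angles, |sin| is subadditive, so |sin(k·x/2)| ≤ ∑ |x_j||sin(k_j/2)|, and
Cauchy–Schwarz finishes. The bound is global in k, so the comparison with the random walk needs no
separate region near 0. -/
theorem one_sub_cos_le (k : Fin d → ℝ) (x : Fin d → ℤ) :
    1 - Real.cos (∑ j, k j * (x j : ℝ)) ≤ normSq x * dirichletSum k := by
  have h1 : |Real.sin ((∑ j, k j * (x j : ℝ)) / 2)| ≤
      ∑ j, |(x j : ℝ)| * |Real.sin (k j / 2)| := by
    rw [sum_div]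
    refine (abs_sin_sum_le _ _).trans (sum_le_sum fun j _ => ?_)
    rw [mul_div_right_comm]
    exact abs_sin_int_mul_le _ _
  have h2 : Real.sin ((∑ j, k j * (x j : ℝ)) / 2) ^ 2 ≤
      (∑ j, |(x j : ℝ)| ^ 2) * ∑ j, |Real.sin (k j / 2)| ^ 2 := by
    rw [← sq_abs]
    exact (pow_le_pow_left₀ (abs_nonneg _) h1 2).trans (sum_mul_sq_le_sq_mul_sq _ _ _)
  simp only [sq_abs] at h2
  rw [one_sub_cos_eq, dirichletSum]
  simp only [one_sub_cos_eq, ← mul_sum]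
  rw [normSq]
  linarith

theorem dirichletSum_nonneg (k : Fin d → ℝ) : 0 ≤ dirichletSum k :=
  sum_nonneg fun j _ => by linarith [Real.cos_le_one (k j)]

theorem dirichletSum_pos {k : Fin d → ℝ} (hk : k ∉ zeroLattice d) : 0 < dirichletSum k := by
  rw [mem_zeroLattice_iff] at hk
  push Not at hk
  obtain ⟨i, hi⟩ := hk
  refine sum_pos' (fun j _ => by linarith [Real.cos_le_one (k j)]) ⟨i, mem_univ _, ?_⟩
  rw [one_sub_cos_eq]
  positivity

theorem le_dirichletSum (hd : 0 < d) {k : Fin d → ℝ} (hk : k ∈ box d) :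
    2 / π ^ 2 * ‖k‖ ^ 2 ≤ dirichletSum k := by
  have : Nonempty (Fin d) := ⟨⟨0, hd⟩⟩
  obtain ⟨i, hi⟩ := Finite.exists_max fun i => ‖k i‖
  have h1 : ‖k‖ = ‖k i‖ := le_antisymm ((pi_norm_le_iff_of_nonneg (norm_nonneg _)).2 hi)
    (norm_le_pi_norm k i)
  rw [h1, Real.norm_eq_abs, sq_abs]
  refine le_trans ?_ (single_le_sum (f := fun j => 1 - Real.cos (k j))
    (fun j _ => by linarith [Real.cos_le_one (k j)]) (mem_univ i))
  have := Real.cos_le_one_sub_mul_cos_sq (x := k i) (abs_le.2 ⟨hk.1 i, hk.2 i⟩)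
  linarith

end WSAW

/-! ### The parameters λ and μ, and bounds on A, F and E -/

namespace WSAW

open Finset MeasureTheory Filter Topology
open scoped ENNReal Real

variable {d : ℕ}

/-- The average over the nearest neighbours of the origin. -/
noncomputable def stepMean {V : Type*} [AddCommGroup V] [Module ℝ V] (h : (Fin d → ℤ) → V) : V :=
  ∑ s : Step d, (1 / (2 * d) : ℝ) • h (stepVec s)

theorem stepMean_of_forall (hd : 0 < d) {h : (Fin d → ℤ) → ℝ} {c : ℝ}
    (hc : ∀ s, h (stepVec s) = c) : stepMean h = c := by
  have hd' : (d : ℝ) ≠ 0 := by positivity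
  simp only [stepMean, hc, smul_eq_mul, sum_const, card_univ, Fintype.card_prod, Fintype.card_fin,
    Fintype.card_bool, nsmul_eq_mul]
  push_cast
  field_simp

theorem re_stepMean_chr (hd : 0 < d) (k : Fin d → ℝ) :
    (stepMean (chr k)).re = 1 - dirichletSum k / d := by
  have h1 : ∀ s : Step d, (chr k (stepVec s)).re = Real.cos (k s.1) := by
    intro s
    have : ∑ j, k j * (stepVec s j : ℝ) = k s.1 * (if s.2 then 1 else -1) := by
      rw [sum_eq_single_of_mem s.1 (mem_univ _)]
      · cases h : s.2 <;> simp [stepVec, h]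
      · intro j _ hj
        simp [stepVec, hj]
    rw [chr, this, mul_comm, Complex.exp_ofReal_mul_I_re]
    cases s.2 <;> simp
  have hd' : (d : ℝ) ≠ 0 := by positivity
  rw [stepMean, Complex.re_sum]
  simp only [Complex.smul_re, h1, smul_eq_mul]
  rw [Fintype.sum_prod_type]
  simp only [sum_const, card_univ, Fintype.card_bool, nsmul_eq_mul, dirichletSum, sum_sub_distrib,
    Fintype.card_fin, ← mul_sum]
  field_simp
  push_cast
  ring

section HasSum

variable {V : Type*} [AddCommGroup V] [Module ℝ V] [TopologicalSpace V] [IsTopologicalAddGroup V]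
  [ContinuousConstSMul ℝ V]

/-- Testing against a vector-valued h treats masses, second moments and characters at once. -/
theorem hasSum_A (μ : ℝ) (h : (Fin d → ℤ) → V) :
    HasSum (fun x => A d μ x • h x) (h 0 - (μ * (2 * d)) • stepMean h) := by
  have := (hasSum_delta h).sub ((hasSum_D h).const_smul (μ * (2 * d)))
  refine this.congr_fun fun x => ?_
  rw [A, sub_smul, mul_smul]

theorem hasSum_F {β z : ℝ} {h : (Fin d → ℤ) → V} {P : V}
    (hP : HasSum (fun x => PiZ d β z x • h x) P) :
    HasSum (fun x => F d β z x • h x) (h 0 - (z * (2 * d)) • stepMean h - P) := by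
  refine ((hasSum_A z h).sub hP).congr_fun fun x => ?_
  rw [F, A, sub_smul]

theorem hasSum_E {β z : ℝ} {h : (Fin d → ℤ) → V} {P : V}
    (hP : HasSum (fun x => PiZ d β z x • h x) P) :
    HasSum (fun x => E d β z x • h x) (h 0 - (mu d β z * (2 * d)) • stepMean h -
      lam d β z • (h 0 - (z * (2 * d)) • stepMean h - P)) := by
  refine ((hasSum_A _ h).sub ((hasSum_F hP).const_smul (lam d β z))).congr_fun fun x => ?_
  rw [E, sub_smul, mul_smul]

end HasSum

/-- The bounds on the lace expansion that enter the estimate of `f̂_z`. -/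
structure LaceBounds (d : ℕ) (β z K : ℝ) : Prop where
  summable_listJ : Summable fun l : List (Step d) => |z ^ l.length * listJ β l|
  lamDenom_pos : 0 < lamDenom d β z
  mu_nonneg : 0 ≤ mu d β z
  mu_le : mu d β z ≤ 1 / (2 * d)
  mom_PiZ : Mom (nd d) fun x => (PiZ d β z x : ℂ)
  mom_A : Mom (nd d) fun x => (A d (mu d β z) x : ℂ)
  mom_F : Mom (nd d) fun x => (F d β z x : ℂ)
  mom_E : Mom (nd d) fun x => (E d β z x : ℂ)
  moment_A : moment (nd d) (fun x => (A d (mu d β z) x : ℂ)) ≤ K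
  moment_F : moment (nd d) (fun x => (F d β z x : ℂ)) ≤ K
  moment_E : moment (nd d) (fun x => (E d β z x : ℂ)) ≤ K * β
  le_A : ∀ k, dirichletSum k / (2 * d) ≤ ‖fourier (A d (mu d β z)) k‖
  le_F : ∀ k, dirichletSum k / (2 * d) ≤ ‖fourier (F d β z) k‖
  vanishTo_E : VanishTo 4 fun x => (E d β z x : ℂ)

theorem two_le_nd (hd : 4 < d) : 2 ≤ nd d := by
  unfold nd
  split_ifs <;> omega

theorem mom_PiZ_of_listJ {n : ℕ} {β z c : ℝ} (hc : 0 ≤ c)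
    (h : ∑' l : List (Step d), ENNReal.ofReal ((1 + ‖disp l‖) ^ n * |z ^ l.length * listJ β l|) ≤
      ENNReal.ofReal c) :
    (Summable fun l : List (Step d) => |z ^ l.length * listJ β l|) ∧
      (Mom n fun x => (PiZ d β z x : ℂ)) ∧ moment n (fun x => (PiZ d β z x : ℂ)) ≤ c := by
  have hnn : ∀ l : List (Step d), 0 ≤ (1 + ‖disp l‖) ^ n * |z ^ l.length * listJ β l| :=
    fun l => by positivity
  have h1 : Summable fun l : List (Step d) => (1 + ‖disp l‖) ^ n * |z ^ l.length * listJ β l| := by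
    refine (ENNReal.summable_toReal (h.trans_lt ENNReal.ofReal_lt_top).ne).congr fun l => ?_
    rw [ENNReal.toReal_ofReal (hnn l)]
  have h2 : ∑' l : List (Step d), (1 + ‖disp l‖) ^ n * |z ^ l.length * listJ β l| ≤ c := by
    rw [← ENNReal.ofReal_tsum_of_nonneg hnn h1] at h
    exact (ENNReal.ofReal_le_ofReal_iff hc).1 h
  have hJ : Summable fun l : List (Step d) => |z ^ l.length * listJ β l| := by
    refine h1.of_nonneg_of_le (fun _ => abs_nonneg _) fun l => ?_
    refine le_mul_of_one_le_left (abs_nonneg _) (one_le_pow₀ ?_)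
    linarith [norm_nonneg (disp l)]
  have e1 : ∀ l : List (Step d), ‖((z ^ l.length * listJ β l : ℝ) : ℂ) *
      (((1 + ‖disp l‖) ^ n : ℝ) : ℂ)‖ = (1 + ‖disp l‖) ^ n * |z ^ l.length * listJ β l| := by
    intro l
    rw [norm_mul, Complex.norm_real, Complex.norm_real, Real.norm_eq_abs, mul_comm,
      Real.norm_of_nonneg (by positivity)]
  have h3 := summable_norm_listSum_mul (w := fun l : List (Step d) => z ^ l.length * listJ β l)
    (h := fun x => (((1 + ‖x‖) ^ n : ℝ) : ℂ)) (h1.congr fun l => (e1 l).symm)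
  have e2 : ∀ x : Fin d → ℤ, ‖(listSum (fun l : List (Step d) => z ^ l.length * listJ β l) x : ℂ) *
      (((1 + ‖x‖) ^ n : ℝ) : ℂ)‖ = (1 + ‖x‖) ^ n * ‖(PiZ d β z x : ℂ)‖ := by
    intro x
    rw [norm_mul, mul_comm, Complex.norm_real ((1 + ‖x‖) ^ n), Real.norm_of_nonneg (by positivity),
      PiZ_eq_listSum hJ]
  refine ⟨hJ, h3.1.congr e2, ?_⟩
  rw [moment, ← tsum_congr e2]
  exact h3.2.trans ((tsum_congr e1).trans_le h2)

/-- The real part is (1 - μΩ) + μΩ(1 - D̂): the first term is nonnegative and the second keeps at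
least half of 1 - D̂. -/
theorem le_norm_fourier_A (hd : 0 < d) {μ : ℝ} (h1 : 1 / 2 ≤ μ * (2 * d)) (h2 : μ * (2 * d) ≤ 1)
    (k : Fin d → ℝ) : dirichletSum k / (2 * d) ≤ ‖fourier (A d μ) k‖ := by
  have e : fourier (A d μ) k = chr k 0 - (μ * (2 * d)) • stepMean (chr k) :=
    (hasSum_A μ (chr k)).tsum_eq
  refine le_trans ?_ (Complex.re_le_norm _)
  rw [e, chr_zero_right, Complex.sub_re, Complex.one_re, Complex.smul_re, re_stepMean_chr hd]
  have h3 : 0 ≤ dirichletSum k / (2 * d) := div_nonneg (dirichletSum_nonneg k) (by positivity)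
  have h4 : dirichletSum k / d = 2 * (dirichletSum k / (2 * d)) := by field_simp
  rw [h4, smul_eq_mul]
  nlinarith

/-- The real part is F̂(0) + zΩ(1 - D̂(k)) + ∑ Π(x)(1 - cos k·x). The first term is nonnegative, the
second is at least 1 - D̂, and the small second moment of Π lets the third remove at most half of
that. -/
theorem le_norm_fourier_F (hd : 0 < d) {β z c : ℝ} (hz : 1 ≤ z * (2 * d))
    (hs0 : Summable fun x => |PiZ d β z x|) (hs2 : Summable fun x => normSq x * |PiZ d β z x|)
    (hs2c : ∑' x, normSq x * |PiZ d β z x| ≤ c) (hc : 2 * d * c ≤ 1)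
    (h0 : 0 ≤ 1 - z * (2 * d) - ∑' x, PiZ d β z x) (k : Fin d → ℝ) :
    dirichletSum k / (2 * d) ≤ ‖fourier (F d β z) k‖ := by
  have hPk : HasSum (fun x => PiZ d β z x • chr k x) (∑' x, PiZ d β z x • chr k x) := by
    refine (Summable.of_norm (hs0.congr fun x => ?_)).hasSum
    rw [norm_smul, norm_chr, mul_one, Real.norm_eq_abs]
  have h1 : fourier (F d β z) k = chr k 0 - (z * (2 * d)) • stepMean (chr k) -
      ∑' x, PiZ d β z x • chr k x := (hasSum_F hPk).tsum_eq
  have h2 : (∑' x, PiZ d β z x • chr k x).re =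
      ∑' x, PiZ d β z x * Real.cos (∑ j, k j * (x j : ℝ)) := by
    rw [Complex.re_tsum hPk.summable]
    refine tsum_congr fun x => ?_
    rw [Complex.smul_re, chr, mul_comm Complex.I, Complex.exp_ofReal_mul_I_re, smul_eq_mul]
  have hsc : Summable fun x => PiZ d β z x * Real.cos (∑ j, k j * (x j : ℝ)) := by
    refine Summable.of_norm_bounded hs0 fun x => ?_
    rw [norm_mul, Real.norm_eq_abs, Real.norm_eq_abs]
    exact mul_le_of_le_one_right (abs_nonneg _) (Real.abs_cos_le_one _)
  have h4 : 0 ≤ dirichletSum k := dirichletSum_nonneg k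
  have h3 : ∑' x, PiZ d β z x * Real.cos (∑ j, k j * (x j : ℝ)) - ∑' x, PiZ d β z x ≤
      c * dirichletSum k := by
    rw [← hsc.tsum_sub hs0.of_abs]
    refine le_trans ((hsc.sub hs0.of_abs).tsum_le_tsum (fun x => ?_)
      (hs2.mul_right (dirichletSum k))) ?_
    · have h4 := one_sub_cos_le k x
      have h5 : 0 ≤ 1 - Real.cos (∑ j, k j * (x j : ℝ)) := by
        linarith [Real.cos_le_one (∑ j, k j * (x j : ℝ))]
      calc PiZ d β z x * Real.cos (∑ j, k j * (x j : ℝ)) - PiZ d β z x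
          = -PiZ d β z x * (1 - Real.cos (∑ j, k j * (x j : ℝ))) := by ring
        _ ≤ |PiZ d β z x| * (1 - Real.cos (∑ j, k j * (x j : ℝ))) := by
            gcongr
            exact neg_le_abs _
        _ ≤ |PiZ d β z x| * (normSq x * dirichletSum k) := by gcongr
        _ = normSq x * |PiZ d β z x| * dirichletSum k := by ring
    · rw [tsum_mul_right]
      gcongr
  refine le_trans ?_ (Complex.re_le_norm _)
  rw [h1, chr_zero_right, Complex.sub_re, Complex.sub_re, h2, Complex.one_re, Complex.smul_re,
    re_stepMean_chr hd, smul_eq_mul]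
  have h5 : 2 * d * c * dirichletSum k ≤ 1 * dirichletSum k := by gcongr
  have h6 : c * dirichletSum k ≤ dirichletSum k / (2 * d) := by
    rw [le_div_iff₀ (by positivity)]
    linarith
  have h7 : dirichletSum k / d = 2 * (dirichletSum k / (2 * d)) := by field_simp
  have h8 : 0 ≤ dirichletSum k / (2 * d) := by positivity
  rw [h7]
  nlinarith

/-- The definition of μ makes the mass of E zero, and that of λ makes its second moment zero;
permutation symmetry spreads the latter over the coordinates. -/
theorem vanishTo_E (hd : 0 < d) {β z : ℝ} (hE : Mom 2 fun x => (E d β z x : ℂ))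
    (hs0 : Summable fun x => PiZ d β z x) (hs2 : Summable fun x => normSq x * PiZ d β z x)
    (hden : lamDenom d β z ≠ 0) : VanishTo 4 fun x => (E d β z x : ℂ) := by
  have hP0 : HasSum (fun x => PiZ d β z x • (1 : ℝ)) (∑' x, PiZ d β z x) := by
    simpa using hs0.hasSum
  have hP2 : HasSum (fun x => PiZ d β z x • normSq x) (∑' x, normSq x * PiZ d β z x) := by
    simpa [mul_comm] using hs2.hasSum
  have hm0 : stepMean (fun _ : Fin d → ℤ => (1 : ℝ)) = 1 := stepMean_of_forall hd fun _ => rfl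
  have hm2 : stepMean (normSq (d := d)) = 1 := stepMean_of_forall hd normSq_stepVec
  have hF0 : ∑' x, F d β z x = 1 - z * (2 * d) - ∑' x, PiZ d β z x := by
    simpa [hm0] using (hasSum_F hP0).tsum_eq
  have hlam : lam d β z * lamDenom d β z = 1 := by
    rw [lam]
    field_simp
  rw [lamDenom] at hlam
  have hmu : mu d β z * (2 * d) = 1 - lam d β z * ∑' x, F d β z x := by
    rw [mu]
    field_simp
  have hinv := (latticeInvariant_E (d := d) β z).ofReal
  have hE0 : ∑' x, E d β z x = 0 := by
    have := (hasSum_E hP0).tsum_eq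
    simp only [hm0, smul_eq_mul, mul_one] at this
    rw [this, hmu, hF0]
    ring
  have hE2 : ∑' x, E d β z x * normSq x = 0 := by
    have := (hasSum_E hP2).tsum_eq
    simp only [hm2, smul_eq_mul, mul_one, show normSq (0 : Fin d → ℤ) = 0 by simp [normSq]] at this
    rw [this, hmu, hF0]
    linear_combination hlam
  refine vanishTo_four hinv ?_ fun i => ?_
  · rw [← Complex.ofReal_tsum, hE0, Complex.ofReal_zero]
  · have hsum : ∀ j : Fin d, Summable fun x => ((x j : ℤ) : ℂ) ^ 2 * (E d β z x : ℂ) := by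
      intro j
      refine Summable.of_norm_bounded hE fun x => ?_
      rw [norm_mul, norm_pow, Complex.norm_intCast]
      gcongr
      have := norm_le_pi_norm x j
      rw [Int.norm_eq_abs] at this
      linarith
    have h1 : ∑' x, ∑ j : Fin d, ((x j : ℤ) : ℂ) ^ 2 * (E d β z x : ℂ) = 0 := by
      rw [← Complex.ofReal_zero, ← hE2, Complex.ofReal_tsum]
      refine tsum_congr fun x => ?_
      rw [normSq, ← sum_mul]
      push_cast
      ring
    rw [Summable.tsum_finsetSum fun j _ => hsum j,
      sum_congr rfl fun j _ => tsum_sq_eq hinv j i, sum_const, card_univ, Fintype.card_fin,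
      nsmul_eq_mul] at h1
    exact (mul_eq_zero.1 h1).resolve_left (by exact_mod_cast hd.ne')

/-- The bounds that follow from the smallness of the moments of `Π_z`. -/
theorem laceBounds_of_moment_le (hd : 4 < d) {β z ε : ℝ} (hβ : β ≤ 1) (hz : 1 / (2 * d) ≤ z)
    (hzc : z ≤ zc d β) (hJ : Summable fun l : List (Step d) => |z ^ l.length * listJ β l|)
    (hPi : Mom (nd d) fun x => (PiZ d β z x : ℂ))
    (hε : moment (nd d) (fun x => (PiZ d β z x : ℂ)) ≤ ε) (hsmall : 2 * d ^ 2 * ε ≤ 1) {K : ℝ}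
    (hK : 4 * 2 ^ nd d ≤ K) (hKβ : 10 * d * 2 ^ nd d * ε ≤ K * β) : LaceBounds d β z K := by
  have hd5 : (5 : ℝ) ≤ d := by exact_mod_cast hd
  have hdpos : 0 < d := by omega
  have hε0 : 0 ≤ ε := (moment_nonneg _ _).trans hε
  have hε1 : 10 * d * ε ≤ 1 := by nlinarith
  have hε2 : 50 * ε ≤ 1 := by nlinarith
  have hz0 : 0 < z := lt_of_lt_of_le (by positivity) hz
  have hz1 : 1 ≤ z * (2 * d) := by rwa [div_le_iff₀ (by positivity)] at hz
  have hpow : (1 : ℝ) ≤ 2 ^ nd d := one_le_pow₀ (by norm_num)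
  have hs0 : Summable fun x => |PiZ d β z x| := by
    refine (hPi.mono (Nat.zero_le _)).congr fun x => ?_
    simp
  have hs0ε : ∑' x, |PiZ d β z x| ≤ ε := by
    refine le_trans (le_of_eq ?_) ((moment_mono (Nat.zero_le _) hPi).trans hε)
    exact tsum_congr fun x => by simp
  have hs2' : Summable fun x => d * ((1 + ‖x‖) ^ 2 * ‖(PiZ d β z x : ℂ)‖) :=
    (hPi.mono (two_le_nd hd)).mul_left _
  have hle2 : ∀ x, normSq x * |PiZ d β z x| ≤ d * ((1 + ‖x‖) ^ 2 * ‖(PiZ d β z x : ℂ)‖) := by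
    intro x
    rw [← mul_assoc, Complex.norm_real, Real.norm_eq_abs]
    gcongr
    exact normSq_le x
  have hs2 : Summable fun x => normSq x * |PiZ d β z x| :=
    hs2'.of_nonneg_of_le (fun x => mul_nonneg (normSq_nonneg x) (abs_nonneg _)) hle2
  have hs2ε : ∑' x, normSq x * |PiZ d β z x| ≤ d * ε := by
    refine (hs2.tsum_le_tsum hle2 hs2').trans ?_
    rw [tsum_mul_left]
    have := (moment_mono (two_le_nd hd) hPi).trans hε
    gcongr
    exact this
  have hs2abs : Summable fun x => normSq x * PiZ d β z x := by
    refine Summable.of_abs (hs2.congr fun x => ?_)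
    rw [abs_mul, abs_of_nonneg (normSq_nonneg x)]
  have hP0 : HasSum (fun x => PiZ d β z x • (1 : ℝ)) (∑' x, PiZ d β z x) := by
    simpa using hs0.of_abs.hasSum
  set p0 := ∑' x, PiZ d β z x with hp0
  set p2 := ∑' x, normSq x * PiZ d β z x with hp2
  have hp0ε : |p0| ≤ ε := by
    have := norm_tsum_le_tsum_norm (f := PiZ d β z) hs0
    exact this.trans hs0ε
  have hp2ε : |p2| ≤ d * ε := by
    have hn : ∀ x, ‖normSq x * PiZ d β z x‖ = normSq x * |PiZ d β z x| := fun x => by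
      rw [norm_mul, Real.norm_of_nonneg (normSq_nonneg x), Real.norm_eq_abs]
    have := norm_tsum_le_tsum_norm (f := fun x => normSq x * PiZ d β z x)
      (hs2.congr fun x => (hn x).symm)
    exact this.trans ((tsum_congr hn).trans_le hs2ε)
  have hm0 : stepMean (fun _ : Fin d → ℤ => (1 : ℝ)) = 1 := stepMean_of_forall hdpos fun _ => rfl
  have hF0 : ∑' x, F d β z x = 1 - z * (2 * d) - p0 := by
    have := (hasSum_F hP0).tsum_eq
    simpa [hm0] using this
  have hFnn := tsum_F_nonneg hβ hz0 hzc hJ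
  set s := ∑' x, F d β z x with hs
  -- This uses zΩ ≥ 1; with the lower bound s ≥ 0 it places μΩ = 1 - λs in [1/2, 1].
  have hsε : s ≤ ε := by linarith [abs_le.1 hp0ε]
  have hden : lamDenom d β z = 1 - p0 + p2 := rfl
  have hdε : |p2 - p0| ≤ 2 * d * ε := by
    refine (abs_sub _ _).trans ?_
    nlinarith
  have hdε' := abs_le.1 hdε
  have hden0 : 4 / 5 ≤ lamDenom d β z := by rw [hden]; linarith
  have hdenpos : 0 < lamDenom d β z := by linarith
  have hlam : lam d β z * lamDenom d β z = 1 := by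
    rw [lam]
    field_simp
  set l := lam d β z with hl
  have hl0 : 0 < l := by rw [hl, lam]; positivity
  have hl2 : l ≤ 5 / 4 := by
    by_contra! h
    nlinarith
  have h1l : |1 - l| ≤ 5 / 4 * (2 * d * ε) := by
    have : 1 - l = l * (p2 - p0) := by rw [← hlam, hden]; ring
    rw [this, abs_mul, abs_of_pos hl0]
    gcongr
  have hmu : mu d β z * (2 * d) = 1 - l * s := by
    rw [mu, div_mul_cancel₀ _ (by positivity)]
  have hls : l * s ≤ 5 / 4 * ε := by gcongr
  have hls0 : 0 ≤ l * s := by positivity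
  have hmu_half : 1 / 2 ≤ mu d β z * (2 * d) := by rw [hmu]; linarith
  have hmu_nn : 0 ≤ mu d β z := by
    by_contra! h
    nlinarith
  have hMδ := moment_delta (d := d) (nd d)
  have hMD := moment_D hdpos (nd d)
  have hMA : ∀ μ : ℝ, 0 ≤ μ → μ * (2 * d) ≤ 2 → (Mom (nd d) fun x => (A d μ x : ℂ)) ∧
      moment (nd d) (fun x => (A d μ x : ℂ)) ≤ 3 * 2 ^ nd d := by
    intro μ hμ0 hμ
    have h1 := moment_const_mul ((-(μ * (2 * d)) : ℝ) : ℂ) hMD.1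
    have h2 := moment_add hMδ.1 h1.1
    have e : (fun x => (A d μ x : ℂ)) =
        fun x => (delta d x : ℂ) + ((-(μ * (2 * d)) : ℝ) : ℂ) * (D d x : ℂ) := by
      funext x
      rw [A]
      push_cast
      ring
    rw [e]
    refine ⟨h2.1, h2.2.trans ?_⟩
    rw [h1.2, hMδ.2, hMD.2, Complex.norm_real, norm_neg, Real.norm_of_nonneg (by positivity)]
    have := mul_le_mul_of_nonneg_right hμ (zero_le_one.trans hpow)
    linarith
  have hA := hMA (mu d β z) hmu_nn (by rw [hmu]; linarith)
  -- Nonnegativity of F̂(0) also bounds z from above: zΩ ≤ 1 - Π̂(0) ≤ 2.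
  have hAz := hMA z hz0.le (by linarith [abs_le.1 hp0ε])
  have hF : (Mom (nd d) fun x => (F d β z x : ℂ)) ∧
      moment (nd d) (fun x => (F d β z x : ℂ)) ≤ K := by
    have h1 := moment_const_mul (-1) hPi
    have h2 := moment_add hAz.1 h1.1
    have e : (fun x => (F d β z x : ℂ)) = fun x => (A d z x : ℂ) + -1 * (PiZ d β z x : ℂ) := by
      funext x
      rw [F, A]
      push_cast
      ring
    rw [e]
    refine ⟨h2.1, h2.2.trans ?_⟩
    rw [h1.2, norm_neg, norm_one, one_mul]
    linarith [hAz.2]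
  have hE : (Mom (nd d) fun x => (E d β z x : ℂ)) ∧
      moment (nd d) (fun x => (E d β z x : ℂ)) ≤ K * β := by
    have h1 := moment_const_mul ((1 - l : ℝ) : ℂ) hMδ.1
    have h2 := moment_const_mul ((-((1 - l) + l * p0) : ℝ) : ℂ) hMD.1
    have h3 := moment_const_mul (l : ℂ) hPi
    have h12 := moment_add h1.1 h2.1
    have h123 := moment_add h12.1 h3.1
    -- The dependence on z cancels from the coefficient of D. So E = (1-λ)δ - ((1-λ) + λΠ̂(0))D +
    -- λΠ, in which every coefficient or term is of the order of the moments of Π.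
    have hc : mu d β z * (2 * d) - l * (z * (2 * d)) = (1 - l) + l * p0 := by
      rw [hmu, hF0]; ring
    have e : (fun x => (E d β z x : ℂ)) = fun x => ((1 - l : ℝ) : ℂ) * (delta d x : ℂ) +
        ((-((1 - l) + l * p0) : ℝ) : ℂ) * (D d x : ℂ) + (l : ℂ) * (PiZ d β z x : ℂ) := by
      funext x
      rw [E, A, F, ← hc]
      push_cast
      ring
    rw [e]
    refine ⟨h123.1, h123.2.trans ((add_le_add_left h12.2 _).trans (le_trans ?_ hKβ))⟩
    rw [h1.2, h2.2, h3.2, hMδ.2, hMD.2]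
    simp only [Complex.norm_real, norm_neg, Real.norm_eq_abs, abs_of_pos hl0]
    have h4 : |1 - l + l * p0| ≤ 5 / 4 * (2 * d * ε) + 5 / 4 * ε := by
      refine (abs_add_le _ _).trans (add_le_add h1l ?_)
      rw [abs_mul, abs_of_pos hl0]
      gcongr
    have h5 : l * moment (nd d) (fun x => (PiZ d β z x : ℂ)) ≤ 5 / 4 * ε := by
      have := moment_nonneg (nd d) (fun x => (PiZ d β z x : ℂ))
      gcongr
    have hdε0 : 5 * ε ≤ d * ε := by gcongr
    calc |1 - l| * 1 + |1 - l + l * p0| * 2 ^ nd d + l * moment (nd d) (fun x => (PiZ d β z x : ℂ))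
        ≤ (5 / 4 * (2 * d * ε)) * 2 ^ nd d +
          (5 / 4 * (2 * d * ε) + 5 / 4 * ε) * 2 ^ nd d + 5 / 4 * ε * 2 ^ nd d := by
          refine add_le_add (add_le_add ?_ (by gcongr))
            (h5.trans (le_mul_of_one_le_right (by positivity) hpow))
          gcongr
      _ = (5 * (d * ε) + 5 / 2 * ε) * 2 ^ nd d := by ring
      _ ≤ (10 * (d * ε)) * 2 ^ nd d := by gcongr; linarith
      _ = _ := by ring
  refine ⟨hJ, hdenpos, hmu_nn, ?_, hPi, hA.1, hF.1, hE.1, hA.2.trans (by linarith), hF.2, hE.2, ?_, ?_, ?_⟩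
  rotate_left
  · exact le_norm_fourier_A hdpos hmu_half (by linarith)
  · exact le_norm_fourier_F hdpos hz1 hs0 hs2 hs2ε (by linarith) (hF0 ▸ hFnn)
  · exact vanishTo_E hdpos (hE.1.mono (two_le_nd hd)) hs0.of_abs hs2abs hdenpos.ne'
  rw [le_div_iff₀ (by positivity), hmu]
  linarith

theorem exists_laceBounds (hd : 4 < d) : ∃ β₀ K : ℝ, 0 < β₀ ∧ β₀ ≤ 1 / 2 ∧ 0 < K ∧
    ∀ β : ℝ, 0 < β → β ≤ β₀ → ∀ z : ℝ, 1 / (2 * d) ≤ z → z ≤ zc d β → b d β z ≤ 3 →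
      LaceBounds d β z K := by
  obtain ⟨β₀, K, hβ₀, hβ₀', hK, h⟩ := exists_moment_bound hd
  have hdpos : (0 : ℝ) < d := by exact_mod_cast (by omega : 0 < d)
  refine ⟨min β₀ (1 / (2 * d ^ 2 * K)), 4 * 2 ^ nd d + 10 * d * 2 ^ nd d * K, by positivity,
    (min_le_left _ _).trans hβ₀', by positivity, fun β hβ hβle z hz hzc hb => ?_⟩
  have hz0 : 0 ≤ z := le_trans (by positivity) hz
  obtain ⟨hJ, hPi, hε⟩ := mom_PiZ_of_listJ (by positivity)
    (h β hβ (hβle.trans (min_le_left _ _)) z hz0 hb)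
  have h1 : β ≤ 1 / (2 * d ^ 2 * K) := hβle.trans (min_le_right _ _)
  rw [le_div_iff₀ (by positivity)] at h1
  have h2 : (0 : ℝ) ≤ 4 * 2 ^ nd d := by positivity
  have h3 : (0 : ℝ) ≤ 10 * d * 2 ^ nd d * K := by positivity
  refine laceBounds_of_moment_le hd (by linarith [hβle.trans (min_le_left _ _)]) hz hzc hJ hPi hε
    (by linarith) (by linarith) ?_
  rw [add_mul]
  nlinarith [mul_nonneg h2 hβ.le]

end WSAW

/-! ### Integrability at the singular point -/

namespace WSAW

open Finset MeasureTheory Filter Topology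
open scoped ENNReal Real

variable {d : ℕ}

theorem box_subset_ball : box d ⊆ Metric.ball 0 4 := fun k hk => by
  rw [mem_ball_zero_iff]
  exact (norm_le_pi_of_mem_box hk).trans_lt Real.pi_lt_four

theorem measurableSet_box : MeasurableSet (box d) := measurableSet_Icc

theorem isCompact_box : IsCompact (box d) := isCompact_Icc

/-- In polar coordinates the radial density r^{d-1} cancels the singularity exactly. -/
theorem integrableOn_norm_zpow (hd : 0 < d) :
    IntegrableOn (fun k : Fin d → ℝ => ‖k‖ ^ (-((d : ℤ) - 1))) (box d) := by
  have : Nonempty (Fin d) := ⟨⟨0, hd⟩⟩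
  refine IntegrableOn.mono_set ?_ box_subset_ball
  rw [integrableOn_fun_norm_addHaar volume (f := fun y : ℝ => y ^ (-((d : ℤ) - 1)))]
  refine (integrableOn_congr_fun (g := fun _ => (1 : ℝ)) (fun y hy => ?_) measurableSet_Ioo).2
    (by simp)
  have hy0 : y ≠ 0 := hy.1.ne'
  have e : (-((d : ℤ) - 1)) = -((d - 1 : ℕ) : ℤ) := by omega
  simp only [Module.finrank_fin_fun, smul_eq_mul]
  rw [e, zpow_neg, zpow_natCast, mul_inv_cancel₀ (pow_ne_zero _ hy0)]

theorem ae_notMem_zeroLattice (hd : 0 < d) : ∀ᵐ k : Fin d → ℝ, k ∉ zeroLattice d := by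
  have : Nonempty (Fin d) := ⟨⟨0, hd⟩⟩
  exact measure_eq_zero_iff_ae_notMem.1 (countable_zeroLattice.measure_zero volume)

theorem aestronglyMeasurable_of_continuousOn (hd : 0 < d) {g : (Fin d → ℝ) → ℂ}
    (hg : ContinuousOn g (zeroLattice d)ᶜ) :
    AEStronglyMeasurable g (volume.restrict (box d)) := by
  have h1 := hg.aestronglyMeasurable (μ := volume) isOpen_compl_zeroLattice.measurableSet
  rw [Measure.restrict_eq_self_of_ae_mem (s := (zeroLattice d)ᶜ) (ae_notMem_zeroLattice hd)] at h1
  exact h1.restrict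

/-! ### Integration by parts on the torus -/

/-- Periodicity with respect to `(2πℤ)^d`. -/
def IsPeriodic (g : (Fin d → ℝ) → ℂ) : Prop := ∀ k i, g (k + Pi.single i (2 * π)) = g k

theorem IsPeriodic.partialD {g : (Fin d → ℝ) → ℂ} (hg : IsPeriodic g) (i : Fin d) :
    IsPeriodic (partialD i g) := by
  intro k j
  simp only [WSAW.partialD, lineDeriv]
  congr 1
  funext t
  rw [add_right_comm]
  exact hg _ _

theorem IsPeriodic.dlist {g : (Fin d → ℝ) → ℂ} (hg : IsPeriodic g) (L : List (Fin d)) :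
    IsPeriodic (dlist L g) := by
  induction L with
  | nil => exact hg
  | cons i L ih => exact ih.partialD i

theorem insertNth_notMem_zeroLattice {n : ℕ} (i : Fin (n + 1)) {y : Fin n → ℝ}
    (hy : y ∉ zeroLattice n) (t : ℝ) : i.insertNth t y ∉ zeroLattice (n + 1) := by
  intro h
  refine hy fun j => ?_
  simpa using h (i.succAbove j)

theorem insertNth_eq_add_smul {n : ℕ} (i : Fin (n + 1)) (y : Fin n → ℝ) (t : ℝ) :
    i.insertNth t y = i.insertNth 0 y + t • (Pi.single i 1 : Fin (n + 1) → ℝ) := by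
  ext j
  refine i.succAboveCases ?_ (fun j => ?_) j
  · simp
  · simp

theorem integral_line_partialD {n : ℕ} (i : Fin (n + 1)) {g : (Fin (n + 1) → ℝ) → ℂ}
    (hg : ContDiffOn ℝ 1 g (zeroLattice (n + 1))ᶜ) (hper : IsPeriodic g) {y : Fin n → ℝ}
    (hy : y ∉ zeroLattice n) : ∫ t in Set.Icc (-π) π, partialD i g (i.insertNth t y) = 0 := by
  have hline : ∀ t : ℝ, i.insertNth t y ∈ (zeroLattice (n + 1))ᶜ :=
    fun t => insertNth_notMem_zeroLattice i hy t
  have hcont : Continuous fun t : ℝ => (i.insertNth t y : Fin (n + 1) → ℝ) := by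
    rw [funext (insertNth_eq_add_smul i y)]
    fun_prop
  have hderiv : ∀ t : ℝ, HasDerivAt (fun t : ℝ => g (i.insertNth t y))
      (partialD i g (i.insertNth t y)) t := by
    intro t
    have h1 : DifferentiableAt ℝ g (i.insertNth t y) :=
      (hg.differentiableOn (by simp)).differentiableAt
        (isOpen_compl_zeroLattice.mem_nhds (hline t))
    have h2 : HasDerivAt (fun t : ℝ => (i.insertNth t y : Fin (n + 1) → ℝ)) (Pi.single i 1) t := by
      rw [funext (insertNth_eq_add_smul i y)]
      simpa using ((hasDerivAt_id t).smul_const (Pi.single i 1 : Fin (n + 1) → ℝ)).const_add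
        (i.insertNth 0 y : Fin (n + 1) → ℝ)
    rw [partialD_eq_fderiv h1]
    exact h1.hasFDerivAt.comp_hasDerivAt t h2
  have hc : Continuous fun t : ℝ => partialD i g (i.insertNth t y) := by
    have h1 : ContDiffOn ℝ (0 : ℕ) (partialD i g) (zeroLattice (n + 1))ᶜ :=
      ContDiffOn.partialD isOpen_compl_zeroLattice (by simpa using hg) i
    exact h1.continuousOn.comp_continuous hcont hline
  rw [integral_Icc_eq_integral_Ioc, ← intervalIntegral.integral_of_le (by linarith [Real.pi_pos]),
    intervalIntegral.integral_eq_sub_of_hasDerivAt (fun t _ => hderiv t) (hc.intervalIntegrable _ _),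
    sub_eq_zero]
  rw [← hper (i.insertNth (-π) y) i]
  congr 1
  rw [insertNth_eq_add_smul i y π, insertNth_eq_add_smul i y (-π), add_assoc]
  congr 1
  ext j
  by_cases h : j = i
  · subst h
    simp
    ring
  · simp [h]

/-- By Fubini, integrate first in direction i. As d ≥ 2, almost every such line avoids the singular
points, and along it the fundamental theorem of calculus and periodicity give 0. No cutoff near the
origin is needed. -/
theorem integral_partialD (hd : 2 ≤ d) (i : Fin d) {g : (Fin d → ℝ) → ℂ}
    (hg : ContDiffOn ℝ 1 g (zeroLattice d)ᶜ) (hper : IsPeriodic g)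
    (hint : IntegrableOn (partialD i g) (box d)) : ∫ k in box d, partialD i g k = 0 := by
  obtain ⟨n, rfl⟩ : ∃ n, d = n + 1 := ⟨d - 1, by omega⟩
  rw [IntegrableOn, volume_restrict_box] at hint
  rw [volume_restrict_box]
  have hmp := (measurePreserving_piFinSuccAbove
    (fun _ : Fin (n + 1) => volume.restrict (Set.Icc (-π) π)) i).symm
  rw [← hmp.integrable_comp_emb (MeasurableEquiv.measurableEmbedding _)] at hint
  rw [← hmp.integral_comp']
  refine (integral_prod_symm _ hint).trans ?_
  refine integral_eq_zero_of_ae ?_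
  have h1 : ∀ᵐ y ∂(Measure.pi fun _ : Fin n => volume.restrict (Set.Icc (-π) π)),
      y ∉ zeroLattice n := by
    rw [← volume_restrict_box]
    exact ae_restrict_of_ae (ae_notMem_zeroLattice (by omega))
  filter_upwards [h1] with y hy
  exact integral_line_partialD i hg hper hy

theorem integral_partialD_mul (hd : 2 ≤ d) (i : Fin d) {g φ : (Fin d → ℝ) → ℂ}
    (hg : ContDiffOn ℝ 1 g (zeroLattice d)ᶜ) (hgper : IsPeriodic g) (hφ : ContDiff ℝ 1 φ)
    (hφper : IsPeriodic φ) (hint : IntegrableOn g (box d))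
    (hint' : IntegrableOn (partialD i g) (box d)) :
    ∫ k in box d, partialD i g k * φ k = -∫ k in box d, g k * partialD i φ k := by
  have hφc : ContDiffOn ℝ (0 : ℕ) (partialD i φ) Set.univ :=
    ContDiffOn.partialD isOpen_univ (by simpa using hφ.contDiffOn) i
  have h1 : IntegrableOn (fun k => partialD i g k * φ k) (box d) :=
    hint'.mul_continuousOn hφ.continuous.continuousOn isCompact_box
  have h2 : IntegrableOn (fun k => g k * partialD i φ k) (box d) :=
    hint.mul_continuousOn (hφc.continuousOn.mono (Set.subset_univ _)) isCompact_box
  have e : ∀ᵐ k ∂(volume.restrict (box d)),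
      partialD i g k * φ k + g k * partialD i φ k = partialD i (g * φ) k := by
    filter_upwards [ae_restrict_of_ae (ae_notMem_zeroLattice (by omega))] with k hk
    rw [partialD_mul ((hg.differentiableOn (by simp)).differentiableAt
      (isOpen_compl_zeroLattice.mem_nhds hk)) (hφ.differentiable (by simp) k)]
  have h3 := integral_partialD hd i (hg.mul hφ.contDiffOn)
    (fun k j => by rw [hgper, hφper])
    ((integrable_congr e).1 (h1.add h2))
  have h4 := integral_add h1 h2
  rw [integral_congr_ae e] at h4
  rw [eq_neg_iff_add_eq_zero, ← h4]
  exact h3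

theorem integral_dlist_mul (hd : 2 ≤ d) {g : (Fin d → ℝ) → ℂ} (hgper : IsPeriodic g)
    (L : List (Fin d)) (hg : ContDiffOn ℝ L.length g (zeroLattice d)ᶜ)
    (hint : ∀ M : List (Fin d), M.length ≤ L.length → IntegrableOn (dlist M g) (box d))
    {φ : (Fin d → ℝ) → ℂ} (hφ : ContDiff ℝ (⊤ : ℕ∞) φ) (hφper : IsPeriodic φ) :
    ∫ k in box d, dlist L g k * φ k =
      (-1) ^ L.length * ∫ k in box d, g k * dlist L.reverse φ k := by
  induction L generalizing φ with
  | nil => simp [dlist]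
  | cons i L ih =>
    rw [List.length_cons] at hg hint
    have hg' : ContDiffOn ℝ 1 (dlist L g) (zeroLattice d)ᶜ := by
      simpa using ContDiffOn.dlist isOpen_compl_zeroLattice hg L (by omega)
    have hφ' : ContDiff ℝ (⊤ : ℕ∞) (partialD i φ) := by
      rw [contDiff_infty]
      intro n
      rw [← contDiffOn_univ]
      exact ContDiffOn.partialD isOpen_univ (contDiffOn_univ.2 (contDiff_infty.1 hφ _)) i
    rw [dlist_cons, integral_partialD_mul hd i hg' (hgper.dlist L) (contDiff_infty.1 hφ 1) hφper
      (hint L (by omega)) (hint (i :: L) (by simp)),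
      ih (hg.of_le (by norm_cast; omega)) (fun M hM => hint M (by omega)) hφ' (hφper.partialD i),
      List.reverse_cons, dlist_append, List.length_cons, pow_succ]
    simp [dlist]

theorem partialD_comm {φ : (Fin d → ℝ) → ℂ} (hφ : ContDiff ℝ 2 φ) (i j : Fin d) :
    partialD i (partialD j φ) = partialD j (partialD i φ) := by
  have h1 : Differentiable ℝ (fderiv ℝ φ) :=
    (hφ.fderiv_right (m := 1) (by norm_num)).differentiable (by simp)
  have h2 : ∀ j, partialD j φ = fun k => fderiv ℝ φ k (Pi.single j 1) := fun j =>
    funext fun k => partialD_eq_fderiv (hφ.differentiable (by simp) k) j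
  have h3 : ∀ (i j : Fin d) (k), partialD i (partialD j φ) k =
      fderiv ℝ (fderiv ℝ φ) k (Pi.single i 1) (Pi.single j 1) := by
    intro i j k
    rw [h2]
    have := (h1 k).hasFDerivAt.clm_apply (hasFDerivAt_const (Pi.single j (1 : ℝ)) k)
    rw [partialD_eq_of_hasFDerivAt this]
    simp
  funext k
  rw [h3, h3]
  exact (hφ.contDiffAt.isSymmSndFDerivAt (by simp)).eq _ _

theorem contDiff_dlist {φ : (Fin d → ℝ) → ℂ} (hφ : ContDiff ℝ (⊤ : ℕ∞) φ) (L : List (Fin d))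
    (n : ℕ) : ContDiff ℝ n (dlist L φ) := by
  have h := ContDiffOn.dlist (n := n + L.length) isOpen_univ
    (contDiffOn_univ.2 (contDiff_infty.1 hφ _)) L (by omega)
  rw [Nat.add_sub_cancel] at h
  exact contDiffOn_univ.1 h

/-- Integration by parts reverses the order of the derivatives; on a smooth test function this is
harmless. -/
theorem dlist_perm {φ : (Fin d → ℝ) → ℂ} (hφ : ContDiff ℝ (⊤ : ℕ∞) φ) {L M : List (Fin d)}
    (h : L.Perm M) : dlist L φ = dlist M φ := by
  induction h with
  | nil => rfl
  | cons i _ ih => rw [dlist_cons, ih, dlist_cons]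
  | swap i j L => exact partialD_comm (contDiff_dlist hφ L 2) j i
  | trans _ _ h1 h2 => exact h1.trans h2

end WSAW

/-! ### Singularity and derivatives of f̂ -/

namespace WSAW

open Finset MeasureTheory Filter Topology
open scoped ENNReal Real

variable {d : ℕ}

theorem chr_add_single (k : Fin d → ℝ) (i : Fin d) (x : Fin d → ℤ) :
    chr (k + Pi.single i (2 * π)) x = chr k x := by
  have h : ∑ j, (k + Pi.single i (2 * π) : Fin d → ℝ) j * (x j : ℝ) =
      (∑ j, k j * (x j : ℝ)) + 2 * π * x i := by
    simp [add_mul, sum_add_distrib, Pi.single_apply]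
  rw [chr, chr, h, Complex.exp_eq_exp_iff_exists_int]
  refine ⟨x i, ?_⟩
  push_cast
  ring

theorem isPeriodic_fourier (f : (Fin d → ℤ) → ℝ) : IsPeriodic (fourier f) := fun k i =>
  tsum_congr fun x => congrArg _ (chr_add_single k i x)

/-- The order of vanishing of `Ê_z` at the origin that the moments of `Π_z` give. -/
def vanishingOrder (d : ℕ) : ℕ := if d = 5 then 3 else 4

theorem vanishingOrder_le_four : vanishingOrder d ≤ 4 := by
  unfold vanishingOrder
  split_ifs <;> omega

/-- The Taylor bound needs as many moments as orders of vanishing. For d = 5 only three are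
available, so one order of the vanishing of Ê is given up. -/
theorem vanishingOrder_le_nd (hd : 4 < d) : vanishingOrder d ≤ nd d := by
  unfold vanishingOrder nd
  split_ifs <;> omega

/-- Power counting: the top derivatives have exponent `vanishingOrder d` - 4 - `nd d`, which must be
at least -(d-1). This is what costs a derivative when d = 5. -/
theorem nd_add_four_le : nd d + 4 ≤ vanishingOrder d + (d - 1) := by
  unfold vanishingOrder nd
  split_ifs <;> omega

theorem LaceBounds.fhat_eq_mul {β z K : ℝ} (h : LaceBounds d β z K) (hβ : β ≤ 1) (hz : 0 ≤ z) :
    fhat d β z = (fourier (A d (mu d β z)))⁻¹ * fourier (E d β z) * (fourier (F d β z))⁻¹ :=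
  funext fun k => fhat_eq hβ hz h.mu_nonneg h.summable_listJ k

theorem ne_zero_of_le_norm (hd : 0 < d) {g : (Fin d → ℝ) → ℂ}
    (hg : ∀ k, dirichletSum k / (2 * d) ≤ ‖g k‖) {k : Fin d → ℝ} (hk : k ∉ zeroLattice d) :
    g k ≠ 0 := by
  have h := dirichletSum_pos hk
  exact norm_pos_iff.1 (lt_of_lt_of_le (by positivity) (hg k))

theorem contDiffOn_inv_fourier (hd : 0 < d) {n : ℕ} {f : (Fin d → ℤ) → ℝ}
    (hf : Mom n fun x => (f x : ℂ)) (hle : ∀ k, dirichletSum k / (2 * d) ≤ ‖fourier f k‖) :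
    ContDiffOn ℝ n (fourier f)⁻¹ (zeroLattice d)ᶜ := by
  have h : ContDiffOn ℝ n (fourier f) (zeroLattice d)ᶜ := (contDiff_fc hf).contDiffOn
  exact h.inv fun k hk => ne_zero_of_le_norm hd hle hk

theorem LaceBounds.contDiffOn_fhat (hd : 0 < d) {β z K : ℝ} (h : LaceBounds d β z K) (hβ : β ≤ 1)
    (hz : 0 ≤ z) : ContDiffOn ℝ (nd d) (fhat d β z) (zeroLattice d)ᶜ := by
  rw [h.fhat_eq_mul hβ hz]
  have hE : ContDiffOn ℝ (nd d) (fourier (E d β z)) (zeroLattice d)ᶜ :=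
    (contDiff_fc h.mom_E).contDiffOn
  exact ((contDiffOn_inv_fourier hd h.mom_A h.le_A).mul hE).mul
    (contDiffOn_inv_fourier hd h.mom_F h.le_F)

/-- Lattice symmetry makes the gradient vanish at the origin, so it has exponent 1 as `Sym.inv`
requires. The statement serves both A and F. -/
theorem exists_sym_inv_fourier (hd : 4 < d) {K : ℝ} (hK : 0 ≤ K) : ∃ K' : ℝ, 0 ≤ K' ∧
    ∀ f : (Fin d → ℤ) → ℝ, LatticeInvariant f → (Mom (nd d) fun x => (f x : ℂ)) →
      moment (nd d) (fun x => (f x : ℂ)) ≤ K →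
      (∀ k, dirichletSum k / (2 * d) ≤ ‖fourier f k‖) → Sym (nd d) (-2) K' (fourier f)⁻¹ := by
  have hdpos : 0 < d := by omega
  have hc : 0 < 2 / π ^ 2 / (2 * d) := by positivity
  obtain ⟨K', hK', h⟩ := Sym.inv d (nd d) hc
    (show 0 ≤ (4 * ((d : ℝ) + 1)) ^ nd d * K by positivity)
  obtain ⟨n, hn⟩ : ∃ n, nd d = n + 1 := ⟨nd d - 1, by have := two_le_nd hd; omega⟩
  refine ⟨K', hK', fun f hinv hf hfK hle => h _ (contDiff_fc hf).contDiffOn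
    (fun k hk => ne_zero_of_le_norm hdpos hle hk) (fun k hk _ => ?_) fun i => ?_⟩
  · refine le_trans ?_ (hle k)
    rw [div_mul_eq_mul_div]
    gcongr
    exact le_dirichletSum hdpos hk
  · have h2 := two_le_nd hd
    have hf1 : Mom (n + 1) fun x => (f x : ℂ) := hn ▸ hf
    have hm := moment_mulI_le hf1 i
    rw [← hn] at hm
    rw [fourier_eq_fc, partialD_fc (hf.mono (by omega)), show nd d - 1 = n by omega]
    exact (sym_fc (N := nd d) (by omega) (by omega) (by omega) (hf1.mulI i)
      (vanishTo_one_mulI hinv.ofReal i)).mono_const (by gcongr; exact hm.trans hfK)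

/-- Each inverse contributes exponent -2 and Ê its order of vanishing; the factor β enters only
through the moments of E. -/
theorem exists_sym_fhat (hd : 4 < d) {K : ℝ} (hK : 0 ≤ K) : ∃ K' : ℝ, 0 < K' ∧
    ∀ β z : ℝ, 0 < β → β ≤ 1 → 0 ≤ z → LaceBounds d β z K →
      Sym (nd d) ((vanishingOrder d : ℤ) - 4) (K' * β) (fhat d β z) := by
  have hdpos : 0 < d := by omega
  obtain ⟨M, hM, hinv⟩ := exists_sym_inv_fourier hd hK
  set B := (4 * ((d : ℝ) + 1)) ^ nd d * K
  have hB : 0 ≤ B := by positivity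
  refine ⟨2 ^ nd d * (2 ^ nd d * (M * B) * M) + 1, by positivity, fun β z hβ0 hβ hz h => ?_⟩
  have hE : Sym (nd d) (vanishingOrder d) (B * β) (fourier (E d β z)) :=
    (sym_fc (N := nd d) (by exact_mod_cast vanishingOrder_le_nd hd) le_rfl (by omega) h.mom_E
      (h.vanishTo_E.mono (by exact_mod_cast vanishingOrder_le_four))).mono_const (by
        rw [mul_assoc]
        have := h.moment_E
        gcongr)
  have hA := hinv _ (latticeInvariant_A _) h.mom_A h.moment_A h.le_A
  have hF := hinv _ (latticeInvariant_F _ _) h.mom_F h.moment_F h.le_F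
  have cA := contDiffOn_inv_fourier hdpos h.mom_A h.le_A
  have cF := contDiffOn_inv_fourier hdpos h.mom_F h.le_F
  have cE : ContDiffOn ℝ (nd d) (fourier (E d β z)) (zeroLattice d)ᶜ :=
    (contDiff_fc h.mom_E).contDiffOn
  have h1 := Sym.mul hM (by positivity) cA cE hA hE
  have h2 := Sym.mul (by positivity) hM (cA.mul cE) cF h1 hF
  rw [h.fhat_eq_mul hβ hz, show (vanishingOrder d : ℤ) - 4 = -2 + vanishingOrder d + -2 by ring]
  refine h2.mono_const ?_
  rw [add_mul, one_mul]
  refine le_trans (le_of_eq ?_) (le_add_of_nonneg_right hβ0.le)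
  ring

theorem norm_dlist_le (hd : 4 < d) {K : ℝ} (hK : 0 ≤ K) {g : (Fin d → ℝ) → ℂ}
    (hg : Sym (nd d) ((vanishingOrder d : ℤ) - 4) K g) {L : List (Fin d)} (hL : L.length ≤ nd d)
    {k : Fin d → ℝ} (hk : k ∈ box d) (h0 : k ≠ 0) :
    ‖dlist L g k‖ ≤ K * 4 ^ d * ‖k‖ ^ (-((d : ℤ) - 1)) := by
  have h1 := (hg.dlist L hL).bound k hk h0
  have hk0 : 0 < ‖k‖ := norm_pos_iff.2 h0
  have h2 := nd_add_four_le (d := d)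
  -- Lower derivatives are less singular by m powers of ‖k‖, which are bounded on the box.
  obtain ⟨m, hm⟩ : ∃ m : ℕ, (vanishingOrder d : ℤ) - 4 - L.length = m + -((d : ℤ) - 1) :=
    ⟨vanishingOrder d + (d - 1) - 4 - L.length, by omega⟩
  have h3 := vanishingOrder_le_four (d := d)
  have hk4 : ‖k‖ ≤ 4 := (norm_le_pi_of_mem_box hk).trans Real.pi_le_four
  have h4 : ‖k‖ ^ m ≤ 4 ^ d := calc
    ‖k‖ ^ m ≤ 4 ^ m := by gcongr
    _ ≤ 4 ^ d := pow_le_pow_right₀ (by norm_num) (by omega)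
  refine h1.trans ?_
  rw [hm, zpow_add₀ hk0.ne', zpow_natCast, ← mul_assoc]
  gcongr

theorem integrableOn_dlist (hd : 4 < d) {K : ℝ} (hK : 0 ≤ K) {g : (Fin d → ℝ) → ℂ}
    (hgc : ContDiffOn ℝ (nd d) g (zeroLattice d)ᶜ)
    (hg : Sym (nd d) ((vanishingOrder d : ℤ) - 4) K g) {L : List (Fin d)} (hL : L.length ≤ nd d) :
    IntegrableOn (dlist L g) (box d) ∧ ∫ k in box d, ‖dlist L g k‖ ≤
      K * (4 ^ d * ∫ k in box d, ‖k‖ ^ (-((d : ℤ) - 1))) := by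
  have hdpos : 0 < d := by omega
  have h1 : IntegrableOn (fun k : Fin d → ℝ => K * 4 ^ d * ‖k‖ ^ (-((d : ℤ) - 1))) (box d) :=
    (integrableOn_norm_zpow hdpos).const_mul _
  have h2 : ∀ᵐ k ∂volume.restrict (box d),
      ‖dlist L g k‖ ≤ K * 4 ^ d * ‖k‖ ^ (-((d : ℤ) - 1)) := by
    filter_upwards [ae_restrict_mem measurableSet_box,
      ae_restrict_of_ae (ae_notMem_zeroLattice hdpos)] with k hk hk0
    refine norm_dlist_le hd hK hg hL hk ?_
    rintro rfl
    exact hk0 fun i => ⟨0, by simp⟩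
  have h3 := aestronglyMeasurable_of_continuousOn hdpos
    (ContDiffOn.dlist isOpen_compl_zeroLattice hgc L hL).continuousOn
  have h4 : IntegrableOn (dlist L g) (box d) := h1.mono' h3 h2
  refine ⟨h4, (integral_mono_ae h4.norm h1 h2).trans_eq ?_⟩
  rw [integral_const_mul, mul_assoc]

theorem LaceBounds.wellDefined (hd : 4 < d) {β z K : ℝ} (h : LaceBounds d β z K) :
    WellDefined d β z := by
  have hdpos : 0 < d := by omega
  refine ⟨summable_lacePi h.summable_listJ, ?_, h.lamDenom_pos, h.mu_nonneg, h.mu_le, fun k hk =>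
    ⟨ne_zero_of_le_norm hdpos h.le_A hk, ne_zero_of_le_norm hdpos h.le_F hk⟩⟩
  refine Summable.of_nonneg_of_le (fun x => ?_) (fun x => ?_)
    ((h.mom_PiZ.mono (two_le_nd hd)).mul_left (1 + d : ℝ))
  · have := normSq_nonneg x
    positivity
  · rw [← mul_assoc, Complex.norm_real, Real.norm_eq_abs]
    have h1 := normSq_le x
    have h2 : (1 : ℝ) ≤ (1 + ‖x‖) ^ 2 := one_le_pow₀ (by linarith [norm_nonneg x])
    gcongr
    linarith

end WSAW

theorem proposition3p3 (d : ℕ) (hd : 4 < d) :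
    ∃ β₀ : ℝ, 0 < β₀ ∧ β₀ < 1 ∧ ∃ K : ℝ, 0 < K ∧
      ∀ β : ℝ, 0 < β → β ≤ β₀ →
      ∀ z : ℝ, 1 / (2 * d) ≤ z → z ≤ WSAW.zc d β → WSAW.b d β z ≤ 3 →
        WSAW.WellDefined d β z ∧
        ContDiffOn ℝ (WSAW.nd d) (WSAW.fhat d β z) (WSAW.zeroLattice d)ᶜ ∧
        ∀ α : Fin d → ℕ, ∑ i, α i ≤ WSAW.nd d →
          MeasureTheory.IntegrableOn (WSAW.nabla α (WSAW.fhat d β z)) (WSAW.box d) ∧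
          ∫ k in WSAW.box d, ‖WSAW.nabla α (WSAW.fhat d β z) k‖ ≤ K * β ∧
          ∀ φ : (Fin d → ℝ) → ℂ, WSAW.IsTorusTest φ →
            ∫ k in WSAW.box d, WSAW.fhat d β z k * WSAW.nabla α φ k =
              (-1) ^ (∑ i, α i) * ∫ k in WSAW.box d, WSAW.nabla α (WSAW.fhat d β z) k * φ k := by
  open WSAW MeasureTheory in
  have hdpos : 0 < d := by omega
  obtain ⟨β₀, K, hβ₀, hβ₀', hK, hbounds⟩ := exists_laceBounds hd
  obtain ⟨K', hK', hsym⟩ := exists_sym_fhat hd hK.le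
  set I := ∫ k in box d, ‖k‖ ^ (-((d : ℤ) - 1))
  have hI : 0 ≤ I := integral_nonneg fun k => zpow_nonneg (norm_nonneg k) _
  -- The added 1 gives positivity without showing that I is nonzero.
  refine ⟨β₀, hβ₀, by linarith, K' * (4 ^ d * I) + 1, by positivity, fun β hβ hββ z hz hzc hb => ?_⟩
  have hβ1 : β ≤ 1 := by linarith
  have hz0 : 0 ≤ z := le_trans (by positivity) hz
  have h := hbounds β hβ hββ z hz hzc hb
  have hc := h.contDiffOn_fhat hdpos hβ1 hz0
  have hs := hsym β z hβ hβ1 hz0 h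
  have hper : IsPeriodic (fhat d β z) := fun k i => by
    simp only [h.fhat_eq_mul hβ1 hz0, Pi.mul_apply, Pi.inv_apply, isPeriodic_fourier _ k i]
  have hint := fun {L : List (Fin d)} (hL : L.length ≤ nd d) =>
    integrableOn_dlist hd (by positivity) hc hs hL
  refine ⟨h.wellDefined hd, hc, fun α hα => ?_⟩
  rw [← length_multiList] at hα ⊢
  rw [nabla_eq_dlist]
  refine ⟨(hint hα).1, (hint hα).2.trans ?_, fun φ hφ => ?_⟩
  · rw [add_mul]
    exact le_trans (le_of_eq (by ring)) (le_add_of_nonneg_right (by positivity))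
  · rw [nabla_eq_dlist, integral_dlist_mul (by omega) hper _ (hc.of_le (by exact_mod_cast hα))
      (fun M hM => (hint (hM.trans hα)).1) hφ.1 hφ.2, dlist_perm hφ.1 (List.reverse_perm _),
      ← mul_assoc, ← mul_pow]
    simp
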